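/- **Setting.** Let $(\mathfrak X,\mathcal X)$ be a measurable space and let $\mathcal H$ be a reproducing kernel Hilbert space of real functions on $\mathfrak X$ whose kernel $\mathrm{ker}$ is bounded ($\sup_x\sqrt{\mathrm{ker}(x,x)}<\infty$) and measurable ($\mathrm{ker}(\cdot,x)$ is measurable for each $x$). Let $\mathcal M_b(\mathfrak X,\mathcal X)$ be the space of finite signed measures and let $\mu:\mathcal M_b(\mathfrak X,\mathcal X)\to\mathcal H$, $\mu(Q)=\int \mathrm{ker}(\cdot,x)\,dQ(x)$, be the kernel mean embedding. For probability measures $P,Q$ let $D_{\mathrm{MMD}}(P,Q)=\sup_{h\in\mathcal H,\|h\|=1}|\int h\,dP-\int h\,dQ|$. Let $\Theta\subset\mathbb R^q$ be compact and let $\{P_\theta\}_{\theta\in\Theta}$ be probability measures on $\mathfrak X$ with densities $p(\cdot|\theta)\ge 0$ with respect to a measure $\lambda$. To give a meaning to derivatives at boundary points, $p(x|\theta)$ is defined for $\theta$ in an open set $U\supset\Theta$, with $p(\cdot|\theta)$ $\lambda$-integrable and real-valued for $\theta\in U$. For a multi-index $\alpha\in\mathbb N^q$, $D^\alpha$ is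 the partial derivative in $\theta$. For $k\ge1$, $\mathcal E_k(\Theta)$ and $\mathcal G_k(\Theta)$ are the sets of discrete probability measures on $\Theta$ with exactly, respectively at most, $k$ atoms. For $G=\sum_i p_i\delta_{\theta_i}$ put $P_G=\sum_i p_iP_{\theta_i}$ and $G\phi=\sum_i p_i\phi(\theta_i)$. $W_r$ is the Wasserstein-$r$ distance for the Euclidean distance. The MMD class is $\Phi_1=\{\theta\mapsto\int f\,dP_\theta : f\in\mathcal H,\ \|f\|\le1\}$, whose members are extended to $U$ by $\theta\mapsto\int f(x)p(x|\theta)\,d\lambda(x)$; thus $\sup_{\phi\in\Phi_1}|G\phi-H\phi|=D_{\mathrm{MMD}}(P_G,P_H)$ for $G,H\in\mathcal G_k(\Theta)$. **Definitions.** Let $m\geq 1$ and $1\le k_0\le k$ be integers. *Assumption $A2(m)$.* (i) For $\lambda$-a.e. $x$, $p(x|\cdot)$ is $m$ times continuously differentiable on $U$. (ii) For all $|\gamma|\le m-1$, $i\in\{1,\dots,q\}$ and $\theta\in U$ there are $\delta>0$ and a $\lambda$-integrable $\psi$ such that for each real $t$ with $0<|t|<\delta$, $\left|\frac{D^\gamma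 p(x|\theta+te_i)-D^\gamma p(x|\theta)}{t}\right|\le\psi(x)$ for $\lambda$-a.e. $x$. (iii) For all $|\gamma|=m$ and $\theta\in U$ there are $\delta>0$ and a $\lambda$-integrable $\psi$ such that for each $v\in\mathbb R^q$ with $0<\|v\|<\delta$, $|D^\gamma p(x|\theta+v)-D^\gamma p(x|\theta)|\le\psi(x)$ for $\lambda$-a.e. $x$. *Linear independence.* A set $\Phi$ of real functions on $U$ is an *$(m,k_0,k)$ linear independent domain* if each $\phi\in\Phi$ is $m$ times continuously differentiable on $U$ and, for every integer $\ell\in[k_0,2k-k_0]$, all integers $1\le m_1,\dots,m_\ell\le m+1$ with $2k_0\le\sum_i m_i\le2k$, and all distinct $\theta_1,\dots,\theta_\ell\in\Theta$, real coefficients $a_{i\alpha}$ ($i\leq \ell$, $|\alpha|<m_i$) satisfy $$\sum_{i=1}^\ell\sum_{|\alpha|<m_i}a_{i\alpha}D^\alpha\phi(\theta_i)=0\ \ \forall\phi\in\Phi\quad\text{and}\quad\sum_{i=1}^\ell a_{i\mathbf 0}=0$$ if and only if all $a_{i\alpha}$ vanish. The family $\{p(x|\theta)\}$ is *$(m,k_0,k)$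 linear independent* if for $\lambda$-a.e. $x$ the function $p(x|\cdot)$ is $m$ times continuously differentiable on $U$ and the same equivalence holds with the first condition replaced by $\sum_i\sum_{|\alpha|<m_i}a_{i\alpha}D^\alpha p(x|\theta_i)=0$ for $\lambda$-a.e. $x$. **Lemma.** Suppose that $\Theta$ is compact and that $\mu$ is injective on $\mathcal M_b(\mathfrak X,\mathcal X)$. Let $k\geq 1$. (a) Let $1\le k_0\le k$ and $d_1=k-k_0+1$. If $\{p(x|\theta)\}$ satisfies $A2(2d_1-1)$ and is $(2d_1-1,k_0,k)$ linear independent, then $\Phi_1$ is a $(2d_1-1,k_0,k)$ linear independent domain, and for every $G_0\in\mathcal E_{k_0}(\Theta)$ $$\liminf_{\substack{G,H\to G_0\text{ in }W_1\\ G\ne H\in\mathcal G_k(\Theta)}}\frac{D_{\mathrm{MMD}}(P_G,P_H)}{W_{2d_1-1}^{2d_1-1}(G,H)}>0 .$$ (b) If $\{p(x|\theta)\}$ satisfies $A2(2k-1)$ and is $(2k-1,1,k)$ linear independent, then $\Phi_1$ is a $(2k-1,1,k)$ linear independent domain. If moreover $G\mapsto P_G$ is injective on $\mathcal G_k(\Theta)$,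 then $$\inf_{G\ne H\in\mathcal G_k(\Theta)}\frac{D_{\mathrm{MMD}}(P_G,P_H)}{W_{2k-1}^{2k-1}(G,H)}>0 .$$ (The infimum and the lower limit over an empty set of pairs are $+\infty$.) -/

import Mathlib

open MeasureTheory Filter Topology
open scoped ENNReal

noncomputable section

namespace MMDMixture

/-! ### Reproducing kernel Hilbert spaces of real functions and the kernel mean embedding -/

section Kernel

variable {X : Type*} (H : Type*) [NormedAddCommGroup H] [InnerProductSpace ℝ H] [CompleteSpace H]
  [RKHS ℝ H X ℝ]

/-- The real-valued reproducing kernel `ker (x, y)` of the RKHS `H` of real functions on `X`. -/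
def ker (x y : X) : ℝ := RKHS.kernel H x y 1

/-- The function `ker (·, x)`, as an element of `H`. -/
def kerSection (x : X) : H := RKHS.kerFun H x 1

variable {H}

theorem kerSection_apply (x y : X) : kerSection H x y = ker H y x :=
  RKHS.kerFun_apply H x 1 y

/-- The reproducing property. -/
theorem inner_kerSection (x : X) (h : H) : inner ℝ (kerSection H x) h = h x := by
  simp [kerSection]

variable (H)

/-- The kernel of `H` is bounded and measurable. -/
structure BoundedMeasurableKernel [MeasurableSpace X] : Prop where
  measurable : ∀ x : X, Measurable fun y : X => ker H y x
  bounded : ∃ C : ℝ, ∀ x : X, Real.sqrt (ker H x x) ≤ C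

variable {H}

theorem norm_kerSection (x : X) : ‖kerSection H x‖ = Real.sqrt (ker H x x) := by
  rw [← kerSection_apply, ← inner_kerSection, real_inner_self_eq_norm_sq,
    Real.sqrt_sq (norm_nonneg _)]

theorem abs_apply_le (h : H) (x : X) : |h x| ≤ Real.sqrt (ker H x x) * ‖h‖ := by
  rw [← inner_kerSection, ← norm_kerSection]
  exact abs_real_inner_le_norm _ _

/-- If the kernel is measurable then every member of `H` is a measurable function. -/
theorem BoundedMeasurableKernel.measurable_apply [MeasurableSpace X]
    (hH : BoundedMeasurableKernel H) (h : H) : Measurable fun x : X => h x := by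
  have key : h ∈ closure ((Submodule.span ℝ {RKHS.kerFun H x v | (x : X) (v : ℝ)} :
      Submodule ℝ H) : Set H) := by
    have := RKHS.kerFun_dense (𝕜 := ℝ) (X := X) (V := ℝ) H
    rw [← Submodule.topologicalClosure_coe, this]
    trivial
  obtain ⟨u, hu, hlim⟩ := mem_closure_iff_seq_limit.1 key
  have hspan : ∀ g ∈ Submodule.span ℝ {RKHS.kerFun H x v | (x : X) (v : ℝ)},
      Measurable fun x : X => (g : H) x := by
    intro g hg
    induction hg using Submodule.span_induction with
    | mem g hg =>
      obtain ⟨x, v, rfl⟩ := hg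
      have : ∀ y : X, (RKHS.kerFun H x v) y = v * ker H y x := by
        intro y
        have hv : RKHS.kerFun H x v = v • kerSection H x := by
          rw [kerSection, ← map_smul, smul_eq_mul, mul_one]
        rw [hv, RKHS.coe_smul, Pi.smul_apply, kerSection_apply, smul_eq_mul]
      simp_rw [this]
      exact (hH.measurable x).const_mul v
    | zero => simp
    | add a b _ _ ha hb =>
      rw [RKHS.coe_add]
      exact ha.add hb
    | smul c a _ ha =>
      rw [RKHS.coe_smul]
      exact ha.const_smul c
  refine measurable_of_tendsto_metrizable (fun n => hspan (u n) (hu n)) ?_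
  rw [tendsto_pi_nhds]
  intro x
  exact ((RKHS.continuous_eval (𝕜 := ℝ) (V := ℝ) (H := H) x).tendsto h).comp hlim

theorem BoundedMeasurableKernel.integrable [MeasurableSpace X]
    (hH : BoundedMeasurableKernel H) (ν : Measure X) [IsFiniteMeasure ν] (h : H) :
    Integrable (fun x : X => h x) ν := by
  obtain ⟨C, hC⟩ := hH.bounded
  refine Integrable.of_bound (hH.measurable_apply h).aestronglyMeasurable (C * ‖h‖)
    (Eventually.of_forall fun x => ?_)
  exact (abs_apply_le h x).trans (mul_le_mul_of_nonneg_right (hC x) (norm_nonneg h))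

/-- The integral `∫ f dQ` against a finite signed measure, through the Jordan decomposition. -/
def signedIntegral [MeasurableSpace X] (Q : SignedMeasure X) (f : X → ℝ) : ℝ :=
  ∫ x, f x ∂Q.toJordanDecomposition.posPart - ∫ x, f x ∂Q.toJordanDecomposition.negPart

/-- The bounded linear functional `h ↦ ∫ h dQ` on `H`. -/
def integralFunctional [MeasurableSpace X] (hH : BoundedMeasurableKernel H)
    (Q : SignedMeasure X) : StrongDual ℝ H :=
  LinearMap.mkContinuousOfExistsBound
    { toFun := fun h => signedIntegral Q fun x => h x
      map_add' := fun a b => by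
        simp only [signedIntegral, RKHS.coe_add, Pi.add_apply]
        rw [integral_add (hH.integrable _ a) (hH.integrable _ b),
          integral_add (hH.integrable _ a) (hH.integrable _ b)]
        ring
      map_smul' := fun c a => by
        simp only [signedIntegral, RKHS.coe_smul, Pi.smul_apply, smul_eq_mul, RingHom.id_apply]
        rw [integral_const_mul, integral_const_mul]
        ring }
    (by
      obtain ⟨C, hC⟩ := hH.bounded
      refine ⟨C * Q.toJordanDecomposition.posPart.real Set.univ +
        C * Q.toJordanDecomposition.negPart.real Set.univ, fun h => ?_⟩
      have hb : ∀ (ν : Measure X) [IsFiniteMeasure ν],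
          ‖∫ x, h x ∂ν‖ ≤ C * ‖h‖ * ν.real Set.univ := fun ν _ =>
        norm_integral_le_of_norm_le_const (Eventually.of_forall fun x =>
          (abs_apply_le h x).trans (mul_le_mul_of_nonneg_right (hC x) (norm_nonneg h)))
      refine (norm_sub_le _ _).trans ?_
      have h1 := hb Q.toJordanDecomposition.posPart
      have h2 := hb Q.toJordanDecomposition.negPart
      linarith)

/-- The kernel mean embedding `μ` from finite signed measures on `X` to `H`: the Riesz
representative of `h ↦ ∫ h dQ`. By `meanEmbedding_apply`, `μ(Q)(y) = ∫ ker (y, x) dQ(x)`. -/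
def meanEmbedding [MeasurableSpace X] (hH : BoundedMeasurableKernel H)
    (Q : SignedMeasure X) : H :=
  (InnerProductSpace.toDual ℝ H).symm (integralFunctional hH Q)

theorem inner_meanEmbedding [MeasurableSpace X] (hH : BoundedMeasurableKernel H)
    (Q : SignedMeasure X) (h : H) :
    inner ℝ (meanEmbedding hH Q) h = signedIntegral Q fun x => h x := by
  rw [meanEmbedding, InnerProductSpace.toDual_symm_apply]
  rfl

theorem meanEmbedding_apply [MeasurableSpace X] (hH : BoundedMeasurableKernel H)
    (Q : SignedMeasure X) (y : X) :
    meanEmbedding hH Q y = signedIntegral Q fun x => ker H y x := by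
  rw [← inner_kerSection, real_inner_comm, inner_meanEmbedding]
  congr 1
  funext x
  rw [← inner_kerSection, real_inner_comm, inner_kerSection, kerSection_apply]

variable (H)

/-- The maximum mean discrepancy between `P` and `Q`:
`sup {|∫ h dP - ∫ h dQ| : h ∈ H, ‖h‖ = 1}`. -/
def mmd [MeasurableSpace X] (P Q : Measure X) : ℝ≥0∞ :=
  ⨆ (h : H) (_ : ‖h‖ = 1), ENNReal.ofReal |∫ x, h x ∂P - ∫ x, h x ∂Q|

end Kernel

/-! ### Partial derivatives and multi-indices -/

/-- The parameter space `ℝ^q` with its Euclidean norm. -/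
abbrev Param (q : ℕ) : Type := EuclideanSpace ℝ (Fin q)

variable {q : ℕ}

/-- The partial derivative in the `i`-th coordinate. -/
def partialDeriv (i : Fin q) (f : Param q → ℝ) : Param q → ℝ :=
  fun θ => lineDeriv ℝ f θ (EuclideanSpace.single i 1)

/-- `D^α f`: the partial derivative of order `α i` in the `i`-th coordinate, for every `i`. -/
def multiDeriv (α : Fin q → ℕ) (f : Param q → ℝ) : Param q → ℝ :=
  (List.finRange q).foldr (fun i g => (partialDeriv i)^[α i] g) f

/-- The multi-indices `α` with `|α| < n`. -/
def multiIndices (q n : ℕ) : Finset (Fin q → ℕ) :=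
  {α ∈ Fintype.piFinset fun _ : Fin q => Finset.range n | ∑ i, α i < n}

theorem mem_multiIndices {n : ℕ} {α : Fin q → ℕ} : α ∈ multiIndices q n ↔ ∑ i, α i < n := by
  simp only [multiIndices, Finset.mem_filter, Fintype.mem_piFinset, Finset.mem_range,
    and_iff_right_iff_imp]
  intro h i
  exact (Finset.single_le_sum (fun j _ => Nat.zero_le (α j)) (Finset.mem_univ i)).trans_lt h

/-! ### Finitely supported mixing measures -/

/-- Finitely supported weights on `ℝ^q`; `G` stands for the discrete measure `∑ G(θ) δ_θ`. -/
abbrev Weights (q : ℕ) : Type := Param q →₀ ℝ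

/-- The discrete probability measures with finitely many atoms, all of them in `Θ`. -/
def mixing (Θ : Set (Param q)) : Set (Weights q) :=
  {G | (∀ θ, 0 ≤ G θ) ∧ ∑ θ ∈ G.support, G θ = 1 ∧ (G.support : Set (Param q)) ⊆ Θ}

/-- `𝓔_k(Θ)`: exactly `k` atoms. -/
def mixingExactly (k : ℕ) (Θ : Set (Param q)) : Set (Weights q) :=
  {G ∈ mixing Θ | G.support.card = k}

/-- `𝓖_k(Θ)`: at most `k` atoms. -/
def mixingAtMost (k : ℕ) (Θ : Set (Param q)) : Set (Weights q) :=
  {G ∈ mixing Θ | G.support.card ≤ k}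

/-- `G φ = ∫ φ dG`. -/
def integrate (G : Weights q) (φ : Param q → ℝ) : ℝ := ∑ θ ∈ G.support, G θ * φ θ

/-- The mixture distribution `P_G = ∑ G(θ) P_θ`. -/
def mixture {X : Type*} [MeasurableSpace X] (P : Param q → Measure X) (G : Weights q) :
    Measure X :=
  ∑ θ ∈ G.support, ENNReal.ofReal (G θ) • P θ

/-- The couplings of `G` and `G'`, as matrices of masses on pairs of atoms. -/
def couplings (G G' : Weights q) : Set (Param q → Param q → ℝ) :=
  {c | (∀ a b, 0 ≤ c a b) ∧ (∀ a ∈ G.support, ∑ b ∈ G'.support, c a b = G a) ∧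
    ∀ b ∈ G'.support, ∑ a ∈ G.support, c a b = G' b}

/-- The Wasserstein-`r` distance with respect to the Euclidean distance. -/
def wasserstein (r : ℕ) (G G' : Weights q) : ℝ :=
  (⨅ c : couplings G G', ∑ a ∈ G.support, ∑ b ∈ G'.support, c.1 a b * ‖a - b‖ ^ r) ^
    (1 / (r : ℝ))

/-- The deviation `sup {|G φ - G' φ| : φ ∈ Φ}`. -/
def testDistance (Φ : Set (Param q → ℝ)) (G G' : Weights q) : ℝ≥0∞ :=
  ⨆ φ ∈ Φ, ENNReal.ofReal |integrate G φ - integrate G' φ|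

/-! ### Inverse bounds -/

/-- The ratio `D(G, G') / W_r^r(G, G')`. -/
def inverseRatio (D : Weights q → Weights q → ℝ≥0∞) (r : ℕ) (G G' : Weights q) : ℝ≥0∞ :=
  D G G' / ENNReal.ofReal (wasserstein r G G' ^ r)

/-- `G, G' → G₀` in `W₁` with `G ≠ G'` in `𝓖_k(Θ)`. -/
def pairsTendingTo (Θ : Set (Param q)) (k : ℕ) (G₀ : Weights q) :
    Filter (Weights q × Weights q) :=
  (comap (fun G => wasserstein 1 G G₀) (𝓝 0) ×ˢ comap (fun G => wasserstein 1 G G₀) (𝓝 0)) ⊓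
    𝓟 {GG | GG.1 ∈ mixingAtMost k Θ ∧ GG.2 ∈ mixingAtMost k Θ ∧ GG.1 ≠ GG.2}

/-- The local inverse bound at `G₀` for a deviation `D`, with exponent `r`. -/
def LocalInverseBound (D : Weights q → Weights q → ℝ≥0∞) (Θ : Set (Param q)) (k r : ℕ)
    (G₀ : Weights q) : Prop :=
  0 < liminf (fun GG => inverseRatio D r GG.1 GG.2) (pairsTendingTo Θ k G₀)

/-- The global inverse bound for a deviation `D`, with exponent `r`. -/
def GlobalInverseBound (D : Weights q → Weights q → ℝ≥0∞) (Θ : Set (Param q)) (k r : ℕ) : Prop :=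
  0 < ⨅ (G ∈ mixingAtMost k Θ) (G' ∈ mixingAtMost k Θ) (_ : G ≠ G'), inverseRatio D r G G'

/-! ### Linear independence and domination conditions

In this part `U` is an open set that contains the parameter set `Θ`. The functions of the
parameter are defined on `U`, which gives a meaning to their derivatives on all of `Θ`. -/

/-- `Φ` is an `(m, k₀, k)` linear independent domain. -/
structure LinearIndependentDomain (Φ : Set (Param q → ℝ)) (Θ U : Set (Param q))
    (m k₀ k : ℕ) : Prop where
  contDiffOn : ∀ φ ∈ Φ, ContDiffOn ℝ m φ U
  independent : ∀ l : ℕ, k₀ ≤ l → l ≤ 2 * k - k₀ → ∀ ord : Fin l → ℕ,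
    (∀ i, 1 ≤ ord i ∧ ord i ≤ m + 1) → 2 * k₀ ≤ ∑ i, ord i → ∑ i, ord i ≤ 2 * k →
    ∀ θ : Fin l → Param q, Function.Injective θ → (∀ i, θ i ∈ Θ) →
    ∀ a : Fin l → (Fin q → ℕ) → ℝ,
      ((∀ φ ∈ Φ, ∑ i, ∑ α ∈ multiIndices q (ord i), a i α * multiDeriv α φ (θ i) = 0) ∧
        ∑ i, a i 0 = 0) ↔
      ∀ i, ∀ α ∈ multiIndices q (ord i), a i α = 0

variable {X : Type*} [MeasurableSpace X]

/-- The family `p(x | θ)` (written `p θ x`) is `(m, k₀, k)` linear independent, up to null sets of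
the dominating measure `ν`. -/
structure LinearIndependentFamily (ν : Measure X) (p : Param q → X → ℝ) (Θ U : Set (Param q))
    (m k₀ k : ℕ) : Prop where
  contDiffOn : ∀ᵐ x ∂ν, ContDiffOn ℝ m (fun θ => p θ x) U
  independent : ∀ l : ℕ, k₀ ≤ l → l ≤ 2 * k - k₀ → ∀ ord : Fin l → ℕ,
    (∀ i, 1 ≤ ord i ∧ ord i ≤ m + 1) → 2 * k₀ ≤ ∑ i, ord i → ∑ i, ord i ≤ 2 * k →
    ∀ θ : Fin l → Param q, Function.Injective θ → (∀ i, θ i ∈ Θ) →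
    ∀ a : Fin l → (Fin q → ℕ) → ℝ,
      ((∀ᵐ x ∂ν, ∑ i, ∑ α ∈ multiIndices q (ord i),
          a i α * multiDeriv α (fun η => p η x) (θ i) = 0) ∧
        ∑ i, a i 0 = 0) ↔
      ∀ i, ∀ α ∈ multiIndices q (ord i), a i α = 0

/-- The regularity assumption of order `m` on the densities: continuous derivatives up to order
`m`, locally dominated difference quotients of the derivatives of order less than `m`, and locally
dominated increments of the derivatives of order `m`. -/
structure DominatedDerivatives (ν : Measure X) (p : Param q → X → ℝ) (U : Set (Param q))
    (m : ℕ) : Prop where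
  contDiffOn : ∀ᵐ x ∂ν, ContDiffOn ℝ m (fun θ => p θ x) U
  quotient : ∀ γ : Fin q → ℕ, ∑ j, γ j < m → ∀ i : Fin q, ∀ θ ∈ U,
    ∃ δ > 0, ∃ ψ : X → ℝ, Integrable ψ ν ∧ ∀ t : ℝ, 0 < |t| → |t| < δ → ∀ᵐ x ∂ν,
      |(multiDeriv γ (fun η => p η x) (θ + t • EuclideanSpace.single i 1) -
        multiDeriv γ (fun η => p η x) θ) / t| ≤ ψ x
  increment : ∀ γ : Fin q → ℕ, ∑ j, γ j = m → ∀ θ ∈ U,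
    ∃ δ > 0, ∃ ψ : X → ℝ, Integrable ψ ν ∧ ∀ v : Param q, 0 < ‖v‖ → ‖v‖ < δ → ∀ᵐ x ∂ν,
      |multiDeriv γ (fun η => p η x) (θ + v) - multiDeriv γ (fun η => p η x) θ| ≤ ψ x

/-! ### The statistical model and its MMD class -/

/-- `P θ`, for `θ ∈ Θ`, is a family of probability measures with densities `p θ` with respect to
`ν`, and the functions `p θ` extend to parameters in the open set `U ⊇ Θ` as `ν`-integrable
functions (which need not be probability densities outside `Θ`). -/
structure DensityModel (ν : Measure X) (p : Param q → X → ℝ) (P : Param q → Measure X)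
    (Θ U : Set (Param q)) : Prop where
  isOpen : IsOpen U
  subset : Θ ⊆ U
  integrable : ∀ θ ∈ U, Integrable (p θ) ν
  nonneg : ∀ θ ∈ Θ, ∀ᵐ x ∂ν, 0 ≤ p θ x
  isProbability : ∀ θ ∈ Θ, IsProbabilityMeasure (P θ)
  density : ∀ θ ∈ Θ, P θ = ν.withDensity fun x => ENNReal.ofReal (p θ x)

/-- The MMD class: the functions `θ ↦ ∫ f dP_θ`, for `f` in the unit ball of `H`. They are written
with the densities, so that they are defined on `U`; see `DensityModel.integral_eq`. -/
def mmdClass (H : Type*) [NormedAddCommGroup H] [InnerProductSpace ℝ H] [RKHS ℝ H X ℝ]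
    (ν : Measure X) (p : Param q → X → ℝ) : Set (Param q → ℝ) :=
  {φ | ∃ f : H, ‖f‖ ≤ 1 ∧ φ = fun θ => ∫ x, f x * p θ x ∂ν}

/-- On `Θ` the members of the MMD class are the functions `θ ↦ ∫ f dP_θ`. -/
theorem DensityModel.integral_eq {ν : Measure X} {p : Param q → X → ℝ}
    {P : Param q → Measure X} {Θ U : Set (Param q)} (hM : DensityModel ν p P Θ U)
    (f : X → ℝ) {θ : Param q} (hθ : θ ∈ Θ) :
    ∫ x, f x * p θ x ∂ν = ∫ x, f x ∂(P θ) := by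
  have hint := (hM.integrable θ (hM.subset hθ))
  rw [hM.density θ hθ, integral_withDensity_eq_integral_toReal_smul₀
    hint.aestronglyMeasurable.aemeasurable.ennreal_ofReal
    (Eventually.of_forall fun x => ENNReal.ofReal_lt_top)]
  refine integral_congr_ae ?_
  filter_upwards [hM.nonneg θ hθ] with x hx
  rw [ENNReal.toReal_ofReal hx, smul_eq_mul, mul_comm]

end MMDMixture

end

open MeasureTheory Filter Topology
open scoped ENNReal

noncomputable section

namespace MMDMixture

/-! ### Calculus of iterated partial derivatives -/

section Calculus

variable {q : ℕ} {U : Set (Param q)}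

/-! Write `G` and `H` as lists of `k` weighted atoms and let the `2k` atoms converge along an
ultrafilter; compactness of `Θ` makes this possible. Atoms with the same limit `θ_i` form a cluster
of size `m_i`. If `k₀` limit points attract atoms of both lists, counting gives `m_i ≤ 2(k - k₀ +
1)` and at most `2k - k₀` clusters. Let `M` be the sum of the absolute values of the moments of `G -
H` about the `θ_i`, taken in cluster `i` up to order `m_i - 1`. Two estimates compare `M` with the
two sides of the inverse bound.

Upper bound: `W_r^r(G, H) ≤ K M`, where `r + 1` bounds the cluster sizes
(`exists_wasserstein_pow_le`). Replace the distance by the single-linkage ultrametric of the atoms.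
For a power of an ultrametric, a cheapest plan moves between two points at most the excess mass of a
ball around the first, by an exchange argument (`exists_plan_le_abs_mass`). Such a ball is separated
from the other atoms by its radius `δ`, and a product of cutoffs at scale `δ` shows that its signed
mass is `O(δ^(-r) M)`.

Limit: `(Gφ - Hφ) / M` tends to `∑ b_{iα} / α! · D^α φ(θ_i)`, where the `b_{iα}` are the limits of
the normalized moments (`tendsto_sum_mul_div_of_moment`). Taylor remainders are negligible uniformly
in how the atoms collide. The reason is that `n` point evaluations are controlled by their moments
of order less than `n`, by iterating Hadamard's lemma (`abs_sum_mul_le_of_moment_le`). Since `∑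
|b_{iα}| = 1` and `∑ b_{i0} = 0`, linear independence yields a `φ` with nonzero limit, so `|Gφ - Hφ|
≥ c M ≥ c' W_r^r`.

Near `G₀` with `k₀` atoms, convergence in `W₁` forces every atom of `G₀` to be a limit of atoms of
both lists. For the global bound, either the limits of `G` and `H` agree, and one common atom plays
this role with `k₀ = 1`, or they differ and some `φ` separates them.

The passage from densities to the MMD class is differentiation under the integral: a linear relation
among derivatives of all `θ ↦ ∫ f p(·|θ)` says that a signed measure with density `∑ a D^α p` is
annihilated by `H`. Injectivity of the mean embedding makes this density vanish almost everywhere.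
-/

/-- The `i`-th coordinate vector. -/
abbrev coordVec (i : Fin q) : Param q := EuclideanSpace.single i 1

theorem partialDeriv_eq_fderiv {f : Param q → ℝ} {θ : Param q} (hf : DifferentiableAt ℝ f θ)
    (i : Fin q) : partialDeriv i f θ = fderiv ℝ f θ (coordVec i) :=
  hf.lineDeriv_eq_fderiv

theorem partialDeriv_congr {f g : Param q → ℝ} (hU : IsOpen U) (h : Set.EqOn f g U)
    (i : Fin q) : Set.EqOn (partialDeriv i f) (partialDeriv i g) U := fun _ hθ =>
  (h.eventuallyEq_of_mem (hU.mem_nhds hθ)).lineDeriv_eq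

theorem ContDiffOn.partialDeriv {f : Param q → ℝ} {n : ℕ} (hU : IsOpen U)
    (hf : ContDiffOn ℝ (n + 1 : ℕ) f U) (i : Fin q) :
    ContDiffOn ℝ n (MMDMixture.partialDeriv i f) U := by
  have h := (hf.fderiv_of_isOpen (m := n) hU (by norm_cast)).clm_apply
    (contDiffOn_const (c := coordVec i))
  refine h.congr fun θ hθ => partialDeriv_eq_fderiv ?_ i
  exact ((hf.differentiableOn (by norm_cast)) θ hθ).differentiableAt (hU.mem_nhds hθ)

theorem partialDeriv_comm {f : Param q → ℝ} (hU : IsOpen U) (hf : ContDiffOn ℝ 2 f U)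
    (i j : Fin q) :
    Set.EqOn (partialDeriv i (partialDeriv j f)) (partialDeriv j (partialDeriv i f)) U := by
  have hd : ∀ θ ∈ U, DifferentiableAt ℝ f θ := fun θ hθ =>
    ((hf.differentiableOn (by norm_num)) θ hθ).differentiableAt (hU.mem_nhds hθ)
  have hd2 : ∀ θ ∈ U, DifferentiableAt ℝ (fderiv ℝ f) θ := fun θ hθ =>
    (((hf.fderiv_of_isOpen (m := 1) hU (by norm_num)).differentiableOn
      (by norm_num)) θ hθ).differentiableAt (hU.mem_nhds hθ)
  have key : ∀ i j : Fin q, ∀ θ ∈ U, partialDeriv i (partialDeriv j f) θ =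
      fderiv ℝ (fderiv ℝ f) θ (coordVec i) (coordVec j) := by
    intro i j θ hθ
    have h1 : Set.EqOn (partialDeriv j f) (fun θ => fderiv ℝ f θ (coordVec j)) U :=
      fun θ hθ => partialDeriv_eq_fderiv (hd θ hθ) j
    rw [partialDeriv_congr hU h1 i hθ, partialDeriv_eq_fderiv ((hd2 θ hθ).clm_apply
      (differentiableAt_const _)) i, fderiv_clm_apply (hd2 θ hθ) (differentiableAt_const _)]
    simp
  intro θ hθ
  rw [key i j θ hθ, key j i θ hθ]
  exact ((hf.contDiffAt (hU.mem_nhds hθ)).isSymmSndFDerivAt (by simp)) _ _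

theorem iterate_partialDeriv_congr {f g : Param q → ℝ} (hU : IsOpen U) (h : Set.EqOn f g U)
    (i : Fin q) (a : ℕ) : Set.EqOn ((partialDeriv i)^[a] f) ((partialDeriv i)^[a] g) U := by
  induction a with
  | zero => exact h
  | succ a ih =>
    rw [Function.iterate_succ_apply', Function.iterate_succ_apply']
    exact partialDeriv_congr hU ih i

theorem contDiffOn_iterate_partialDeriv {f : Param q → ℝ} {n : ℕ} (hU : IsOpen U) (i : Fin q)
    (a : ℕ) (hf : ContDiffOn ℝ (n + a : ℕ) f U) :
    ContDiffOn ℝ n ((partialDeriv i)^[a] f) U := by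
  induction a generalizing n with
  | zero => exact hf
  | succ a ih =>
    rw [Function.iterate_succ_apply']
    refine ContDiffOn.partialDeriv hU (ih ?_) i
    rwa [add_right_comm]

theorem partialDeriv_iterate_comm {f : Param q → ℝ} (hU : IsOpen U) (i j : Fin q)
    (a : ℕ) (hf : ContDiffOn ℝ (a + 1 : ℕ) f U) :
    Set.EqOn (partialDeriv i ((partialDeriv j)^[a] f)) ((partialDeriv j)^[a] (partialDeriv i f))
      U := by
  induction a with
  | zero => exact fun _ _ => rfl
  | succ a ih =>
    rw [Function.iterate_succ_apply', Function.iterate_succ_apply']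
    refine (partialDeriv_comm hU ?_ i j).trans
      (partialDeriv_congr hU (ih (hf.of_le (by norm_cast; lia))) j)
    exact contDiffOn_iterate_partialDeriv hU j a (n := 2) (hf.of_le (by norm_cast; lia))

theorem contDiffOn_foldr_partialDeriv {f : Param q → ℝ} {n : ℕ} (hU : IsOpen U)
    (α : Fin q → ℕ) (L : List (Fin q)) (hf : ContDiffOn ℝ (n + (L.map α).sum : ℕ) f U) :
    ContDiffOn ℝ n (L.foldr (fun i g => (partialDeriv i)^[α i] g) f) U := by
  induction L generalizing n with
  | nil => exact hf
  | cons j L ih =>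
    refine contDiffOn_iterate_partialDeriv hU j _ (ih ?_)
    simpa [add_assoc] using hf

theorem foldr_partialDeriv_add_single_of_notMem {f : Param q → ℝ} (α : Fin q → ℕ) (i : Fin q)
    (L : List (Fin q)) (hi : i ∉ L) :
    L.foldr (fun j g => (partialDeriv j)^[(α + Pi.single i 1 : Fin q → ℕ) j] g) f =
      L.foldr (fun j g => (partialDeriv j)^[α j] g) f := by
  induction L with
  | nil => rfl
  | cons j L ih =>
    have hj : j ≠ i := fun h => hi (by simp [h])
    have hL : i ∉ L := fun h => hi (List.mem_cons_of_mem _ h)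
    simp only [List.foldr_cons, ih hL]
    simp [hj]

/-- The fold differentiates in a fixed order of the coordinates, so a new `∂_i` is commuted inwards
past the other coordinates until it reaches its own block, which is unique as `L` has no duplicates.
-/
theorem partialDeriv_foldr {f : Param q → ℝ} (hU : IsOpen U) (α : Fin q → ℕ) (i : Fin q)
    (L : List (Fin q)) (hL : L.Nodup) (hi : i ∈ L)
    (hf : ContDiffOn ℝ ((L.map α).sum + 1 : ℕ) f U) :
    Set.EqOn (partialDeriv i (L.foldr (fun j g => (partialDeriv j)^[α j] g) f))
      (L.foldr (fun j g => (partialDeriv j)^[(α + Pi.single i 1 : Fin q → ℕ) j] g) f) U := by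
  induction L with
  | nil => simp at hi
  | cons j L ih =>
    simp only [List.foldr_cons]
    simp only [List.nodup_cons] at hL
    simp only [List.map_cons, List.sum_cons] at hf
    rcases eq_or_ne i j with rfl | hij
    · rw [foldr_partialDeriv_add_single_of_notMem α i L hL.1]
      simp only [Pi.add_apply, Pi.single_eq_same, Function.iterate_succ_apply']
      exact fun _ _ => rfl
    · have hiL : i ∈ L := by simpa [hij] using hi
      have h1 : (α + Pi.single i 1 : Fin q → ℕ) j = α j := by simp [hij.symm]
      rw [h1]
      refine (partialDeriv_iterate_comm hU i j (α j) ?_).trans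
        (iterate_partialDeriv_congr hU (ih hL.2 hiL (hf.of_le (by norm_cast; lia))) j _)
      exact contDiffOn_foldr_partialDeriv hU α L (hf.of_le (by norm_cast; lia))

theorem sum_map_finRange (α : Fin q → ℕ) : ((List.finRange q).map α).sum = ∑ i, α i := by
  rw [← List.ofFn_eq_map, List.sum_ofFn]

theorem contDiffOn_multiDeriv {f : Param q → ℝ} {n : ℕ} (hU : IsOpen U) (α : Fin q → ℕ)
    (hf : ContDiffOn ℝ (n + ∑ i, α i : ℕ) f U) : ContDiffOn ℝ n (multiDeriv α f) U :=
  contDiffOn_foldr_partialDeriv hU α _ (by rwa [sum_map_finRange])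

theorem partialDeriv_multiDeriv {f : Param q → ℝ} {n : ℕ} (hU : IsOpen U)
    (hf : ContDiffOn ℝ n f U) (α : Fin q → ℕ) (hα : ∑ i, α i < n) (i : Fin q) :
    Set.EqOn (partialDeriv i (multiDeriv α f)) (multiDeriv (α + Pi.single i 1) f) U :=
  partialDeriv_foldr hU α i _ (List.nodup_finRange q) (List.mem_finRange i)
    (hf.of_le (by rw [sum_map_finRange]; norm_cast))

theorem multiDeriv_partialDeriv {f : Param q → ℝ} {n : ℕ} (hU : IsOpen U)
    (hf : ContDiffOn ℝ n f U) (α : Fin q → ℕ) (hα : ∑ i, α i < n) (i : Fin q) :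
    Set.EqOn (multiDeriv α (partialDeriv i f)) (multiDeriv (α + Pi.single i 1) f) U := by
  refine Set.EqOn.trans (fun θ hθ => Eq.symm ?_) (partialDeriv_multiDeriv hU hf α hα i)
  -- Here `∂_i` travels through every block down to `f` itself, so its membership in the list plays
  -- no role.
  have : ∀ L : List (Fin q), ContDiffOn ℝ ((L.map α).sum + 1 : ℕ) f U →
      Set.EqOn (partialDeriv i (L.foldr (fun j g => (partialDeriv j)^[α j] g) f))
        (L.foldr (fun j g => (partialDeriv j)^[α j] g) (partialDeriv i f)) U := by
    intro L
    induction L with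
    | nil => exact fun _ _ _ => rfl
    | cons j L ih =>
      intro hL
      simp only [List.map_cons, List.sum_cons] at hL
      simp only [List.foldr_cons]
      refine (partialDeriv_iterate_comm hU i j (α j) ?_).trans
        (iterate_partialDeriv_congr hU (ih (hL.of_le (by norm_cast; lia))) j _)
      exact contDiffOn_foldr_partialDeriv hU α L (hL.of_le (by norm_cast; lia))
  exact this _ (hf.of_le (by rw [sum_map_finRange]; norm_cast)) hθ

@[simp]
theorem multiDeriv_zero (f : Param q → ℝ) : multiDeriv 0 f = f := by
  unfold multiDeriv
  induction List.finRange q with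
  | nil => rfl
  | cons j L ih => exact ih

theorem sum_add_single (α : Fin q → ℕ) (i : Fin q) :
    ∑ j, (α + Pi.single i 1 : Fin q → ℕ) j = ∑ j, α j + 1 := by
  simp [Finset.sum_add_distrib]

/-- Induction on multi-indices, one coordinate at a time. -/
theorem multiIndex_induction {motive : (Fin q → ℕ) → Prop} (zero : motive 0)
    (add_single : ∀ α i, motive α → motive (α + Pi.single i 1)) (α : Fin q → ℕ) : motive α := by
  induction h : ∑ i, α i generalizing α with
  | zero =>
    have : α = 0 := by
      funext i
      simpa using (Finset.sum_eq_zero_iff.1 h) i (Finset.mem_univ i)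
    exact this ▸ zero
  | succ n ih =>
    obtain ⟨i, hi⟩ : ∃ i, α i ≠ 0 := by
      by_contra! hcon
      simp [hcon] at h
    have hα : α = (α - Pi.single i 1) + Pi.single i 1 := by
      funext j
      rcases eq_or_ne j i with rfl | hj
      · simp; lia
      · simp [hj]
    rw [hα]
    refine add_single _ _ (ih _ ?_)
    rw [hα, sum_add_single] at h
    lia

theorem multiDeriv_add {f g : Param q → ℝ} {n : ℕ} (hU : IsOpen U)
    (hf : ContDiffOn ℝ n f U) (hg : ContDiffOn ℝ n g U) (α : Fin q → ℕ) (hα : ∑ i, α i ≤ n) :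
    Set.EqOn (multiDeriv α fun θ => f θ + g θ)
      (fun θ => multiDeriv α f θ + multiDeriv α g θ) U := by
  induction α using multiIndex_induction with
  | zero =>
    simp only [multiDeriv_zero]
    exact fun _ _ => rfl
  | add_single α i ih =>
    rw [sum_add_single] at hα
    have h1 := partialDeriv_multiDeriv hU (hf.add hg) α hα i
    have hd : ∀ {f : Param q → ℝ}, ContDiffOn ℝ n f U → ∀ θ ∈ U,
        DifferentiableAt ℝ (multiDeriv α f) θ := fun hf θ hθ =>
      (((contDiffOn_multiDeriv (n := 1) hU α (hf.of_le (by norm_cast; lia))).differentiableOn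
        (by norm_num)) θ hθ).differentiableAt (hU.mem_nhds hθ)
    intro θ hθ
    refine (h1 hθ).symm.trans ?_
    rw [partialDeriv_congr hU (ih (by lia)) i hθ,
      partialDeriv_eq_fderiv ((hd hf θ hθ).fun_add (hd hg θ hθ)),
      fderiv_fun_add (hd hf θ hθ) (hd hg θ hθ), add_apply,
      ← partialDeriv_eq_fderiv (hd hf θ hθ), ← partialDeriv_eq_fderiv (hd hg θ hθ)]
    simp only
    rw [partialDeriv_multiDeriv hU hf α hα i hθ, partialDeriv_multiDeriv hU hg α hα i hθ]

theorem partialDeriv_const_mul (c : ℝ) (f : Param q → ℝ) (i : Fin q) :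
    partialDeriv i (fun θ => c * f θ) = fun θ => c * partialDeriv i f θ := by
  funext θ
  simp only [partialDeriv, lineDeriv]
  exact deriv_const_mul_field _

/-- Scalars over a field leave `deriv` even where the derivative has its default value, so no
smoothness is needed and the identity applies at every `x`, not only almost every one. -/
theorem multiDeriv_const_mul (c : ℝ) (f : Param q → ℝ) (α : Fin q → ℕ) :
    multiDeriv α (fun θ => c * f θ) = fun θ => c * multiDeriv α f θ := by
  have hit : ∀ (f : Param q → ℝ) (i : Fin q) (a : ℕ), (partialDeriv i)^[a] (fun θ => c * f θ) =
      fun θ => c * (partialDeriv i)^[a] f θ := by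
    intro f i a
    induction a with
    | zero => rfl
    | succ a ih =>
      rw [Function.iterate_succ_apply', Function.iterate_succ_apply', ih, partialDeriv_const_mul]
  unfold multiDeriv
  induction List.finRange q with
  | nil => rfl
  | cons j L ih =>
    simp only [List.foldr_cons, ih]
    exact hit _ _ _

theorem multiDeriv_sum {ι : Type*} (s : Finset ι) {f : ι → Param q → ℝ} {n : ℕ} (hU : IsOpen U)
    (hf : ∀ a ∈ s, ContDiffOn ℝ n (f a) U) (α : Fin q → ℕ) (hα : ∑ i, α i ≤ n) :
    Set.EqOn (multiDeriv α fun θ => ∑ a ∈ s, f a θ)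
      (fun θ => ∑ a ∈ s, multiDeriv α (f a) θ) U := by
  classical
  induction s using Finset.induction_on with
  | empty =>
    simp only [Finset.sum_empty]
    have := multiDeriv_const_mul 0 (0 : Param q → ℝ) α
    simp only [zero_mul] at this
    rw [this]
    exact fun _ _ => rfl
  | insert a s ha ih =>
    simp only [Finset.sum_insert ha]
    have hs : ∀ b ∈ s, ContDiffOn ℝ n (f b) U := fun b hb => hf b (Finset.mem_insert_of_mem hb)
    intro θ hθ
    rw [multiDeriv_add hU (hf a (Finset.mem_insert_self _ _)) (ContDiffOn.sum hs) α hα hθ]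
    simp only
    rw [ih hs hθ]

/-- Composition with an affine contraction. -/
theorem partialDeriv_comp_affine (h : Param q → ℝ) (s : ℝ) (y : Param q) (i : Fin q) :
    partialDeriv i (fun x => h (y + s • (x - y))) =
      fun x => s * partialDeriv i h (y + s • (x - y)) := by
  funext x
  simp only [partialDeriv, lineDeriv]
  have := deriv_comp_mul_left s (fun t : ℝ => h (y + s • (x - y) + t • coordVec i)) 0
  simp only [mul_zero, smul_eq_mul] at this
  rw [← this]
  congr 1
  funext t
  congr 1
  simp only [smul_sub, smul_add, smul_smul]
  abel

theorem multiDeriv_comp_affine (h : Param q → ℝ) (s : ℝ) (y : Param q) (α : Fin q → ℕ) :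
    multiDeriv α (fun x => h (y + s • (x - y))) =
      fun x => s ^ (∑ i, α i) * multiDeriv α h (y + s • (x - y)) := by
  have hit : ∀ (f : Param q → ℝ) (c : ℝ) (i : Fin q) (a : ℕ),
      (partialDeriv i)^[a] (fun x => c * f (y + s • (x - y))) =
        fun x => s ^ a * c * (partialDeriv i)^[a] f (y + s • (x - y)) := by
    intro f c i a
    induction a with
    | zero => simp
    | succ a ih =>
      rw [Function.iterate_succ_apply', Function.iterate_succ_apply', ih, partialDeriv_const_mul,
        partialDeriv_comp_affine]
      funext x
      ring
  rw [← sum_map_finRange]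
  unfold multiDeriv
  induction List.finRange q with
  | nil => simp
  | cons j L ih =>
    simp only [List.foldr_cons, ih, hit]
    funext x
    simp [pow_add]

end Calculus

/-! ### Mean value inequality along coordinates; smoothness from continuous partial derivatives -/

section Calculus

variable {q : ℕ} {U : Set (Param q)}

theorem sum_smul_coordVec (v : Param q) : ∑ i, v i • coordVec i = v := by
  ext j
  simp [coordVec, Finset.sum_apply, Pi.single_apply]

/-- This keeps the path that changes one coordinate at a time inside a ball. -/
theorem norm_sum_smul_coordVec_le (v : Param q) (s : Finset (Fin q)) :
    ‖∑ i ∈ s, v i • coordVec i‖ ≤ ‖v‖ := by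
  rw [EuclideanSpace.norm_eq, EuclideanSpace.norm_eq]
  refine Real.sqrt_le_sqrt (Finset.sum_le_sum fun j _ => ?_)
  have : (∑ i ∈ s, v i • coordVec i : Param q) j = if j ∈ s then v j else 0 := by
    simp [coordVec, Finset.sum_apply, Pi.single_apply]
  rw [this]
  split_ifs <;> simp [sq_nonneg]

theorem hasLineDerivAt_add_smul {f : Param q → ℝ} {θ v : Param q} {s d : ℝ}
    (h : HasLineDerivAt ℝ f d (θ + s • v) v) :
    HasDerivAt (fun t : ℝ => f (θ + t • v)) d s := by
  have h1 : HasDerivAt (fun t : ℝ => f (θ + s • v + t • v)) d (s - s) := by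
    rw [sub_self]; exact h
  have h2 := HasDerivAt.comp_sub_const s s h1
  refine h2.congr_of_eventuallyEq (Eventually.of_forall fun t => ?_)
  simp only [sub_smul]
  congr 1
  abel

/-- The mean value inequality in a coordinate direction. -/
theorem abs_sub_le_of_lineDeriv_le {f f' : Param q → ℝ} {B : Set (Param q)} (hB : Convex ℝ B)
    {i : Fin q} {C : ℝ} (h : ∀ x ∈ B, HasLineDerivAt ℝ f (f' x) x (coordVec i))
    (hC : ∀ x ∈ B, |f' x| ≤ C) {x : Param q} {t : ℝ} (hx : x ∈ B)
    (hxt : x + t • coordVec i ∈ B) : |f (x + t • coordVec i) - f x| ≤ C * |t| := by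
  have hmem : ∀ s ∈ Set.uIcc (0 : ℝ) t, x + s • coordVec i ∈ B := by
    intro s hs
    have : Convex ℝ ((fun s : ℝ => x + s • coordVec i) ⁻¹' B) := by
      intro a ha b hb c d hc hd hcd
      have := hB ha hb hc hd hcd
      simp only [Set.mem_preimage] at *
      convert this using 1
      have hx : x = c • x + d • x := by rw [← add_smul, hcd, one_smul]
      nth_rewrite 1 [hx]
      simp only [smul_add, add_smul, smul_smul, smul_eq_mul]
      abel
    refine this.segment_subset (x := 0) (y := t) (by simpa using hx) hxt ?_
    rwa [segment_eq_uIcc]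
  have := (convex_uIcc (0 : ℝ) t).norm_image_sub_le_of_norm_hasDerivWithin_le
    (f := fun s : ℝ => f (x + s • coordVec i)) (f' := fun s => f' (x + s • coordVec i))
    (fun s hs => (hasLineDerivAt_add_smul (h _ (hmem s hs))).hasDerivWithinAt)
    (fun s hs => hC _ (hmem s hs)) Set.left_mem_uIcc Set.right_mem_uIcc
  simpa using this

/-- A function with continuous partial derivatives is differentiable. -/
theorem hasFDerivAt_of_continuousOn_partial {f : Param q → ℝ} {g : Fin q → Param q → ℝ}
    (hU : IsOpen U) (hf : ∀ i, ∀ θ ∈ U, HasLineDerivAt ℝ f (g i θ) θ (coordVec i))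
    (hg : ∀ i, ContinuousOn (g i) U) {θ : Param q} (hθ : θ ∈ U) :
    HasFDerivAt f (∑ i, g i θ • (EuclideanSpace.proj i : Param q →L[ℝ] ℝ)) θ := by
  rw [hasFDerivAt_iff_isLittleO_nhds_zero, Asymptotics.isLittleO_iff]
  intro ε hε
  set L : Param q →L[ℝ] ℝ := ∑ i, g i θ • (EuclideanSpace.proj i : Param q →L[ℝ] ℝ) with hL
  -- The denominator `q + 1` shares `ε` among the coordinates and covers `q = 0`.
  have hε' : 0 < ε / (q + 1) := by positivity
  have hev : ∀ᶠ x in 𝓝 θ, x ∈ U ∧ ∀ i, |g i x - g i θ| < ε / (q + 1) := by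
    refine Filter.Eventually.and (hU.mem_nhds hθ) (eventually_all.2 fun i => ?_)
    have := ((hg i).continuousAt (hU.mem_nhds hθ)).tendsto
    exact (Metric.tendsto_nhds.1 this) _ hε'
  obtain ⟨ρ, hρ, hball⟩ := Metric.eventually_nhds_iff_ball.1 hev
  have hzero : ∀ᶠ v : Param q in 𝓝 0, ‖v‖ < ρ := by
    filter_upwards [Metric.ball_mem_nhds (0 : Param q) hρ] with v hv
    simpa using hv
  filter_upwards [hzero] with v hv
  have hmem : ∀ s : Finset (Fin q), θ + ∑ i ∈ s, v i • coordVec i ∈ Metric.ball θ ρ := by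
    intro s
    simpa using (norm_sum_smul_coordVec_le v s).trans_lt hv
  have hLi : ∀ i, L (coordVec i) = g i θ := by
    intro i
    simp [hL, coordVec]
  have hline : ∀ i, ∀ x ∈ Metric.ball θ ρ,
      HasLineDerivAt ℝ (fun x => f x - L x) (g i x - g i θ) x (coordVec i) := by
    intro i x hx
    have h1 := hf i x (hball x hx).1
    have h2 := L.hasFDerivAt.hasLineDerivAt (x := x) (coordVec i)
    rw [hLi] at h2
    exact HasDerivAt.sub h1 h2
  -- The partial derivatives of `f - L` are the increments `g i x - g i θ`, small on the ball;
  -- changing one coordinate at a time sums the resulting mean value bounds.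
  have key : ∀ s : Finset (Fin q),
      |(f (θ + ∑ i ∈ s, v i • coordVec i) - L (θ + ∑ i ∈ s, v i • coordVec i)) - (f θ - L θ)| ≤
        ∑ i ∈ s, ε / (q + 1) * |v i| := by
    intro s
    induction s using Finset.induction_on with
    | empty => simp
    | insert i s hi ih =>
      rw [Finset.sum_insert hi]
      have hm := hmem (insert i s)
      rw [Finset.sum_insert hi, add_comm (v i • _), ← add_assoc] at hm
      rw [Finset.sum_insert hi, add_comm (v i • _), ← add_assoc]
      have := abs_sub_le_of_lineDeriv_le (convex_ball θ ρ) (hline i)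
        (fun x hx => ((hball x hx).2 i).le) (hmem s) hm
      refine (abs_sub_le _ _ _).trans (add_le_add this ih)
  have h := key Finset.univ
  rw [sum_smul_coordVec] at h
  have hlin : f (θ + v) - f θ - L v = f (θ + v) - L (θ + v) - (f θ - L θ) := by
    rw [map_add]; ring
  rw [hlin, Real.norm_eq_abs]
  refine h.trans ?_
  calc ∑ i, ε / (q + 1) * |v i| ≤ ∑ i : Fin q, ε / (q + 1) * ‖v‖ := by
        gcongr with i
        exact PiLp.norm_apply_le v i
    _ = ε * ‖v‖ * (q / (q + 1)) := by simp; ring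
    _ ≤ ε * ‖v‖ * 1 := by
        gcongr
        rw [div_le_one (by positivity)]; linarith
    _ = ε * ‖v‖ := mul_one _

theorem contDiffOn_succ_of_partial {f : Param q → ℝ} {g : Fin q → Param q → ℝ} {n : ℕ}
    (hU : IsOpen U) (hf : ∀ i, ∀ θ ∈ U, HasLineDerivAt ℝ f (g i θ) θ (coordVec i))
    (hg : ∀ i, ContDiffOn ℝ n (g i) U) : ContDiffOn ℝ (n + 1 : ℕ) f U := by
  have hfd : ∀ θ ∈ U, HasFDerivAt f
      (∑ i, g i θ • (EuclideanSpace.proj i : Param q →L[ℝ] ℝ)) θ := fun θ hθ =>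
    hasFDerivAt_of_continuousOn_partial hU hf (fun i => (hg i).continuousOn) hθ
  push_cast
  rw [contDiffOn_succ_iff_hasFDerivWithinAt_of_uniqueDiffOn hU.uniqueDiffOn]
  refine ⟨by simp, _, ?_, fun θ hθ => (hfd θ hθ).hasFDerivWithinAt⟩
  exact ContDiffOn.sum fun i _ => (hg i).smul contDiffOn_const

theorem hasLineDerivAt_multiDeriv {f : Param q → ℝ} {n : ℕ} (hU : IsOpen U)
    (hf : ContDiffOn ℝ n f U) (α : Fin q → ℕ) (hα : ∑ i, α i < n) (i : Fin q) {θ : Param q}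
    (hθ : θ ∈ U) :
    HasLineDerivAt ℝ (multiDeriv α f) (multiDeriv (α + Pi.single i 1) f θ) θ (coordVec i) := by
  rw [← partialDeriv_multiDeriv hU hf α hα i hθ]
  refine LineDifferentiableAt.hasLineDerivAt (DifferentiableAt.lineDifferentiableAt ?_)
  exact (((contDiffOn_multiDeriv (n := 1) hU α (hf.of_le (by norm_cast; lia))).differentiableOn
    (by norm_num)) θ hθ).differentiableAt (hU.mem_nhds hθ)

end Calculus

/-! ### Differentiation of integrals that depend on a parameter -/

section ParametricIntegral

variable {q : ℕ} {U : Set (Param q)} {X : Type*} [MeasurableSpace X] {ν : Measure X}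
  {p : Param q → X → ℝ} {m : ℕ}

theorem eventually_add_smul_mem (hU : IsOpen U) {θ : Param q} (hθ : θ ∈ U) (v : Param q) :
    ∀ᶠ t : ℝ in 𝓝[≠] 0, θ + t • v ∈ U := by
  have : Tendsto (fun t : ℝ => θ + t • v) (𝓝 0) (𝓝 θ) :=
    Continuous.tendsto' (by fun_prop) 0 θ (by simp)
  exact (this.mono_left nhdsWithin_le_nhds).eventually (hU.mem_nhds hθ)

/-- Dominated convergence of the difference quotients. Integrability of the next derivative is part
of the conclusion, so that the argument can be iterated in the order of `γ`. -/
theorem DominatedDerivatives.hasLineDerivAt_integral (hU : IsOpen U)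
    (hp : DominatedDerivatives ν p U m) (γ : Fin q → ℕ) (hγ : ∑ j, γ j < m)
    (hint : ∀ θ ∈ U, Integrable (fun x => multiDeriv γ (fun η => p η x) θ) ν) (i : Fin q)
    {θ : Param q} (hθ : θ ∈ U) :
    Integrable (fun x => multiDeriv (γ + Pi.single i 1) (fun η => p η x) θ) ν ∧
      HasLineDerivAt ℝ (fun θ => ∫ x, multiDeriv γ (fun η => p η x) θ ∂ν)
        (∫ x, multiDeriv (γ + Pi.single i 1) (fun η => p η x) θ ∂ν) θ (coordVec i) := by
  obtain ⟨δ, hδ, ψ, hψ, hbound⟩ := hp.quotient γ hγ i θ hθ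
  set F : ℝ → X → ℝ := fun t x => (multiDeriv γ (fun η => p η x) (θ + t • coordVec i) -
        multiDeriv γ (fun η => p η x) θ) / t with hF
  have hlim : ∀ᵐ x ∂ν, Tendsto (fun t => F t x) (𝓝[≠] 0)
      (𝓝 (multiDeriv (γ + Pi.single i 1) (fun η => p η x) θ)) := by
    filter_upwards [hp.contDiffOn] with x hx
    have := hasLineDerivAt_iff_tendsto_slope_zero.1 (hasLineDerivAt_multiDeriv hU hx γ hγ i hθ)
    refine this.congr fun t => ?_
    simp only [hF, smul_eq_mul, div_eq_inv_mul]
  have hmeas : ∀ᶠ t : ℝ in 𝓝[≠] 0, AEStronglyMeasurable (F t) ν := by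
    filter_upwards [eventually_add_smul_mem hU hθ (coordVec i)] with t ht
    exact (((hint _ ht).sub (hint _ hθ)).div_const t).aestronglyMeasurable
  have hsmall : ∀ᶠ t : ℝ in 𝓝[≠] 0, 0 < |t| ∧ |t| < δ := by
    have h1 : ∀ᶠ t : ℝ in 𝓝[≠] 0, |t| < δ := by
      refine nhdsWithin_le_nhds ?_
      simpa [Metric.ball] using Metric.ball_mem_nhds (0 : ℝ) hδ
    filter_upwards [h1, self_mem_nhdsWithin] with t h1 h2
    exact ⟨abs_pos.2 h2, h1⟩
  have hdom : ∀ᶠ t : ℝ in 𝓝[≠] 0, ∀ᵐ x ∂ν, ‖F t x‖ ≤ ψ x := by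
    filter_upwards [hsmall] with t ht
    exact hbound t ht.1 ht.2
  have hInt : Integrable (fun x => multiDeriv (γ + Pi.single i 1) (fun η => p η x) θ) ν := by
    -- The exceptional null set of the bound depends on `t`; along a sequence the union of these
    -- sets is still null, and the limit inherits measurability and the bound `ψ`.
    obtain ⟨u, hu⟩ := exists_seq_tendsto (𝓝[≠] (0 : ℝ))
    obtain ⟨N, hN⟩ := eventually_atTop.1 (hu.eventually (hmeas.and hdom))
    have hu' : Tendsto (fun n => u (n + N)) atTop (𝓝[≠] 0) := hu.comp (tendsto_add_atTop_nat N)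
    have hlim' : ∀ᵐ x ∂ν, Tendsto (fun n => F (u (n + N)) x) atTop
        (𝓝 (multiDeriv (γ + Pi.single i 1) (fun η => p η x) θ)) := by
      filter_upwards [hlim] with x hx using hx.comp hu'
    refine Integrable.mono' hψ (aestronglyMeasurable_of_tendsto_ae atTop
      (fun n => (hN (n + N) (by lia)).1) hlim') ?_
    filter_upwards [hlim', ae_all_iff.2 fun n => (hN (n + N) (by lia)).2] with x hx hb
    exact le_of_tendsto hx.norm (Eventually.of_forall hb)
  refine ⟨hInt, ?_⟩
  rw [hasLineDerivAt_iff_tendsto_slope_zero]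
  refine (tendsto_integral_filter_of_dominated_convergence ψ hmeas hdom hψ hlim).congr' ?_
  filter_upwards [eventually_add_smul_mem hU hθ (coordVec i)] with t ht
  rw [hF, integral_div, integral_sub (hint _ ht) (hint _ hθ), smul_eq_mul, div_eq_inv_mul]

theorem DominatedDerivatives.integrable_multiDeriv (hU : IsOpen U)
    (hp : DominatedDerivatives ν p U m) (hint : ∀ θ ∈ U, Integrable (p θ) ν) (γ : Fin q → ℕ)
    (hγ : ∑ j, γ j ≤ m) :
    ∀ θ ∈ U, Integrable (fun x => multiDeriv γ (fun η => p η x) θ) ν := by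
  induction γ using multiIndex_induction with
  | zero => simpa using hint
  | add_single γ i ih =>
    rw [sum_add_single] at hγ
    exact fun θ hθ => (hp.hasLineDerivAt_integral hU γ hγ (ih (by lia)) i hθ).1

theorem DominatedDerivatives.continuousOn_integral (hU : IsOpen U)
    (hp : DominatedDerivatives ν p U m) (hint : ∀ θ ∈ U, Integrable (p θ) ν) (γ : Fin q → ℕ)
    (hγ : ∑ j, γ j = m) :
    ContinuousOn (fun θ => ∫ x, multiDeriv γ (fun η => p η x) θ ∂ν) U := by
  intro θ hθ
  refine ContinuousAt.continuousWithinAt ?_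
  obtain ⟨δ, hδ, ψ, hψ, hbound⟩ := hp.increment γ hγ θ hθ
  have hI := hp.integrable_multiDeriv hU hint γ hγ.le
  have hc : ContinuousAt
      (fun θ' => ∫ x, (multiDeriv γ (fun η => p η x) θ' - multiDeriv γ (fun η => p η x) θ) ∂ν)
      θ := by
    refine continuousAt_of_dominated (bound := fun x => |ψ x|) ?_ ?_ hψ.abs ?_
    · filter_upwards [hU.mem_nhds hθ] with η hη
      exact ((hI η hη).sub (hI θ hθ)).aestronglyMeasurable
    · filter_upwards [Metric.ball_mem_nhds θ hδ] with η hη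
      rcases eq_or_ne η θ with rfl | hne
      · exact Eventually.of_forall fun x => by simp
      · have h := hbound (η - θ) (norm_pos_iff.2 (sub_ne_zero.2 hne)) (mem_ball_iff_norm.1 hη)
        filter_upwards [h] with x hx
        rw [add_sub_cancel] at hx
        exact hx.trans (le_abs_self _)
    · filter_upwards [hp.contDiffOn] with x hx
      have := (contDiffOn_multiDeriv (n := 0) hU γ (hx.of_le (by norm_cast; lia))).continuousOn
      exact (this.continuousAt (hU.mem_nhds hθ)).sub continuousAt_const
  have h2 : ContinuousAt (fun θ' => (∫ x, (multiDeriv γ (fun η => p η x) θ' -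
      multiDeriv γ (fun η => p η x) θ) ∂ν) + ∫ x, multiDeriv γ (fun η => p η x) θ ∂ν) θ :=
    hc.add continuousAt_const
  refine h2.congr ?_
  filter_upwards [hU.mem_nhds hθ] with η hη
  rw [integral_sub (hI η hη) (hI θ hθ)]
  ring

/-- Descent from the top order: dominated increments give continuity at order `m`, and below it the
partial derivatives of the integral are the integrals of order one higher. -/
theorem DominatedDerivatives.contDiffOn_integral_multiDeriv (hU : IsOpen U)
    (hp : DominatedDerivatives ν p U m) (hint : ∀ θ ∈ U, Integrable (p θ) ν) (n : ℕ)
    (γ : Fin q → ℕ) (hγ : ∑ j, γ j + n = m) :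
    ContDiffOn ℝ n (fun θ => ∫ x, multiDeriv γ (fun η => p η x) θ ∂ν) U := by
  induction n generalizing γ with
  | zero => exact contDiffOn_zero.2 (hp.continuousOn_integral hU hint γ hγ)
  | succ n ih =>
    refine contDiffOn_succ_of_partial hU (fun i θ hθ => (hp.hasLineDerivAt_integral hU γ (by lia)
      (hp.integrable_multiDeriv hU hint γ (by lia)) i hθ).2) fun i => ih _ ?_
    rw [sum_add_single]; lia

theorem DominatedDerivatives.contDiffOn_integral (hU : IsOpen U)
    (hp : DominatedDerivatives ν p U m) (hint : ∀ θ ∈ U, Integrable (p θ) ν) :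
    ContDiffOn ℝ m (fun θ => ∫ x, p θ x ∂ν) U := by
  simpa using hp.contDiffOn_integral_multiDeriv hU hint m 0 (by simp)

theorem DominatedDerivatives.multiDeriv_integral (hU : IsOpen U)
    (hp : DominatedDerivatives ν p U m) (hint : ∀ θ ∈ U, Integrable (p θ) ν) (γ : Fin q → ℕ)
    (hγ : ∑ j, γ j ≤ m) :
    Set.EqOn (multiDeriv γ fun θ => ∫ x, p θ x ∂ν)
      (fun θ => ∫ x, multiDeriv γ (fun η => p η x) θ ∂ν) U := by
  induction γ using multiIndex_induction with
  | zero =>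
    simp only [multiDeriv_zero]
    exact fun _ _ => rfl
  | add_single γ i ih =>
    rw [sum_add_single] at hγ
    intro θ hθ
    rw [← partialDeriv_multiDeriv hU (hp.contDiffOn_integral hU hint) γ hγ i hθ,
      partialDeriv_congr hU (ih (by lia)) i hθ]
    exact (hp.hasLineDerivAt_integral hU γ hγ
      (hp.integrable_multiDeriv hU hint γ (by lia)) i hθ).2.lineDeriv

end ParametricIntegral

/-! ### Functions with bounded derivatives and signed combinations of point evaluations -/

section DerivBound

variable {q : ℕ} {B : Set (Param q)}

/-- `f` is `k` times continuously differentiable on `B` and all its partial derivatives up to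
order `k` are bounded there by `ε`. -/
structure DerivBound (f : Param q → ℝ) (B : Set (Param q)) (k : ℕ) (ε : ℝ) : Prop where
  contDiffOn : ContDiffOn ℝ k f B
  bound : ∀ γ : Fin q → ℕ, ∑ i, γ i ≤ k → ∀ x ∈ B, |multiDeriv γ f x| ≤ ε

theorem DerivBound.abs_le {f : Param q → ℝ} {k : ℕ} {ε : ℝ} (hf : DerivBound f B k ε)
    {x : Param q} (hx : x ∈ B) : |f x| ≤ ε := by
  simpa using hf.bound 0 (by simp) x hx

/-- Hadamard's lemma with bounds on the derivatives. -/
theorem DerivBound.exists_hadamard (hBo : IsOpen B) (hBc : Convex ℝ B) {f : Param q → ℝ} {k : ℕ}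
    {ε : ℝ} (hf : DerivBound f B (k + 1) ε) {y : Param q} (hy : y ∈ B) :
    ∃ g : Fin q → Param q → ℝ, (∀ c, DerivBound (g c) B k ε) ∧
      ∀ x ∈ B, f x = f y + ∑ c, (x c - y c) * g c x := by
  -- The factors are `g c x = ∫ ∂_c f(y + s(x - y)) ds` over `[0, 1]`. The results on parametric
  -- integrals apply with `s` as the sample point and `x` as the parameter.
  set p : Fin q → Param q → ℝ → ℝ := fun c x s => partialDeriv c f (y + s • (x - y)) with hp
  set ν : Measure ℝ := volume.restrict (Set.Ioc 0 1) with hν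
  have hν1 : ν.real Set.univ = 1 := by simp [hν]
  have hae : ∀ {Q : ℝ → Prop}, (∀ s ∈ Set.Icc (0 : ℝ) 1, Q s) → ∀ᵐ s ∂ν, Q s := by
    intro Q hQ
    exact (ae_restrict_iff' measurableSet_Ioc).2
      (Eventually.of_forall fun s hs => hQ s (Set.Ioc_subset_Icc_self hs))
  have hmem : ∀ x ∈ B, ∀ s ∈ Set.Icc (0 : ℝ) 1, y + s • (x - y) ∈ B := fun x hx s hs =>
    hBc.add_smul_sub_mem hy hx hs
  have hpc : ∀ c, ContDiffOn ℝ k (partialDeriv c f) B := fun c =>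
    ContDiffOn.partialDeriv hBo hf.contDiffOn c
  have hcd : ∀ c, ∀ s ∈ Set.Icc (0 : ℝ) 1, ContDiffOn ℝ k (fun x => p c x s) B := by
    intro c s hs
    refine (hpc c).comp (ContDiff.contDiffOn (by fun_prop)) fun x hx => hmem x hx s hs
  have hε : 0 ≤ ε := (abs_nonneg _).trans (hf.abs_le hy)
  have hbd : ∀ c, ∀ s ∈ Set.Icc (0 : ℝ) 1, ∀ γ : Fin q → ℕ, ∑ i, γ i ≤ k → ∀ x ∈ B,
      |multiDeriv γ (fun η => p c η s) x| ≤ ε := by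
    intro c s hs γ hγ x hx
    simp only [hp]
    -- The chain rule only contributes the factor `s ^ |γ| ≤ 1`, so the same `ε` serves for `g`.
    rw [multiDeriv_comp_affine (partialDeriv c f) s y γ]
    simp only
    rw [multiDeriv_partialDeriv hBo hf.contDiffOn γ (by lia) c (hmem x hx s hs), abs_mul,
      abs_of_nonneg (pow_nonneg hs.1 _)]
    have h1 := hf.bound (γ + Pi.single c 1) (by rw [sum_add_single]; lia) _ (hmem x hx s hs)
    exact (mul_le_of_le_one_left (abs_nonneg _) (pow_le_one₀ hs.1 hs.2)).trans h1
  have hdom : ∀ c, DominatedDerivatives ν (p c) B k := by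
    intro c
    refine ⟨hae (hcd c), fun γ hγ i θ hθ => ?_, fun γ hγ θ hθ => ?_⟩
    · obtain ⟨δ, hδ, hball⟩ := Metric.isOpen_iff.1 hBo θ hθ
      refine ⟨δ, hδ, fun _ => ε, integrable_const ε, fun t ht0 ht => hae fun s hs => ?_⟩
      have hθt : θ + t • coordVec i ∈ B := hball (by
        simpa [norm_smul] using ht)
      rw [abs_div, div_le_iff₀ ht0]
      exact abs_sub_le_of_lineDeriv_le hBc
        (fun x hx => hasLineDerivAt_multiDeriv hBo (hcd c s hs) γ hγ i hx)
        (fun x hx => hbd c s hs _ (by rw [sum_add_single]; lia) x hx) hθ hθt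
    · obtain ⟨δ, hδ, hball⟩ := Metric.isOpen_iff.1 hBo θ hθ
      refine ⟨δ, hδ, fun _ => ε + ε, integrable_const _, fun v hv0 hv => hae fun s hs => ?_⟩
      have hθv : θ + v ∈ B := hball (by simpa using hv)
      exact (abs_sub _ _).trans (add_le_add (hbd c s hs γ hγ.le _ hθv) (hbd c s hs γ hγ.le _ hθ))
  have hcont : ∀ c, ∀ x ∈ B, ContinuousOn (p c x) (Set.Icc 0 1) := by
    intro c x hx
    exact (hpc c).continuousOn.comp (by fun_prop) fun s hs => hmem x hx s hs
  have hint : ∀ c, ∀ x ∈ B, Integrable (p c x) ν := fun c x hx =>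
    ((hcont c x hx).integrableOn_Icc).mono_set Set.Ioc_subset_Icc_self
  refine ⟨fun c x => ∫ s, p c x s ∂ν, fun c => ⟨(hdom c).contDiffOn_integral hBo (hint c),
    fun γ hγ x hx => ?_⟩, fun x hx => ?_⟩
  · rw [(hdom c).multiDeriv_integral hBo (hint c) γ hγ hx]
    have := norm_integral_le_of_norm_le_const (μ := ν)
      (hae (Q := fun s => ‖multiDeriv γ (fun η => p c η s) x‖ ≤ ε)
        fun s hs => hbd c s hs γ hγ x hx)
    simpa [hν1] using this
  · have hder : ∀ s ∈ Set.uIcc (0 : ℝ) 1, HasDerivAt (fun s : ℝ => f (y + s • (x - y)))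
        (∑ c, (x c - y c) * p c x s) s := by
      intro s hs
      rw [Set.uIcc_of_le zero_le_one] at hs
      have hz := hmem x hx s hs
      have hd : DifferentiableAt ℝ f (y + s • (x - y)) :=
        ((hf.contDiffOn.differentiableOn (by norm_cast)) _ hz).differentiableAt
          (hBo.mem_nhds hz)
      have h1 := hasLineDerivAt_add_smul (hd.hasFDerivAt.hasLineDerivAt (x - y))
      convert h1 using 1
      have hv := congrArg (fderiv ℝ f (y + s • (x - y))) (sum_smul_coordVec (x - y))
      rw [map_sum] at hv
      rw [← hv]
      refine Finset.sum_congr rfl fun c _ => ?_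
      rw [map_smul, hp]
      simp only
      rw [partialDeriv_eq_fderiv hd]
      rfl
    have hI : IntervalIntegrable (fun s => ∑ c, (x c - y c) * p c x s) volume 0 1 := by
      refine ContinuousOn.intervalIntegrable ?_
      rw [Set.uIcc_of_le zero_le_one]
      exact continuousOn_finsetSum _ fun c _ => continuousOn_const.mul (hcont c x hx)
    have hFTC := intervalIntegral.integral_eq_sub_of_hasDerivAt hder hI
    rw [intervalIntegral.integral_of_le zero_le_one,
      integral_finsetSum _ fun c _ => (hint c x hx).const_mul _] at hFTC
    simp only [one_smul, zero_smul, add_sub_cancel, add_zero, integral_const_mul] at hFTC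
    simp only [hFTC]
    ring

/-- The moment `∑ w_j (z_j - θ)^α`. -/
def moment {ι : Type*} (s : Finset ι) (w : ι → ℝ) (z : ι → Param q) (θ : Param q)
    (α : Fin q → ℕ) : ℝ :=
  ∑ j ∈ s, w j * ∏ c, (z j c - θ c) ^ α c

theorem moment_add_single {ι : Type*} (s : Finset ι) (w : ι → ℝ) (z : ι → Param q)
    (θ : Param q) (α : Fin q → ℕ) (c : Fin q) :
    moment s w z θ (α + Pi.single c 1) = ∑ j ∈ s, w j * (z j c - θ c) *
      ∏ c, (z j c - θ c) ^ α c := by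
  refine Finset.sum_congr rfl fun j _ => ?_
  have : ∏ d, (z j d - θ d) ^ (α + Pi.single c 1 : Fin q → ℕ) d =
      (∏ d, (z j d - θ d) ^ α d) * (z j c - θ c) := by
    simp only [Pi.add_apply, pow_add, Finset.prod_mul_distrib]
    congr 1
    rw [Finset.prod_eq_single c] <;> simp +contextual
  rw [this]
  ring

/-- The constant of `abs_sum_mul_le_of_moment_le`. -/
def momentConst (q : ℕ) : ℕ → ℝ
  | 0 => 0
  | n + 1 => 1 + 2 * q * momentConst q n

theorem momentConst_nonneg (q n : ℕ) : 0 ≤ momentConst q n := by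
  induction n with
  | zero => exact le_rfl
  | succ n ih => unfold momentConst; positivity

/-- A signed combination of `n` point evaluations is controlled, on functions with bounded
derivatives of order less than `n`, by its moments of order less than `n`, no matter how close the
points are to one another. -/
theorem abs_sum_mul_le_of_moment_le {ι : Type*} [DecidableEq ι] {θ : Param q} {ρ : ℝ}
    (hρ1 : ρ ≤ 1) (z : ι → Param q) {ε M : ℝ} (hε : 0 ≤ ε) (n : ℕ) (s : Finset ι)
    (hs : s.card = n) (hz : ∀ j ∈ s, z j ∈ Metric.ball θ ρ) (hM0 : 0 ≤ M) (w : ι → ℝ)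
    (hM : ∀ α : Fin q → ℕ, ∑ i, α i < n → |moment s w z θ α| ≤ M) (f : Param q → ℝ)
    (hf : DerivBound f (Metric.ball θ ρ) (n - 1) ε) :
    |∑ j ∈ s, w j * f (z j)| ≤ momentConst q n * ε * M := by
  induction n generalizing s M w f with
  | zero =>
    rw [Finset.card_eq_zero] at hs
    subst hs
    simp [momentConst]
  | succ n ih =>
    obtain ⟨j₀, hj₀⟩ : s.Nonempty := by rw [← Finset.card_pos]; lia
    have hz0 := hz j₀ hj₀
    have hmass : |∑ j ∈ s, w j| ≤ M := by simpa [moment] using hM 0 (by simp)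
    have hfirst : |f (z j₀) * ∑ j ∈ s, w j| ≤ ε * M := by
      rw [abs_mul]
      exact mul_le_mul (hf.abs_le hz0) hmass (abs_nonneg _) hε
    have hcard : (s.erase j₀).card = n := by rw [Finset.card_erase_of_mem hj₀, hs]; rfl
    -- A single point is treated apart: there only `f` itself is bounded, and Hadamard's lemma would
    -- need one derivative.
    rcases Nat.eq_zero_or_pos n with rfl | hn
    · have hs' : s = {j₀} := by
        rw [Finset.card_eq_zero] at hcard
        rw [← Finset.insert_erase hj₀, hcard]
        rfl
      subst hs'
      simp only [Finset.sum_singleton] at hfirst ⊢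
      simpa [momentConst, mul_comm] using hfirst
    · obtain ⟨k, rfl⟩ : ∃ k, n = k + 1 := ⟨n - 1, by lia⟩
      -- Expanding about the point `z j₀` removes it from the sum: what remains is one evaluation
      -- sum per coordinate, with weights `w j * (z j c - z j₀ c)`, one point fewer and one
      -- derivative fewer. No division by distances between points occurs.
      obtain ⟨g, hg, hfg⟩ := DerivBound.exists_hadamard Metric.isOpen_ball (convex_ball θ ρ)
        (k := k) hf hz0
      have hsplit : ∑ j ∈ s, w j * f (z j) = f (z j₀) * ∑ j ∈ s, w j +
          ∑ c, ∑ j ∈ s.erase j₀, (w j * (z j c - z j₀ c)) * g c (z j) := by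
        have h1 : ∀ c, ∑ j ∈ s.erase j₀, (w j * (z j c - z j₀ c)) * g c (z j) =
            ∑ j ∈ s, (w j * (z j c - z j₀ c)) * g c (z j) := by
          intro c
          rw [← Finset.add_sum_erase s _ hj₀]
          simp
        rw [Finset.sum_congr rfl fun c _ => h1 c, Finset.sum_comm, Finset.mul_sum,
          ← Finset.sum_add_distrib]
        refine Finset.sum_congr rfl fun j hj => ?_
        rw [hfg (z j) (hz j hj), mul_add, Finset.mul_sum]
        congr 1
        · ring
        · exact Finset.sum_congr rfl fun c _ => by ring
      have hcoord : ∀ c, |z j₀ c - θ c| ≤ 1 := by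
        intro c
        have := PiLp.norm_apply_le (z j₀ - θ) c
        have h2 := mem_ball_iff_norm.1 hz0
        simp only [PiLp.sub_apply, Real.norm_eq_abs] at this
        linarith
      have hterm : ∀ c, |∑ j ∈ s.erase j₀, (w j * (z j c - z j₀ c)) * g c (z j)| ≤
          momentConst q (k + 1) * ε * (2 * M) := by
        intro c
        refine ih (s.erase j₀) hcard (fun j hj => hz j (Finset.mem_of_mem_erase hj))
          (by positivity) (fun j => w j * (z j c - z j₀ c)) (fun α hα => ?_) (g c) (hg c)
        -- Writing `z j c - z j₀ c` as a difference of deviations from `θ` gives an old moment of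
        -- one degree more, minus an old moment times a factor of size at most `1`; hence the bound
        -- `2 * M`.
        have hmom : moment (s.erase j₀) (fun j => w j * (z j c - z j₀ c)) z θ α =
            moment s w z θ (α + Pi.single c 1) - (z j₀ c - θ c) * moment s w z θ α := by
          have h1 : moment (s.erase j₀) (fun j => w j * (z j c - z j₀ c)) z θ α =
              moment s (fun j => w j * (z j c - z j₀ c)) z θ α := by
            unfold moment
            rw [← Finset.add_sum_erase s _ hj₀]
            simp
          rw [h1, moment_add_single, moment, moment, Finset.mul_sum, ← Finset.sum_sub_distrib]
          exact Finset.sum_congr rfl fun j _ => by ring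
        rw [hmom]
        have h1 := hM (α + Pi.single c 1) (by rw [sum_add_single]; lia)
        have h2 := hM α (by lia)
        have h3 : |(z j₀ c - θ c) * moment s w z θ α| ≤ M := by
          rw [abs_mul]
          exact (mul_le_of_le_one_left (abs_nonneg _) (hcoord c)).trans h2
        exact (abs_sub _ _).trans (by linarith)
      rw [hsplit]
      refine (abs_add_le _ _).trans ?_
      have h2 : |∑ c, ∑ j ∈ s.erase j₀, (w j * (z j c - z j₀ c)) * g c (z j)| ≤
          ∑ _c : Fin q, momentConst q (k + 1) * ε * (2 * M) :=
        (Finset.abs_sum_le_sum_abs _ _).trans (Finset.sum_le_sum fun c _ => hterm c)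
      rw [Finset.sum_const, Finset.card_univ, Fintype.card_fin, nsmul_eq_mul] at h2
      have h3 : momentConst q (k + 1 + 1) = 1 + 2 * q * momentConst q (k + 1) := rfl
      rw [h3]
      linarith

end DerivBound

/-! ### Taylor polynomials in several variables -/

section Taylor

variable {q : ℕ} {U : Set (Param q)}

/-- The monomial `(x - θ)^α`. -/
def shiftedMonomial (θ : Param q) (α : Fin q → ℕ) (x : Param q) : ℝ := ∏ c, (x c - θ c) ^ α c

/-- `α! = ∏ α_i!`. -/
def multiFactorial (α : Fin q → ℕ) : ℝ := ∏ c, ((α c).factorial : ℝ)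

theorem multiFactorial_ne_zero (α : Fin q → ℕ) : multiFactorial α ≠ 0 :=
  Finset.prod_ne_zero_iff.2 fun c _ => by exact_mod_cast (α c).factorial_ne_zero

theorem contDiff_shiftedMonomial (θ : Param q) (α : Fin q → ℕ) (n : ℕ) :
    ContDiff ℝ n (shiftedMonomial θ α) := by
  unfold shiftedMonomial
  fun_prop

theorem partialDeriv_shiftedMonomial (θ : Param q) (α : Fin q → ℕ) (i : Fin q) :
    partialDeriv i (shiftedMonomial θ α) =
      fun x => (α i : ℝ) * shiftedMonomial θ (α - Pi.single i 1) x := by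
  funext x
  have h1 : (fun t : ℝ => shiftedMonomial θ α (x + t • coordVec i)) =
      fun t => (t + (x i - θ i)) ^ α i *
        ∏ c ∈ Finset.univ.erase i, (x c - θ c) ^ α c := by
    funext t
    unfold shiftedMonomial
    rw [← Finset.mul_prod_erase _ _ (Finset.mem_univ i)]
    congr 1
    · simp [coordVec]
      ring
    · refine Finset.prod_congr rfl fun c hc => ?_
      have : c ≠ i := Finset.ne_of_mem_erase hc
      simp [coordVec, this]
  have h2 : HasDerivAt (fun t : ℝ => (t + (x i - θ i)) ^ α i)
      ((α i : ℝ) * (0 + (x i - θ i)) ^ (α i - 1) * 1) 0 :=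
    ((hasDerivAt_id (0 : ℝ)).add_const _).pow _
  have h3 := h2.mul_const (∏ c ∈ Finset.univ.erase i, (x c - θ c) ^ α c)
  rw [← h1] at h3
  refine h3.deriv.trans ?_
  unfold shiftedMonomial
  rw [← Finset.mul_prod_erase _ _ (Finset.mem_univ i), zero_add, mul_one, mul_assoc]
  congr 2
  · simp
  · refine Finset.prod_congr rfl fun c hc => ?_
    have : c ≠ i := Finset.ne_of_mem_erase hc
    simp [this]

theorem multiDeriv_shiftedMonomial (θ : Param q) (γ α : Fin q → ℕ) :
    multiDeriv γ (shiftedMonomial θ α) θ = if γ = α then multiFactorial α else 0 := by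
  induction γ using multiIndex_induction generalizing α with
  | zero =>
    rw [multiDeriv_zero, shiftedMonomial]
    simp only [sub_self]
    split_ifs with h
    · simp [← h, multiFactorial]
    · obtain ⟨c, hc⟩ : ∃ c, α c ≠ 0 := by
        by_contra! hcon
        exact h (funext fun c => (hcon c).symm)
      exact Finset.prod_eq_zero (Finset.mem_univ c) (zero_pow hc)
  | add_single γ i ih =>
    have h := multiDeriv_partialDeriv isOpen_univ
      ((contDiff_shiftedMonomial θ α (∑ j, γ j + 1)).contDiffOn) γ (by lia) i (Set.mem_univ θ)
    rw [← h, partialDeriv_shiftedMonomial, multiDeriv_const_mul]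
    simp only
    rw [ih]
    -- When `α i = 0` the truncated subtraction is harmless, since the factor `α i` vanishes.
    rcases Nat.eq_zero_or_pos (α i) with h0 | h0
    · have hne : γ + Pi.single i 1 ≠ α := by
        rintro rfl
        simp at h0
      simp [h0, hne]
    · obtain ⟨β, rfl⟩ : ∃ β : Fin q → ℕ, α = β + Pi.single i 1 := by
        refine ⟨α - Pi.single i 1, ?_⟩
        funext j
        rcases eq_or_ne j i with rfl | hj
        · simp; lia
        · simp [hj]
      rw [add_tsub_cancel_right]
      by_cases hγ : γ = β
      · subst hγ
        simp only [if_true]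
        unfold multiFactorial
        have hsplit : ∀ g : Fin q → ℝ, ∏ c, g c = g i * ∏ c ∈ Finset.univ.erase i, g c :=
          fun g => (Finset.mul_prod_erase _ g (Finset.mem_univ i)).symm
        rw [hsplit, hsplit, ← mul_assoc]
        congr 1
        · simp [Nat.factorial_succ]
        · refine Finset.prod_congr rfl fun c hc => ?_
          have : c ≠ i := Finset.ne_of_mem_erase hc
          simp [this]
      · simp [hγ]

/-- The Taylor polynomial of degree less than `n` of `φ` at `θ`. -/
def taylorPoly (φ : Param q → ℝ) (θ : Param q) (n : ℕ) (x : Param q) : ℝ :=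
  ∑ α ∈ multiIndices q n, multiDeriv α φ θ / multiFactorial α * shiftedMonomial θ α x

theorem contDiff_taylorPoly (φ : Param q → ℝ) (θ : Param q) (n k : ℕ) :
    ContDiff ℝ k (taylorPoly φ θ n) :=
  ContDiff.sum fun α _ => contDiff_const.mul (contDiff_shiftedMonomial θ α k)

theorem multiDeriv_taylorPoly (φ : Param q → ℝ) (θ : Param q) {n : ℕ} (γ : Fin q → ℕ)
    (hγ : ∑ i, γ i < n) : multiDeriv γ (taylorPoly φ θ n) θ = multiDeriv γ φ θ := by
  have h := multiDeriv_sum (multiIndices q n) (n := n) isOpen_univ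
    (f := fun α x => multiDeriv α φ θ / multiFactorial α * shiftedMonomial θ α x)
    (fun α _ => (contDiff_const.mul (contDiff_shiftedMonomial θ α n)).contDiffOn) γ hγ.le
    (Set.mem_univ θ)
  refine h.trans ?_
  simp only [multiDeriv_const_mul, multiDeriv_shiftedMonomial]
  rw [Finset.sum_eq_single γ]
  · simp [multiFactorial_ne_zero]
  · intro α _ hα
    simp [hα.symm]
  · intro h
    exact absurd (mem_multiIndices.2 hγ) h

/-- The remainder has vanishing derivatives at `θ` up to order `n`, and these are continuous, hence
small nearby. No derivative of order `n + 1` is involved. -/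
theorem exists_derivBound_sub_taylorPoly (hU : IsOpen U) {φ : Param q → ℝ} {n : ℕ}
    (hφ : ContDiffOn ℝ n φ U) {θ : Param q} (hθ : θ ∈ U) {ε : ℝ} (hε : 0 < ε) :
    ∃ ρ : ℝ, 0 < ρ ∧ ρ ≤ 1 ∧
      DerivBound (fun x => φ x - taylorPoly φ θ (n + 1) x) (Metric.ball θ ρ) n ε := by
  have hT := contDiff_taylorPoly φ θ (n + 1) n
  set R : Param q → ℝ := fun x => φ x - taylorPoly φ θ (n + 1) x with hR
  have hRc : ContDiffOn ℝ n R U := hφ.sub hT.contDiffOn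
  have hzero : ∀ γ : Fin q → ℕ, ∑ i, γ i ≤ n → multiDeriv γ R θ = 0 := by
    intro γ hγ
    have hR' : R = fun x => φ x + (-1) * taylorPoly φ θ (n + 1) x := by
      funext x; simp only [hR]; ring
    rw [hR', multiDeriv_add hU hφ (contDiff_const.mul hT).contDiffOn γ hγ hθ,
      multiDeriv_const_mul]
    simp only
    rw [multiDeriv_taylorPoly φ θ γ (by lia)]
    ring
  have hev : ∀ᶠ x in 𝓝 θ, x ∈ U ∧ ∀ γ ∈ multiIndices q (n + 1), |multiDeriv γ R x| < ε := by
    refine Filter.Eventually.and (hU.mem_nhds hθ) ?_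
    rw [Filter.eventually_all_finset]
    intro γ hγ
    rw [mem_multiIndices] at hγ
    have hc : ContinuousAt (multiDeriv γ R) θ :=
      (contDiffOn_multiDeriv (n := 0) hU γ (hRc.of_le (by norm_cast; lia))).continuousOn.continuousAt
        (hU.mem_nhds hθ)
    have ht := hc.tendsto
    rw [hzero γ (by lia)] at ht
    filter_upwards [Metric.tendsto_nhds.1 ht ε hε] with x hx
    simpa using hx
  obtain ⟨ρ, hρ, hball⟩ := Metric.eventually_nhds_iff_ball.1 hev
  have hsub : ∀ x ∈ Metric.ball θ (min ρ 1), x ∈ Metric.ball θ ρ := fun x hx =>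
    Metric.ball_subset_ball (min_le_left _ _) hx
  refine ⟨min ρ 1, lt_min hρ one_pos, min_le_right _ _,
    hRc.mono fun x hx => (hball x (hsub x hx)).1, fun γ hγ x hx => ?_⟩
  exact ((hball x (hsub x hx)).2 γ (mem_multiIndices.2 (by lia))).le

/-- If points converge to `θ` and the normalized moments of a signed combination of evaluations at
these points converge, then so do its normalized values at smooth functions. -/
theorem tendsto_sum_mul_div_of_moment {ι A : Type*} [DecidableEq ι] {l : Filter A} (hU : IsOpen U)
    {φ : Param q → ℝ} {n : ℕ} (hφ : ContDiffOn ℝ n φ U) {θ : Param q} (hθ : θ ∈ U)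
    {s : Finset ι} (hs : s.card = n + 1) {z : A → ι → Param q} {w : A → ι → ℝ} {M : A → ℝ}
    (hz : ∀ j ∈ s, Tendsto (fun a => z a j) l (𝓝 θ)) (hM0 : ∀ a, 0 ≤ M a)
    (hM : ∀ a, ∀ α ∈ multiIndices q (n + 1), |moment s (w a) (z a) θ α| ≤ M a)
    {b : (Fin q → ℕ) → ℝ}
    (hb : ∀ α ∈ multiIndices q (n + 1),
      Tendsto (fun a => moment s (w a) (z a) θ α / M a) l (𝓝 (b α))) :
    Tendsto (fun a => (∑ j ∈ s, w a j * φ (z a j)) / M a) l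
      (𝓝 (∑ α ∈ multiIndices q (n + 1), b α / multiFactorial α * multiDeriv α φ θ)) := by
  -- On the Taylor polynomial the sum is a fixed linear combination of the moments.
  have hpoly : Tendsto (fun a => (∑ j ∈ s, w a j * taylorPoly φ θ (n + 1) (z a j)) / M a) l
      (𝓝 (∑ α ∈ multiIndices q (n + 1), b α / multiFactorial α * multiDeriv α φ θ)) := by
    have h1 : ∀ a, (∑ j ∈ s, w a j * taylorPoly φ θ (n + 1) (z a j)) / M a =
        ∑ α ∈ multiIndices q (n + 1), (moment s (w a) (z a) θ α / M a) / multiFactorial α *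
          multiDeriv α φ θ := by
      intro a
      simp only [taylorPoly, moment, shiftedMonomial, Finset.mul_sum, Finset.sum_div,
        Finset.sum_mul]
      rw [Finset.sum_comm]
      refine Finset.sum_congr rfl fun α _ => Finset.sum_congr rfl fun j _ => ?_
      ring
    simp only [h1]
    exact tendsto_finsetSum _ fun α hα => ((hb α hα).div_const _).mul_const _
  have hrem : Tendsto (fun a => (∑ j ∈ s, w a j *
      (φ (z a j) - taylorPoly φ θ (n + 1) (z a j))) / M a) l (𝓝 0) := by
    rw [Metric.tendsto_nhds]
    intro ε hε
    have hC := momentConst_nonneg q (n + 1)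
    -- With `n + 1` points, remainder derivatives up to order `n` suffice; this choice makes
    -- `momentConst q (n + 1) * ε'` smaller than `ε`.
    set ε' := ε / (2 * (momentConst q (n + 1) + 1)) with hε'
    have hε'0 : 0 < ε' := by positivity
    obtain ⟨ρ, hρ, hρ1, hR⟩ := exists_derivBound_sub_taylorPoly hU hφ hθ hε'0
    have hev : ∀ᶠ a in l, ∀ j ∈ s, z a j ∈ Metric.ball θ ρ := by
      rw [Filter.eventually_all_finset]
      exact fun j hj => (hz j hj).eventually (Metric.ball_mem_nhds θ hρ)
    filter_upwards [hev] with a ha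
    have h := abs_sum_mul_le_of_moment_le hρ1 (z a) hε'0.le (n + 1) s hs ha (hM0 a) (w a)
      (fun α hα => hM a α (mem_multiIndices.2 hα)) _ hR
    rw [Real.dist_eq, sub_zero, abs_div, abs_of_nonneg (hM0 a)]
    refine (div_le_of_le_mul₀ (hM0 a) (by positivity) h).trans_lt ?_
    rw [hε', mul_div_assoc', div_lt_iff₀ (by positivity)]
    nlinarith
  have := hpoly.add hrem
  rw [add_zero] at this
  refine this.congr fun a => ?_
  rw [← add_div, ← Finset.sum_add_distrib]
  congr 1
  exact Finset.sum_congr rfl fun j _ => by ring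

end Taylor

/-! ### Masses of separated sets of atoms -/

section Separated

variable {q : ℕ}

/-- A mixed partial derivative is the iterated derivative evaluated at unit vectors. This turns norm
bounds on cutoffs into the coordinate bounds of `DerivBound`. -/
theorem abs_multiDeriv_le_norm_iteratedFDeriv {f : Param q → ℝ} {n : ℕ} (hf : ContDiff ℝ n f)
    (γ : Fin q → ℕ) (hγ : ∑ i, γ i ≤ n) (x : Param q) :
    |multiDeriv γ f x| ≤ ‖iteratedFDeriv ℝ (∑ i, γ i) f x‖ := by
  have key : ∃ v : Fin (∑ i, γ i) → Param q, (∀ j, ‖v j‖ ≤ 1) ∧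
      ∀ x, multiDeriv γ f x = iteratedFDeriv ℝ (∑ i, γ i) f x v := by
    clear x
    generalize hm : ∑ i, γ i = m at hγ
    induction γ using multiIndex_induction generalizing m with
    | zero =>
      obtain rfl : m = 0 := by simpa using hm.symm
      exact ⟨fun _ => 0, by simp, by simp⟩
    | add_single γ i ih =>
      rw [sum_add_single] at hm
      subst hm
      obtain ⟨v, hv, h⟩ := ih _ rfl (by lia)
      refine ⟨Fin.cons (coordVec i) v, fun j => ?_, fun x => ?_⟩
      · refine Fin.cases ?_ (fun j => ?_) j
        · simp [coordVec]
        · simpa using hv j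
      · have hd : Differentiable ℝ (iteratedFDeriv ℝ (∑ j, γ j) f) :=
          hf.differentiable_iteratedFDeriv (by norm_cast)
        rw [← partialDeriv_multiDeriv isOpen_univ hf.contDiffOn γ hγ i (Set.mem_univ x),
          iteratedFDeriv_succ_apply_left, Fin.cons_zero, Fin.tail_cons]
        have h1 : multiDeriv γ f = fun x => iteratedFDeriv ℝ (∑ j, γ j) f x v := funext h
        have h2 : HasFDerivAt (fun x => iteratedFDeriv ℝ (∑ j, γ j) f x v)
            ((ContinuousMultilinearMap.apply ℝ (fun _ => Param q) ℝ v).comp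
              (fderiv ℝ (iteratedFDeriv ℝ (∑ j, γ j) f) x)) x :=
          (ContinuousMultilinearMap.apply ℝ (fun _ : Fin (∑ j, γ j) => Param q) ℝ
            v).hasFDerivAt.comp x
            (hd x).hasFDerivAt
        rw [h1, partialDeriv_eq_fderiv h2.differentiableAt, h2.fderiv]
        rfl
  obtain ⟨v, hv, h⟩ := key
  rw [h]
  refine ((iteratedFDeriv ℝ (∑ i, γ i) f x).le_opNorm v).trans ?_
  exact mul_le_of_le_one_right (norm_nonneg _) (Finset.prod_le_one (fun _ _ => norm_nonneg _)
    fun j _ => hv j)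

/-- A smooth function that vanishes at the origin and is `1` away from the unit ball. -/
theorem exists_smooth_cutoff (q N : ℕ) : ∃ C : ℝ, 1 ≤ C ∧ ∃ h : Param q → ℝ, ContDiff ℝ N h ∧
    h 0 = 0 ∧ (∀ x, 1 ≤ ‖x‖ → h x = 1) ∧ ∀ n ≤ N, ∀ x, ‖iteratedFDeriv ℝ n h x‖ ≤ C := by
  let b : ContDiffBump (0 : Param q) := ⟨1 / 2, 1, by norm_num, by norm_num⟩
  have hb : ContDiff ℝ N (b : Param q → ℝ) := b.contDiff
  have hbound : ∀ n ≤ N, ∃ C : ℝ, ∀ x, ‖iteratedFDeriv ℝ n (b : Param q → ℝ) x‖ ≤ C := fun n hn =>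
    (b.hasCompactSupport.iteratedFDeriv n).exists_bound_of_continuous
      (hb.continuous_iteratedFDeriv (by norm_cast))
  choose! C hC using hbound
  have hC0 : ∀ n ≤ N, 0 ≤ C n := fun n hn => (norm_nonneg _).trans (hC n hn 0)
  refine ⟨1 + ∑ n ∈ Finset.range (N + 1), C n, ?_, fun x => 1 - b x,
    contDiff_const.sub hb, ?_, fun x hx => ?_, fun n hn x => ?_⟩
  · have : 0 ≤ ∑ n ∈ Finset.range (N + 1), C n :=
      Finset.sum_nonneg fun n hn => hC0 n (by simpa [Nat.lt_succ_iff] using hn)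
    linarith
  · have : b 0 = 1 := b.one_of_mem_closedBall (by simp [b])
    simp [this]
  · have : b x = 0 := b.zero_of_le_dist (by simpa [b] using hx)
    simp [this]
  · have h1 : ‖iteratedFDeriv ℝ n (fun _ : Param q => (1 : ℝ)) x‖ ≤ 1 := by
      rcases n with _ | n
      · simp
      · rw [iteratedFDeriv_const_of_ne (by simp)]
        simp
    have h2 : C n ≤ ∑ n ∈ Finset.range (N + 1), C n :=
      Finset.single_le_sum (fun n hn => hC0 n (by simpa [Nat.lt_succ_iff] using hn))
        (by simpa [Nat.lt_succ_iff] using hn)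
    have h3 : iteratedFDeriv ℝ n (fun x => 1 - b x) x =
        iteratedFDeriv ℝ n (fun _ : Param q => (1 : ℝ)) x - iteratedFDeriv ℝ n b x :=
      iteratedFDeriv_sub_apply (contDiff_const.contDiffAt)
        (hb.of_le (by norm_cast)).contDiffAt
    rw [h3]
    exact (norm_sub_le _ _).trans (add_le_add h1 ((hC n hn x).trans h2))

/-- Products of `card s` functions whose derivatives are bounded at scale `1 / R`. -/
theorem norm_iteratedFDeriv_prod_le_of_scale {ι : Type*} (s : Finset ι) {N : ℕ} {C R : ℝ}
    (hC : 1 ≤ C) (hR : 0 ≤ R) {f : ι → Param q → ℝ} (hf : ∀ j ∈ s, ContDiff ℝ N (f j))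
    (hb : ∀ j ∈ s, ∀ n ≤ N, ∀ x, ‖iteratedFDeriv ℝ n (f j) x‖ ≤ C * R ^ n) :
    ∀ n ≤ N, ∀ x, ‖iteratedFDeriv ℝ n (fun x => ∏ j ∈ s, f j x) x‖ ≤
      (2 ^ N * C) ^ s.card * R ^ n := by
  classical
  induction s using Finset.induction_on with
  | empty =>
    intro n hn x
    rcases n with _ | n
    · simp
    · simp only [Finset.prod_empty]
      rw [iteratedFDeriv_const_of_ne (by simp)]
      simp; positivity
  | insert i s hi ih =>
    intro n hn x
    have hs : ∀ j ∈ s, ContDiff ℝ N (f j) := fun j hj => hf j (Finset.mem_insert_of_mem hj)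
    have ih' := ih hs fun j hj => hb j (Finset.mem_insert_of_mem hj)
    have hprod : ContDiff ℝ N (fun x => ∏ j ∈ s, f j x) := contDiff_prod hs
    simp only [Finset.prod_insert hi]
    refine (norm_iteratedFDeriv_mul_le (hf i (Finset.mem_insert_self _ _)) hprod x
      (n := n) (by exact_mod_cast hn)).trans ?_
    have hterm : ∀ m ∈ Finset.range (n + 1), (n.choose m : ℝ) * ‖iteratedFDeriv ℝ m (f i) x‖ *
        ‖iteratedFDeriv ℝ (n - m) (fun x => ∏ j ∈ s, f j x) x‖ ≤
          n.choose m * (C * (2 ^ N * C) ^ s.card * R ^ n) := by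
      intro m hm
      rw [Finset.mem_range] at hm
      have hRn : R ^ n = R ^ m * R ^ (n - m) := by rw [← pow_add]; congr 1; lia
      calc _ ≤ (n.choose m : ℝ) * (C * R ^ m) * ((2 ^ N * C) ^ s.card * R ^ (n - m)) := by
            gcongr
            · exact hb i (Finset.mem_insert_self _ _) m (by lia) x
            · exact ih' (n - m) (by lia) x
        _ = _ := by rw [hRn]; ring
    refine (Finset.sum_le_sum hterm).trans ?_
    rw [← Finset.sum_mul, ← Nat.cast_sum, Nat.sum_range_choose, Finset.card_insert_of_notMem hi,
      pow_succ]
    have : ((2 ^ n : ℕ) : ℝ) ≤ 2 ^ N := by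
      push_cast
      exact pow_le_pow_right₀ (by norm_num) hn
    calc _ ≤ (2 : ℝ) ^ N * (C * (2 ^ N * C) ^ s.card * R ^ n) := by gcongr
      _ = _ := by ring

/-- In a cluster of at most `N + 1` points, the mass of a subset that is separated from the rest is
controlled by the moments of the cluster. -/
theorem exists_pow_mul_abs_mass_le (q N : ℕ) : ∃ K : ℝ, 0 ≤ K ∧
    ∀ {ι : Type} [DecidableEq ι] (s S : Finset ι) (z : ι → Param q) (w : ι → ℝ) (θ : Param q)
      (δ M : ℝ), S ⊆ s → s.card ≤ N + 1 → 0 < δ → δ ≤ 1 →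
      (∀ j ∈ S, ∀ l ∈ s \ S, δ ≤ ‖z j - z l‖) → (∀ j ∈ s, z j ∈ Metric.ball θ 1) → 0 ≤ M →
      (∀ α : Fin q → ℕ, ∑ i, α i < s.card → |moment s w z θ α| ≤ M) →
      δ ^ N * |∑ j ∈ S, w j| ≤ K * M := by
  obtain ⟨C, hC, h, hh, h0, h1, hb⟩ := exists_smooth_cutoff q N
  have hmc : ∀ n, n ≤ N + 1 →
      momentConst q n ≤ ∑ n ∈ Finset.range (N + 2), momentConst q n := fun n hn =>
    Finset.single_le_sum (fun n _ => momentConst_nonneg q n) (by rw [Finset.mem_range]; lia)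
  set C₁ := ∑ n ∈ Finset.range (N + 2), momentConst q n with hC₁
  have hC₁0 : 0 ≤ C₁ := Finset.sum_nonneg fun n _ => momentConst_nonneg q n
  have h2C : (1 : ℝ) ≤ 2 ^ N * C := one_le_mul_of_one_le_of_one_le (one_le_pow₀ (by norm_num)) hC
  refine ⟨C₁ * (2 ^ N * C) ^ (N + 1), by positivity, ?_⟩
  intro ι _ s S z w θ δ M hS hcard hδ hδ1 hsep hz hM0 hM
  set R : ℝ := δ⁻¹ with hR
  have hR1 : 1 ≤ R := (one_le_inv₀ hδ).2 hδ1
  set f : ι → Param q → ℝ := fun l x => h (R • (x - z l)) with hf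
  have hhR : ContDiff ℝ N fun y => h (R • y) := hh.comp (by fun_prop)
  have hfc : ∀ l, ContDiff ℝ N (f l) := fun l => hh.comp (by fun_prop)
  have hfb : ∀ l, ∀ n ≤ N, ∀ x, ‖iteratedFDeriv ℝ n (f l) x‖ ≤ C * R ^ n := by
    intro l n hn x
    have e1 : iteratedFDeriv ℝ n (f l) x = iteratedFDeriv ℝ n (fun y => h (R • y)) (x - z l) :=
      iteratedFDeriv_comp_sub (f := fun y => h (R • y)) n (z l) x
    rw [e1, iteratedFDeriv_comp_const_smul R (hh.of_le (by norm_cast)), norm_smul, norm_pow,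
      Real.norm_of_nonneg (by positivity), mul_comm]
    gcongr
    exact hb n hn _
  -- Each factor vanishes at one point outside `S` and equals `1` at distance at least `δ` from it,
  -- so `χ` is the indicator of `S` on the cluster. Its derivatives up to order `N` are `O(R ^ N)`,
  -- uniformly because `R = δ⁻¹ ≥ 1`.
  set χ : Param q → ℝ := fun x => ∏ l ∈ s \ S, f l x with hχ
  have hχc : ContDiff ℝ N χ := contDiff_prod fun l _ => hfc l
  have hχb := norm_iteratedFDeriv_prod_le_of_scale (s \ S) hC (zero_le_one.trans hR1)
    (fun l _ => hfc l) (fun l _ => hfb l)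
  have hdb : DerivBound χ (Metric.ball θ 1) (s.card - 1) ((2 ^ N * C) ^ (N + 1) * R ^ N) := by
    refine ⟨(hχc.of_le (by norm_cast; lia)).contDiffOn, fun γ hγ x _ => ?_⟩
    refine (abs_multiDeriv_le_norm_iteratedFDeriv hχc γ (by lia) x).trans
      ((hχb _ (by lia) x).trans ?_)
    have hcs : (s \ S).card ≤ N + 1 := (Finset.card_le_card Finset.sdiff_subset).trans hcard
    gcongr
    lia
  have hsum : ∑ j ∈ s, w j * χ (z j) = ∑ j ∈ S, w j := by
    rw [← Finset.sum_sdiff hS]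
    have e1 : ∑ j ∈ s \ S, w j * χ (z j) = 0 := by
      refine Finset.sum_eq_zero fun j hj => ?_
      have : χ (z j) = 0 := Finset.prod_eq_zero hj (by simp [hf, h0])
      rw [this, mul_zero]
    rw [e1, zero_add]
    refine Finset.sum_congr rfl fun j hj => ?_
    have : χ (z j) = 1 := by
      refine Finset.prod_eq_one fun l hl => h1 _ ?_
      rw [norm_smul, Real.norm_of_nonneg (by positivity), hR, ← div_eq_inv_mul, le_div_iff₀ hδ,
        one_mul]
      exact hsep j hj l hl
    rw [this, mul_one]
  have hmain := abs_sum_mul_le_of_moment_le le_rfl z (ε := (2 ^ N * C) ^ (N + 1) * R ^ N)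
    (by positivity) s.card s rfl hz hM0 w hM χ hdb
  rw [hsum] at hmain
  have hRδ : δ ^ N * R ^ N = 1 := by rw [← mul_pow, hR, mul_inv_cancel₀ hδ.ne', one_pow]
  calc δ ^ N * |∑ j ∈ S, w j| ≤ δ ^ N * (C₁ * ((2 ^ N * C) ^ (N + 1) * R ^ N) * M) := by
        gcongr
        refine hmain.trans ?_
        gcongr
        exact hmc _ hcard
    _ = (δ ^ N * R ^ N) * (C₁ * (2 ^ N * C) ^ (N + 1) * M) := by ring
    _ = _ := by rw [hRδ, one_mul]

end Separated

/-! ### Single linkage -/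

/-- A finite family of points carries an ultrametric that is comparable with the distance. -/
theorem exists_ultrametric_of_fintype {ι E : Type*} [Fintype ι] [SeminormedAddCommGroup E]
    (z : ι → E) : ∃ u : ι → ι → ℝ, (∀ i, u i i = 0) ∧ (∀ i j, u i j = u j i) ∧
      (∀ i j, 0 ≤ u i j) ∧ (∀ i j l, u i l ≤ max (u i j) (u j l)) ∧
      (∀ i j, u i j ≤ ‖z i - z j‖) ∧ ∀ i j, ‖z i - z j‖ ≤ Fintype.card ι * u i j := by
  classical
  -- The ultrametric is the least scale at which two points are connected by steps of that length.
  -- Concatenating paths gives the ultrametric inequality, and a path has fewer edges than there are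
  -- points.
  let G : ℝ → SimpleGraph ι := fun t =>
    { Adj := fun i j => i ≠ j ∧ ‖z i - z j‖ ≤ t
      symm := ⟨fun i j h => ⟨h.1.symm, by rw [norm_sub_rev]; exact h.2⟩⟩
      loopless := ⟨fun i h => h.1 rfl⟩ }
  let T : ι → ι → Set ℝ := fun i j => {t | 0 ≤ t ∧ (G t).Reachable i j}
  have hmono : ∀ {s t : ℝ}, s ≤ t → G s ≤ G t := fun hst i j h => ⟨h.1, h.2.trans hst⟩
  have hT : ∀ i j, ‖z i - z j‖ ∈ T i j := by
    intro i j
    refine ⟨norm_nonneg _, ?_⟩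
    rcases eq_or_ne i j with rfl | hij
    · exact SimpleGraph.Reachable.refl _
    · exact SimpleGraph.Adj.reachable ⟨hij, le_rfl⟩
  have hbdd : ∀ i j, BddBelow (T i j) := fun i j => ⟨0, fun t ht => ht.1⟩
  have hwalk : ∀ (t : ℝ) (i j : ι) (p : (G t).Walk i j), ‖z i - z j‖ ≤ p.length * t := by
    intro t i j p
    induction p with
    | nil => simp
    | @cons a b c hab p ih =>
      have := norm_sub_le_norm_sub_add_norm_sub (z a) (z b) (z c)
      have h2 := hab.2
      rw [SimpleGraph.Walk.length_cons]
      push_cast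
      linarith
  refine ⟨fun i j => sInf (T i j), fun i => ?_, fun i j => ?_, fun i j => ?_, fun i j l => ?_,
    fun i j => ?_, fun i j => ?_⟩
  · refine le_antisymm (csInf_le (hbdd i i) ⟨le_rfl, SimpleGraph.Reachable.refl _⟩)
      (le_csInf ⟨_, hT i i⟩ fun t ht => ht.1)
  · have : T i j = T j i := by
      ext t
      exact and_congr_right fun _ => SimpleGraph.reachable_comm
    simp only [this]
  · exact le_csInf ⟨_, hT i j⟩ fun t ht => ht.1
  · by_contra! hlt
    obtain ⟨t₁, ht₁, h₁⟩ := exists_lt_of_csInf_lt ⟨_, hT i j⟩ ((le_max_left _ _).trans_lt hlt)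
    obtain ⟨t₂, ht₂, h₂⟩ := exists_lt_of_csInf_lt ⟨_, hT j l⟩ ((le_max_right _ _).trans_lt hlt)
    have hmem : max t₁ t₂ ∈ T i l := ⟨ht₁.1.trans (le_max_left _ _),
      (ht₁.2.mono (hmono (le_max_left _ _))).trans (ht₂.2.mono (hmono (le_max_right _ _)))⟩
    exact absurd (csInf_le (hbdd i l) hmem) (not_le.2 (max_lt h₁ h₂))
  · exact csInf_le (hbdd i j) (hT i j)
  · have hne : (0 : ℝ) < Fintype.card ι := by exact_mod_cast Fintype.card_pos_iff.2 ⟨i⟩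
    rw [← div_le_iff₀' hne]
    refine le_csInf ⟨_, hT i j⟩ fun t ht => ?_
    rw [div_le_iff₀' hne]
    obtain ⟨p, hp⟩ := ht.2.exists_isPath
    have h1 : (p.length : ℝ) ≤ Fintype.card ι := by exact_mod_cast hp.length_lt.le
    exact (hwalk t i j p).trans (mul_le_mul_of_nonneg_right h1 ht.1)

/-! ### Transport for an ultrametric cost -/

section Transport

variable {ι κ : Type*} [Fintype ι] [Fintype κ]

/-- The transport plans between two weight vectors. -/
def plans (w : ι → ℝ) (w' : κ → ℝ) : Set (ι → κ → ℝ) :=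
  {c | (∀ j l, 0 ≤ c j l) ∧ (∀ j, ∑ l, c j l = w j) ∧ ∀ l, ∑ j, c j l = w' l}

theorem plans_nonempty {w : ι → ℝ} {w' : κ → ℝ} (hw : ∀ j, 0 ≤ w j) (hw' : ∀ l, 0 ≤ w' l)
    (h1 : ∑ j, w j = 1) (h1' : ∑ l, w' l = 1) : (plans w w').Nonempty :=
  ⟨fun j l => w j * w' l, fun j l => mul_nonneg (hw j) (hw' l),
    fun j => by rw [← Finset.mul_sum, h1', mul_one],
    fun l => by rw [← Finset.sum_mul, h1, one_mul]⟩

theorem isCompact_plans (w : ι → ℝ) (w' : κ → ℝ) : IsCompact (plans w w') := by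
  have hsub : plans w w' ⊆ Set.univ.pi fun j => Set.univ.pi fun _ => Set.Icc 0 (w j) := by
    intro c hc j _ l _
    refine ⟨hc.1 j l, ?_⟩
    rw [← hc.2.1 j]
    exact Finset.single_le_sum (fun l _ => hc.1 j l) (Finset.mem_univ l)
  refine IsCompact.of_isClosed_subset
    (isCompact_univ_pi fun j => isCompact_univ_pi fun _ => isCompact_Icc) ?_ hsub
  simp only [plans, Set.ofPred_and, Set.ofPred_forall]
  refine IsClosed.inter ?_ (IsClosed.inter ?_ ?_)
  · exact isClosed_iInter fun j => isClosed_iInter fun l =>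
      isClosed_le continuous_const (by fun_prop)
  · exact isClosed_iInter fun j => isClosed_eq (by fun_prop) continuous_const
  · exact isClosed_iInter fun l => isClosed_eq (by fun_prop) continuous_const

/-- For a cost that is a power of an ultrametric there is a transport plan that moves, between any
two points, at most the excess mass of the open ball around the first of them which does not
contain the second. -/
theorem exists_plan_le_abs_mass {w : ι → ℝ} {w' : κ → ℝ} (hw : ∀ j, 0 ≤ w j)
    (hw' : ∀ l, 0 ≤ w' l) (h1 : ∑ j, w j = 1) (h1' : ∑ l, w' l = 1) {r : ℕ} (hr : r ≠ 0)
    {u : ι ⊕ κ → ι ⊕ κ → ℝ} (hself : ∀ a, u a a = 0) (hsymm : ∀ a b, u a b = u b a)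
    (hnonneg : ∀ a b, 0 ≤ u a b) (hultra : ∀ a b c, u a c ≤ max (u a b) (u b c)) :
    ∃ c ∈ plans w w', ∀ j l, c j l * u (.inl j) (.inr l) ^ r ≤
      |∑ a with u a (.inl j) < u (.inl j) (.inr l), Sum.elim w (fun l => - w' l) a| *
        u (.inl j) (.inr l) ^ r := by
  classical
  set cost : (ι → κ → ℝ) → ℝ := fun c => ∑ j, ∑ l, c j l * u (.inl j) (.inr l) ^ r with hcost
  obtain ⟨c, hc, hmin⟩ := (isCompact_plans w w').exists_isMinOn
    (plans_nonempty hw hw' h1 h1') (f := cost) (by fun_prop)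
  refine ⟨c, hc, fun j l => ?_⟩
  set t := u (.inl j) (.inr l) with ht
  rcases (hnonneg (.inl j) (.inr l)).eq_or_lt with h0 | htpos
  -- At distance zero both sides vanish, because `r ≠ 0`.
  · rw [← ht] at h0
    simp [← h0, hr]
  rw [← ht] at htpos
  rcases (hc.1 j l).eq_or_lt with h0 | hcpos
  · rw [← h0, zero_mul]
    positivity
  refine mul_le_mul_of_nonneg_right ?_ (by positivity)
  have hlS : ¬ u (.inr l) (.inl j) < t := by rw [hsymm, ← ht]; exact lt_irrefl _
  -- In a cheapest plan that sends mass from `j` out of its ball to `l`, no mass enters this ball.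
  -- If `j'` outside sent mass to `l'` inside, exchanging the two targets would save cost: `u(j, l')
  -- < t = u(j, l)`, while the ultrametric inequality gives `u(j', l) ≤ u(j', l')`.
  have hno : ∀ j' l', ¬ u (.inl j') (.inl j) < t → u (.inr l') (.inl j) < t → c j' l' = 0 := by
    intro j' l' hj' hl'
    by_contra hne
    have hpos' : 0 < c j' l' := lt_of_le_of_ne (hc.1 j' l') (Ne.symm hne)
    have hjj : j ≠ j' := by
      rintro rfl
      exact hj' (by rwa [hself])
    have hll : l ≠ l' := by
      rintro rfl
      exact hlS hl'
    set η := min (c j l) (c j' l') with hη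
    have hηpos : 0 < η := lt_min hcpos hpos'
    set e : ι → κ → ι → κ → ℝ := fun j₀ l₀ a b => if a = j₀ then (if b = l₀ then η else 0) else 0
      with he
    set d : ι → κ → ℝ := fun a b => c a b - e j l a b - e j' l' a b + e j l' a b + e j' l a b
      with hd
    have hrow : ∀ j₀ l₀ a, ∑ b, e j₀ l₀ a b = if a = j₀ then η else 0 := by
      intro j₀ l₀ a
      simp only [he]
      split_ifs <;> simp
    have hcol : ∀ j₀ l₀ b, ∑ a, e j₀ l₀ a b = if b = l₀ then η else 0 := by
      intro j₀ l₀ b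
      simp [he]
    have hdp : d ∈ plans w w' := by
      refine ⟨fun a b => ?_, fun a => ?_, fun b => ?_⟩
      · have h1 := hc.1 a b
        have h2 : η ≤ c j l := min_le_left _ _
        have h3 : η ≤ c j' l' := min_le_right _ _
        simp only [hd, he]
        by_cases ha : a = j
        · subst ha
          by_cases hb : b = l
          · subst hb
            simp [hjj, h2, hll]
          · simp only [hb, hjj, if_true, if_false]
            split_ifs <;> linarith
        · by_cases ha' : a = j'
          · subst ha'
            simp only [ha, if_true, if_false]
            by_cases hb : b = l'
            · subst hb
              simp [h3, hll.symm]
            · simp only [hb, if_false]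
              split_ifs <;> linarith
          · simpa [ha, ha'] using h1
      · simp only [hd, Finset.sum_add_distrib, Finset.sum_sub_distrib, hrow, hc.2.1]
        ring
      · simp only [hd, Finset.sum_add_distrib, Finset.sum_sub_distrib, hcol, hc.2.2]
        ring
    have hecost : ∀ j₀ l₀, ∑ a, ∑ b, e j₀ l₀ a b * u (.inl a) (.inr b) ^ r =
        η * u (.inl j₀) (.inr l₀) ^ r := by
      intro j₀ l₀
      simp [he, ite_mul]
    have hdcost : cost d = cost c - η * u (.inl j) (.inr l) ^ r - η * u (.inl j') (.inr l') ^ r +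
        η * u (.inl j) (.inr l') ^ r + η * u (.inl j') (.inr l) ^ r := by
      simp only [hcost, hd, add_mul, sub_mul, Finset.sum_add_distrib, Finset.sum_sub_distrib,
        hecost]
    have hle : cost c ≤ cost d := hmin hdp
    have hlt : u (.inl j) (.inr l') ^ r < u (.inl j) (.inr l) ^ r := by
      refine pow_lt_pow_left₀ ?_ (hnonneg _ _) hr
      rw [hsymm]
      exact hl'
    have hbig : t ≤ u (.inl j') (.inr l') := by
      by_contra! hcon
      exact hj' ((hultra _ (.inr l') _).trans_lt (max_lt hcon hl'))
    have hle2 : u (.inl j') (.inr l) ^ r ≤ u (.inl j') (.inr l') ^ r := by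
      refine pow_le_pow_left₀ (hnonneg _ _) ?_ r
      refine (hultra _ (.inr l') _).trans (max_le le_rfl ?_)
      exact (hultra _ (.inl j) _).trans (max_le (hl'.le.trans hbig) hbig)
    nlinarith
  -- As nothing enters, the excess mass of the ball is exactly the mass that leaves it, and `c j l`
  -- is one of its terms.
  have hmass : ∑ a with u a (.inl j) < t, Sum.elim w (fun l => - w' l) a =
      ∑ a with u (.inl a) (.inl j) < t, ∑ b with ¬ u (.inr b) (.inl j) < t, c a b := by
    rw [Finset.sum_filter, Fintype.sum_sum_type]
    simp only [Sum.elim_inl, Sum.elim_inr]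
    rw [← Finset.sum_filter, ← Finset.sum_filter, Finset.sum_neg_distrib]
    have e1 : ∑ a with u (.inl a) (.inl j) < t, w a =
        ∑ a with u (.inl a) (.inl j) < t, ∑ b with u (.inr b) (.inl j) < t, c a b +
        ∑ a with u (.inl a) (.inl j) < t, ∑ b with ¬ u (.inr b) (.inl j) < t, c a b := by
      rw [← Finset.sum_add_distrib]
      refine Finset.sum_congr rfl fun a _ => ?_
      rw [Finset.sum_filter_add_sum_filter_not, hc.2.1]
    have e2 : ∑ b with u (.inr b) (.inl j) < t, w' b =
        ∑ a with u (.inl a) (.inl j) < t, ∑ b with u (.inr b) (.inl j) < t, c a b := by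
      rw [Finset.sum_comm]
      refine Finset.sum_congr rfl fun b hb => ?_
      rw [← hc.2.2, ← Finset.sum_filter_add_sum_filter_not Finset.univ
        (fun a => u (.inl a) (.inl j) < t)]
      rw [add_eq_left]
      exact Finset.sum_eq_zero fun a ha => hno a b (Finset.mem_filter.1 ha).2
        (Finset.mem_filter.1 hb).2
    rw [e1, e2]
    ring
  rw [hmass]
  refine le_trans ?_ (le_abs_self _)
  have hjm : j ∈ Finset.univ.filter fun a => u (.inl a) (.inl j) < t :=
    Finset.mem_filter.2 ⟨Finset.mem_univ _, by rwa [hself]⟩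
  have hlm : l ∈ Finset.univ.filter fun b => ¬ u (.inr b) (.inl j) < t :=
    Finset.mem_filter.2 ⟨Finset.mem_univ _, hlS⟩
  refine (Finset.single_le_sum (f := fun b => c j b) (fun b _ => hc.1 j b) hlm).trans ?_
  exact Finset.single_le_sum (f := fun a => ∑ b with ¬ u (.inr b) (.inl j) < t, c a b)
    (fun a _ => Finset.sum_nonneg fun b _ => hc.1 a b) hjm

end Transport

/-! ### Mixing measures given by lists of weights and atoms -/

section MixOf

variable {q k : ℕ}

/-- The measure `∑ w_j δ_{x_j}`. -/
def mixOf (w : Fin k → ℝ) (x : Fin k → Param q) : Weights q := ∑ j, Finsupp.single (x j) (w j)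

theorem mixOf_apply (w : Fin k → ℝ) (x : Fin k → Param q) (a : Param q) :
    mixOf w x a = ∑ j with x j = a, w j := by
  classical
  simp only [mixOf, Finsupp.finsetSum_apply, Finsupp.single_apply, Finset.sum_filter]

theorem integrate_mixOf (w : Fin k → ℝ) (x : Fin k → Param q) (φ : Param q → ℝ) :
    integrate (mixOf w x) φ = ∑ j, w j * φ (x j) := by
  change (mixOf w x).sum (fun θ a => a * φ θ) = _
  rw [mixOf, ← Finsupp.sum_finsetSum_index (by simp) (by intros; ring)]
  simp

/-- Shorter lists are padded with zero-weight copies of one atom, so that all measures share the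
index type `Fin k`. -/
theorem exists_eq_mixOf {Θ : Set (Param q)} {G : Weights q} (hG : G ∈ mixingAtMost k Θ) :
    ∃ (w : Fin k → ℝ) (x : Fin k → Param q), (∀ j, x j ∈ Θ) ∧ (∀ j, 0 ≤ w j) ∧ ∑ j, w j = 1 ∧
      G = mixOf w x := by
  classical
  obtain ⟨⟨hnonneg, hsum, hΘ⟩, hcard⟩ := hG
  have hne : G.support.Nonempty := by
    rw [Finset.nonempty_iff_ne_empty]
    intro h
    simp [h] at hsum
  obtain ⟨a₀, ha₀⟩ := hne
  let e := G.support.equivFin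
  let x : Fin k → Param q := fun j =>
    if h : (j : ℕ) < G.support.card then (e.symm ⟨j, h⟩ : Param q) else a₀
  let w : Fin k → ℝ := fun j => if (j : ℕ) < G.support.card then G (x j) else 0
  have hx : ∀ j, x j ∈ G.support := by
    intro j
    simp only [x]
    split_ifs with h
    · exact (e.symm ⟨j, h⟩).2
    · exact ha₀
  have hG : G = mixOf w x := by
    ext a
    rw [mixOf_apply]
    by_cases ha : a ∈ G.support
    · set i := e ⟨a, ha⟩ with hi
      have hik : (i : ℕ) < k := i.2.trans_le hcard
      have hxi : x ⟨i, hik⟩ = a := by simp [x, hi]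
      rw [Finset.sum_eq_single (⟨i, hik⟩ : Fin k)]
      · simp [w, hxi]
      · intro j hj hji
        rw [Finset.mem_filter] at hj
        simp only [w]
        split_ifs with h
        · exfalso
          apply hji
          have h2 : e.symm ⟨j, h⟩ = ⟨a, ha⟩ := by
            apply Subtype.ext
            refine Eq.trans ?_ hj.2
            simp [x, h]
          have h3 : (⟨j, h⟩ : Fin G.support.card) = i := by rw [hi, ← h2, e.apply_symm_apply]
          ext
          simpa using congrArg Fin.val h3
        · rfl
      · intro h
        simp [hxi] at h
    · rw [Finsupp.notMem_support_iff.1 ha]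
      symm
      refine Finset.sum_eq_zero fun j hj => ?_
      exact absurd ((Finset.mem_filter.1 hj).2 ▸ hx j) ha
  refine ⟨w, x, fun j => hΘ (hx j), fun j => ?_, ?_, hG⟩
  · simp only [w]
    split_ifs
    · exact hnonneg _
    · exact le_rfl
  · have h := integrate_mixOf w x fun _ => 1
    rw [← hG] at h
    simpa [integrate, hsum] using h.symm

theorem bddBelow_range_cost (r : ℕ) (G G' : Weights q) :
    BddBelow (Set.range fun c : couplings G G' =>
      ∑ a ∈ G.support, ∑ b ∈ G'.support, c.1 a b * ‖a - b‖ ^ r) := by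
  refine ⟨0, ?_⟩
  rintro _ ⟨c, rfl⟩
  exact Finset.sum_nonneg fun a _ => Finset.sum_nonneg fun b _ =>
    mul_nonneg (c.2.1 a b) (by positivity)

theorem wasserstein_pow {r : ℕ} (hr : r ≠ 0) (G G' : Weights q) : wasserstein r G G' ^ r =
    ⨅ c : couplings G G', ∑ a ∈ G.support, ∑ b ∈ G'.support, c.1 a b * ‖a - b‖ ^ r := by
  rw [wasserstein, ← Real.rpow_natCast, ← Real.rpow_mul, one_div, inv_mul_cancel₀, Real.rpow_one]
  · exact_mod_cast hr
  · exact Real.iInf_nonneg fun c => Finset.sum_nonneg fun a _ => Finset.sum_nonneg fun b _ =>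
      mul_nonneg (c.2.1 a b) (by positivity)

/-- A plan between lists is pushed forward to the supports. Repeated atoms are merged; entries whose
atom lies outside the support have weight zero, hence carry no mass in the plan. -/
theorem wasserstein_pow_le_of_plan {r : ℕ} (hr : r ≠ 0) {w w' : Fin k → ℝ} (hw : ∀ j, 0 ≤ w j)
    (hw' : ∀ l, 0 ≤ w' l) (x y : Fin k → Param q) {c : Fin k → Fin k → ℝ} (hc : c ∈ plans w w') :
    wasserstein r (mixOf w x) (mixOf w' y) ^ r ≤ ∑ j, ∑ l, c j l * ‖x j - y l‖ ^ r := by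
  classical
  rw [wasserstein_pow hr]
  have hzero : ∀ {v : Fin k → ℝ} {z : Fin k → Param q}, (∀ j, 0 ≤ v j) →
      ∀ j, z j ∉ (mixOf v z).support → v j = 0 := by
    intro v z hv j hj
    rw [Finsupp.notMem_support_iff, mixOf_apply,
      Finset.sum_eq_zero_iff_of_nonneg fun j _ => hv j] at hj
    exact hj j (by simp)
  have hcol0 : ∀ j l, y l ∉ (mixOf w' y).support → c j l = 0 := by
    intro j l hl
    have h := hc.2.2 l
    rw [hzero hw' l hl, Finset.sum_eq_zero_iff_of_nonneg fun j _ => hc.1 j l] at h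
    exact h j (Finset.mem_univ _)
  have hrow0 : ∀ j l, x j ∉ (mixOf w x).support → c j l = 0 := by
    intro j l hj
    have h := hc.2.1 j
    rw [hzero hw j hj, Finset.sum_eq_zero_iff_of_nonneg fun l _ => hc.1 j l] at h
    exact h l (Finset.mem_univ _)
  let d : Param q → Param q → ℝ := fun a b =>
    ∑ j, ∑ l, if x j = a then (if y l = b then c j l else 0) else 0
  have hd : d ∈ couplings (mixOf w x) (mixOf w' y) := by
    refine ⟨fun a b => ?_, fun a _ => ?_, fun b _ => ?_⟩
    · refine Finset.sum_nonneg fun j _ => Finset.sum_nonneg fun l _ => ?_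
      split_ifs
      exacts [hc.1 j l, le_rfl, le_rfl]
    · simp only [d]
      rw [Finset.sum_comm, mixOf_apply, Finset.sum_filter]
      refine Finset.sum_congr rfl fun j _ => ?_
      rw [Finset.sum_comm]
      split_ifs
      · rw [← hc.2.1 j]
        refine Finset.sum_congr rfl fun l _ => ?_
        rw [Finset.sum_ite_eq]
        split_ifs with h
        · rfl
        · exact (hcol0 j l h).symm
      · simp
    · simp only [d]
      rw [Finset.sum_comm, mixOf_apply, Finset.sum_filter]
      rw [Finset.sum_congr rfl fun j _ => Finset.sum_comm, Finset.sum_comm]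
      refine Finset.sum_congr rfl fun l _ => ?_
      split_ifs with h
      · rw [← hc.2.2 l]
        refine Finset.sum_congr rfl fun j _ => ?_
        rw [Finset.sum_ite_eq]
        split_ifs with h
        · rfl
        · exact (hrow0 j l h).symm
      · simp
  refine (ciInf_le (bddBelow_range_cost r _ _) ⟨d, hd⟩).trans (le_of_eq ?_)
  have hswap : ∀ a b, d a b * ‖a - b‖ ^ r = ∑ j, ∑ l,
      if x j = a then (if y l = b then c j l * ‖x j - y l‖ ^ r else 0) else 0 := by
    intro a b
    simp only [d, Finset.sum_mul]
    refine Finset.sum_congr rfl fun j _ => Finset.sum_congr rfl fun l _ => ?_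
    split_ifs with h1 h2
    · rw [h1, h2]
    · rw [zero_mul]
    · rw [zero_mul]
  simp only [hswap]
  rw [Finset.sum_congr rfl fun a _ => Finset.sum_comm, Finset.sum_comm]
  refine Finset.sum_congr rfl fun j _ => ?_
  rw [Finset.sum_congr rfl fun a _ => Finset.sum_comm, Finset.sum_comm]
  refine Finset.sum_congr rfl fun l _ => ?_
  rw [Finset.sum_comm]
  by_cases hl : y l ∈ (mixOf w' y).support
  · by_cases hj : x j ∈ (mixOf w x).support
    · rw [Finset.sum_eq_single_of_mem _ hl fun b _ hb => by simp [hb.symm]]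
      rw [Finset.sum_eq_single_of_mem _ hj fun a _ ha => by simp [ha.symm]]
      simp
    · simp [hrow0 j l hj]
  · simp [hcol0 j l hl]

/-- The signed weights of the difference of two mixing measures. -/
def signedWeights (w w' : Fin k → ℝ) : Fin k ⊕ Fin k → ℝ := Sum.elim w fun l => - w' l

theorem integrate_sub_integrate (w w' : Fin k → ℝ) (x y : Fin k → Param q) (φ : Param q → ℝ) :
    integrate (mixOf w x) φ - integrate (mixOf w' y) φ =
      ∑ a, signedWeights w w' a * φ (Sum.elim x y a) := by
  rw [integrate_mixOf, integrate_mixOf, Fintype.sum_sum_type]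
  simp [signedWeights, sub_eq_add_neg]

/-- The indices in the cluster `i`. -/
abbrev fiber {ι κ : Type*} [Fintype ι] [DecidableEq κ] (cl : ι → κ) (i : κ) : Finset ι :=
  Finset.univ.filter fun a => cl a = i

/-- The one-cluster estimate is applied to the part of `S` in each cluster. It requires a separation
of at most `1`, whereas `δ` may be as large as `D`; using it at scale `δ / D` costs the factor `D ^
r`. -/
theorem exists_pow_mul_abs_mass_le_of_clusters (q r : ℕ) : ∃ K : ℝ, 0 ≤ K ∧
    ∀ {ι : Type} [Fintype ι] [DecidableEq ι] {L : ℕ} (cl : ι → Fin L) (θ : Fin L → Param q)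
      (z : ι → Param q) (s : ι → ℝ) (M D δ : ℝ) (S : Finset ι),
      (∀ i, (fiber cl i).card ≤ r + 1) → (∀ a, z a ∈ Metric.ball (θ (cl a)) 1) → 0 ≤ M →
      (∀ i, ∀ α : Fin q → ℕ, ∑ c, α c < (fiber cl i).card →
        |moment (fiber cl i) s z (θ i) α| ≤ M) → 1 ≤ D → 0 < δ → δ ≤ D →
      (∀ a ∈ S, ∀ b ∉ S, δ ≤ ‖z a - z b‖) →
      δ ^ r * |∑ a ∈ S, s a| ≤ L * D ^ r * K * M := by
  obtain ⟨K, hK0, hK⟩ := exists_pow_mul_abs_mass_le q r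
  refine ⟨K, hK0, ?_⟩
  intro ι _ _ L cl θ z s M D δ S hcard hz hM0 hM hD hδ hδD hsep
  have hD0 : 0 < D := by linarith
  have hcl : ∀ i, (δ / D) ^ r * |∑ a ∈ S with cl a = i, s a| ≤ K * M := by
    intro i
    refine hK (fiber cl i) {a ∈ S | cl a = i} z s (θ i) (δ / D) M ?_ (hcard i) (by positivity)
      ((div_le_one hD0).2 hδD) ?_ ?_ hM0 (hM i)
    · exact fun a ha => by simpa using (Finset.mem_filter.1 ha).2
    · intro a ha b hb
      refine (div_le_self hδ.le hD).trans (hsep a (Finset.mem_filter.1 ha).1 b fun hbS => ?_)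
      simp only [fiber, Finset.mem_sdiff, Finset.mem_filter, Finset.mem_univ, true_and] at hb
      exact hb.2 ⟨hbS, hb.1⟩
    · intro a ha
      have : cl a = i := by simpa using ha
      exact this ▸ hz a
  have hsum : |∑ a ∈ S, s a| ≤ ∑ i, |∑ a ∈ S with cl a = i, s a| := by
    rw [← Finset.sum_fiberwise S cl s]
    exact Finset.abs_sum_le_sum_abs _ _
  have hδr : δ ^ r = D ^ r * (δ / D) ^ r := by
    rw [← mul_pow, mul_div_cancel₀ _ hD0.ne']
  calc δ ^ r * |∑ a ∈ S, s a| ≤ δ ^ r * ∑ i, |∑ a ∈ S with cl a = i, s a| := by gcongr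
    _ = D ^ r * ∑ i, (δ / D) ^ r * |∑ a ∈ S with cl a = i, s a| := by
        rw [hδr, mul_assoc, Finset.mul_sum]
    _ ≤ D ^ r * ∑ _i : Fin L, K * M :=
        mul_le_mul_of_nonneg_left (Finset.sum_le_sum fun i _ => hcl i) (by positivity)
    _ = _ := by simp; ring

/-- The Wasserstein distance of two mixing measures is controlled by the moments of the clusters of
their atoms. -/
theorem exists_wasserstein_pow_le (q k : ℕ) {r : ℕ} (hr : r ≠ 0) (L : ℕ) {D : ℝ} (hD : 1 ≤ D) :
    ∃ K : ℝ, 0 ≤ K ∧ ∀ (cl : Fin k ⊕ Fin k → Fin L) (θ : Fin L → Param q) (w w' : Fin k → ℝ)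
      (x y : Fin k → Param q) (M : ℝ),
      (∀ j, 0 ≤ w j) → (∀ l, 0 ≤ w' l) → ∑ j, w j = 1 → ∑ l, w' l = 1 →
      (∀ a b, ‖(Sum.elim x y : Fin k ⊕ Fin k → Param q) a - Sum.elim x y b‖ ≤ D) →
      (∀ i, (fiber cl i).card ≤ r + 1) →
      (∀ a, Sum.elim x y a ∈ Metric.ball (θ (cl a)) 1) → 0 ≤ M →
      (∀ i, ∀ α : Fin q → ℕ, ∑ c, α c < (fiber cl i).card →
        |moment (fiber cl i) (signedWeights w w') (Sum.elim x y) (θ i) α| ≤ M) →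
      wasserstein r (mixOf w x) (mixOf w' y) ^ r ≤ K * M ∧
        (M = 0 → mixOf w x = mixOf w' y) := by
  obtain ⟨K, hK0, hK⟩ := exists_pow_mul_abs_mass_le_of_clusters q r
  have hD0 : 0 < D := by linarith
  -- The factor `(2 * k) ^ r` compares the distance with the ultrametric on `2k` points, `k * k`
  -- counts the pairs, and the rest bounds the mass of a ball.
  refine ⟨(2 * k) ^ r * (k * (k * (L * D ^ r * K))), by positivity, ?_⟩
  intro cl θ w w' x y M hw hw' h1 h1' hdiam hcard hz hM0 hM
  set z : Fin k ⊕ Fin k → Param q := Sum.elim x y with hzdef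
  have hmass := fun (δ : ℝ) (S : Finset (Fin k ⊕ Fin k)) =>
    hK cl θ z (signedWeights w w') M D δ S hcard hz hM0 hM hD
  constructor
  · obtain ⟨u, hself, hsymm, hnonneg, hultra, hule, hleu⟩ := exists_ultrametric_of_fintype z
    obtain ⟨c, hc, hcb⟩ := exists_plan_le_abs_mass hw hw' h1 h1' hr hself hsymm hnonneg hultra
    refine (wasserstein_pow_le_of_plan hr hw hw' x y hc).trans ?_
    have hterm : ∀ j l, c j l * ‖x j - y l‖ ^ r ≤ (2 * k) ^ r * (L * D ^ r * K * M) := by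
      intro j l
      have hd : ‖x j - y l‖ ≤ 2 * k * u (.inl j) (.inr l) := by
        have := hleu (.inl j) (.inr l)
        simpa [hzdef, two_mul] using this
      have hu : c j l * u (.inl j) (.inr l) ^ r ≤ L * D ^ r * K * M := by
        refine (hcb j l).trans ?_
        rcases (hnonneg (.inl j) (.inr l)).eq_or_lt with h0 | hpos
        · rw [← h0, zero_pow hr, mul_zero]
          positivity
        · rw [mul_comm]
          -- In an ultrametric a point outside an open ball is at least the radius away from every
          -- point inside, and the distance dominates the ultrametric.
          refine hmass _ _ hpos ((hule _ _).trans (hdiam _ _)) fun a ha b hb => ?_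
          simp only [Finset.mem_filter, Finset.mem_univ, true_and, not_lt] at ha hb
          refine le_trans ?_ (hule a b)
          by_contra! hcon
          have := hultra b a (.inl j)
          rw [hsymm b a] at this
          exact absurd (this.trans_lt (max_lt hcon ha)) (not_lt.2 hb)
      calc c j l * ‖x j - y l‖ ^ r ≤ c j l * (2 * k * u (.inl j) (.inr l)) ^ r := by
            have := hc.1 j l
            gcongr
        _ = (2 * k) ^ r * (c j l * u (.inl j) (.inr l) ^ r) := by rw [mul_pow]; ring
        _ ≤ _ := by gcongr
    calc _ ≤ ∑ _j : Fin k, ∑ _l : Fin k, (2 * (k : ℝ)) ^ r * (L * D ^ r * K * M) :=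
          Finset.sum_le_sum fun j _ => Finset.sum_le_sum fun l _ => hterm j l
      _ = _ := by simp; ring
  · intro hM00
    classical
    ext a
    -- Finitely many points have a positive gap, so the entries located at `a` are separated from
    -- the rest; for `M = 0` their signed mass `G(a) - H(a)` must vanish.
    set S : Finset (Fin k ⊕ Fin k) := Finset.univ.filter fun i => z i = a with hS
    have hev : ∀ᶠ δ : ℝ in 𝓝[>] 0, 0 < δ ∧ δ ≤ D ∧ ∀ i l, i ∈ S → l ∉ S → δ ≤ ‖z i - z l‖ := by
      have hlt : ∀ d : ℝ, 0 < d → ∀ᶠ δ : ℝ in 𝓝[>] 0, δ ≤ d := fun d hd =>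
        nhdsWithin_le_nhds (eventually_le_nhds hd)
      refine Filter.Eventually.and self_mem_nhdsWithin ((hlt D hD0).and ?_)
      refine eventually_all.2 fun i => eventually_all.2 fun l => ?_
      by_cases hil : i ∈ S ∧ l ∉ S
      · have : 0 < ‖z i - z l‖ := by
          rw [norm_pos_iff, sub_ne_zero]
          intro h
          apply hil.2
          have := hil.1
          simp only [hS, Finset.mem_filter, Finset.mem_univ, true_and] at this ⊢
          rw [← h, this]
        filter_upwards [hlt _ this] with δ hδ _ _ using hδ
      · exact Eventually.of_forall fun δ hi hl => absurd ⟨hi, hl⟩ hil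
    obtain ⟨δ, hδ, hδD, hsep⟩ := hev.exists
    have h := hmass δ S hδ hδD fun i hi l hl => hsep i l hi hl
    rw [hM00, mul_zero] at h
    have h0 : ∑ i ∈ S, signedWeights w w' i = 0 := by
      have h2 : |∑ i ∈ S, signedWeights w w' i| ≤ 0 := by
        by_contra! hcon
        have : 0 < δ ^ r * |∑ i ∈ S, signedWeights w w' i| := by positivity
        linarith
      exact abs_nonpos_iff.1 h2
    rw [hS, Finset.sum_filter, Fintype.sum_sum_type] at h0
    simp only [hzdef, signedWeights, Sum.elim_inl, Sum.elim_inr, ← Finset.sum_filter,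
      Finset.sum_neg_distrib] at h0
    rw [mixOf_apply, mixOf_apply]
    linarith

end MixOf

/-! ### The lower bound along an ultrafilter -/

section Clusters

/-- The clusters of `k + k` limit points, when `k₀` of them are limits of both halves. -/
theorem exists_clusters {E : Type*} {k k₀ : ℕ} (X Y : Fin k → E) (T₀ : Finset E)
    (hT₀ : T₀.card = k₀) (hX : ∀ t ∈ T₀, ∃ j, X j = t) (hY : ∀ t ∈ T₀, ∃ l, Y l = t) :
    ∃ (L : ℕ) (cl : Fin k ⊕ Fin k → Fin L) (θ : Fin L → E), Function.Injective θ ∧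
      (∀ a, θ (cl a) = Sum.elim X Y a) ∧ k₀ ≤ L ∧ L ≤ 2 * k - k₀ ∧
      (∀ i, 1 ≤ (fiber cl i).card ∧ (fiber cl i).card ≤ 2 * (k - k₀ + 1)) ∧
      ∑ i, (fiber cl i).card = 2 * k := by
  classical
  set Z : Fin k ⊕ Fin k → E := Sum.elim X Y with hZ
  set T : Finset E := Finset.univ.image Z with hT
  have hZT : ∀ a, Z a ∈ T := fun a => Finset.mem_image_of_mem _ (Finset.mem_univ a)
  let cl : Fin k ⊕ Fin k → Fin T.card := fun a => T.equivFin ⟨Z a, hZT a⟩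
  let θ : Fin T.card → E := fun i => (T.equivFin.symm i : E)
  have hθ : Function.Injective θ := Subtype.val_injective.comp T.equivFin.symm.injective
  have hθcl : ∀ a, θ (cl a) = Z a := fun a => by simp [θ, cl]
  have hcl : ∀ a i, Z a = θ i → a ∈ fiber cl i := by
    intro a i h
    rw [← hθcl] at h
    simpa using hθ h
  have hsum : ∑ i, (fiber cl i).card = 2 * k := by
    have := Finset.card_eq_sum_card_fiberwise (f := cl) (s := Finset.univ) (t := Finset.univ)
      (by simp)
    rw [← this]
    simp [two_mul]
  have hsub : T₀ ⊆ T := by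
    intro t ht
    obtain ⟨j, hj⟩ := hX t ht
    have := hZT (.inl j)
    rwa [hZ, Sum.elim_inl, hj] at this
  set I : Finset (Fin T.card) := Finset.univ.filter fun i => θ i ∈ T₀ with hI
  have hIcard : I.card = k₀ := by
    have : I.image θ = T₀ := by
      ext t
      simp only [hI, Finset.mem_image, Finset.mem_filter, Finset.mem_univ, true_and]
      constructor
      · rintro ⟨i, hi, rfl⟩
        exact hi
      · intro ht
        refine ⟨T.equivFin ⟨t, hsub ht⟩, ?_, ?_⟩ <;> simp [θ, ht]
    rw [← hT₀, ← this, Finset.card_image_of_injective _ hθ]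
  -- A cluster at a point of `T₀` contains an index from each half, so it has at least two elements.
  -- Summing gives `T.card + k₀ ≤ 2 * k`, and subtracting the minimal sizes of the other clusters
  -- bounds each single one.
  let e : Fin T.card → ℕ := fun i => if i ∈ I then 2 else 1
  have he : ∀ i, e i ≤ (fiber cl i).card := by
    intro i
    simp only [e]
    split_ifs with h
    · have ht : θ i ∈ T₀ := by simpa [hI] using h
      obtain ⟨j, hj⟩ := hX _ ht
      obtain ⟨l, hl⟩ := hY _ ht
      have h1 : (.inl j : Fin k ⊕ Fin k) ∈ fiber cl i := hcl _ _ hj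
      have h2 : (.inr l : Fin k ⊕ Fin k) ∈ fiber cl i := hcl _ _ hl
      exact Finset.one_lt_card.2 ⟨_, h1, _, h2, by simp⟩
    · obtain ⟨a, -, ha⟩ := Finset.mem_image.1 (T.equivFin.symm i).2
      exact Finset.card_pos.2 ⟨a, hcl a i ha⟩
  have hesum : ∑ i, e i = T.card + k₀ := by
    have : ∀ i, e i = 1 + if i ∈ I then 1 else 0 := fun i => by simp only [e]; split_ifs <;> rfl
    simp [this, Finset.sum_add_distrib, hIcard]
  have hk₀T : k₀ ≤ T.card := hT₀ ▸ Finset.card_le_card hsub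
  have htot : T.card + k₀ ≤ 2 * k := by
    rw [← hesum, ← hsum]
    exact Finset.sum_le_sum fun i _ => he i
  refine ⟨T.card, cl, θ, hθ, hθcl, hk₀T, by lia, fun i => ⟨?_, ?_⟩, hsum⟩
  · refine le_trans ?_ (he i)
    simp only [e]
    split_ifs <;> lia
  · have h1 := Finset.add_sum_erase Finset.univ (fun i => (fiber cl i).card) (Finset.mem_univ i)
    have h2 := Finset.add_sum_erase Finset.univ e (Finset.mem_univ i)
    have h3 : ∑ i ∈ Finset.univ.erase i, e i ≤ ∑ i ∈ Finset.univ.erase i, (fiber cl i).card :=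
      Finset.sum_le_sum fun i _ => he i
    rw [hsum] at h1
    rw [hesum] at h2
    by_cases h : i ∈ I
    · have h4 : e i = 2 := by simp [e, h]
      lia
    · have h4 : e i = 1 := by simp [e, h]
      have h5 : k₀ + 1 ≤ T.card := by
        rw [← hIcard, ← Finset.card_insert_of_notMem h]
        simpa using Finset.card_le_univ (insert i I)
      lia

end Clusters

section Ultra

variable {q k : ℕ} {A : Type*}

theorem exists_tendsto_of_mem_isCompact {E : Type*} [TopologicalSpace E] {K : Set E}
    (hK : IsCompact K) (𝒰 : Ultrafilter A) {f : A → E} (hf : ∀ᶠ a in 𝒰, f a ∈ K) :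
    ∃ b ∈ K, Tendsto f 𝒰 (𝓝 b) :=
  hK.ultrafilter_le_nhds (𝒰.map f) (le_principal_iff.2 hf)

/-- The core compactness argument: the clusters' total moment size `M` dominates the Wasserstein
cost, while after division by `M` the deviation has a nonzero limit for a suitable test function.
Both `κ` and `φ` may depend on the ultrafilter. -/
theorem LinearIndependentDomain.exists_pow_wasserstein_le {Φ : Set (Param q → ℝ)}
    {Θ U : Set (Param q)} {k₀ : ℕ} (hk₀k : k₀ ≤ k) {r : ℕ}
    (hr : r + 1 = 2 * (k - k₀ + 1)) (hΦ : LinearIndependentDomain Φ Θ U r k₀ k) (hU : IsOpen U)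
    (hΘU : Θ ⊆ U) (𝒰 : Ultrafilter A) {w w' : A → Fin k → ℝ} {x y : A → Fin k → Param q}
    (hw : ∀ a j, 0 ≤ w a j) (hw' : ∀ a j, 0 ≤ w' a j) (hw1 : ∀ a, ∑ j, w a j = 1)
    (hw1' : ∀ a, ∑ j, w' a j = 1) {D : ℝ} (hD : 1 ≤ D)
    (hdiam : ∀ a b c, ‖(Sum.elim (x a) (y a) : Fin k ⊕ Fin k → Param q) b -
      Sum.elim (x a) (y a) c‖ ≤ D) {X Y : Fin k → Param q} (hXΘ : ∀ j, X j ∈ Θ)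
    (hYΘ : ∀ j, Y j ∈ Θ) (hX : ∀ j, Tendsto (fun a => x a j) 𝒰 (𝓝 (X j)))
    (hY : ∀ j, Tendsto (fun a => y a j) 𝒰 (𝓝 (Y j))) (T₀ : Finset (Param q))
    (hT₀ : T₀.card = k₀) (hT₀X : ∀ t ∈ T₀, ∃ j, X j = t) (hT₀Y : ∀ t ∈ T₀, ∃ l, Y l = t)
    (hne : ∀ a, mixOf (w a) (x a) ≠ mixOf (w' a) (y a)) :
    ∃ κ > 0, ∃ φ ∈ Φ, ∀ᶠ a in 𝒰,
      0 < |integrate (mixOf (w a) (x a)) φ - integrate (mixOf (w' a) (y a)) φ| ∧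
      κ * wasserstein r (mixOf (w a) (x a)) (mixOf (w' a) (y a)) ^ r ≤
        |integrate (mixOf (w a) (x a)) φ - integrate (mixOf (w' a) (y a)) φ| := by
  obtain ⟨L, cl, θ, hθ, hθcl, hL, hL', hord, hsum⟩ := exists_clusters X Y T₀ hT₀ hT₀X hT₀Y
  obtain ⟨K, hK0, hK⟩ := exists_wasserstein_pow_le q k (r := r) (by lia) L hD
  set z : A → Fin k ⊕ Fin k → Param q := fun a => Sum.elim (x a) (y a) with hz
  set s : A → Fin k ⊕ Fin k → ℝ := fun a => signedWeights (w a) (w' a) with hs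
  have hzlim : ∀ b, Tendsto (fun a => z a b) 𝒰 (𝓝 (θ (cl b))) := by
    intro b
    rw [hθcl]
    rcases b with j | l
    · exact hX j
    · exact hY l
  have hsurj : ∀ i, ∃ b, cl b = i := by
    intro i
    obtain ⟨b, hb⟩ := Finset.card_pos.1 (hord i).1
    exact ⟨b, by simpa using hb⟩
  have hθΘ : ∀ i, θ i ∈ Θ := by
    intro i
    obtain ⟨b, rfl⟩ := hsurj i
    rw [hθcl]
    rcases b with j | l
    · exact hXΘ j
    · exact hYΘ l
  set mom : A → Fin L → (Fin q → ℕ) → ℝ := fun a i α => moment (fiber cl i) (s a) (z a) (θ i) α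
    with hmom
  set M : A → ℝ := fun a => ∑ i, ∑ α ∈ multiIndices q (fiber cl i).card, |mom a i α| with hMdef
  have hM0 : ∀ a, 0 ≤ M a := fun a =>
    Finset.sum_nonneg fun i _ => Finset.sum_nonneg fun α _ => abs_nonneg _
  have hmomM : ∀ a i, ∀ α ∈ multiIndices q (fiber cl i).card, |mom a i α| ≤ M a := by
    intro a i α hα
    refine (Finset.single_le_sum (f := fun α => |mom a i α|) (fun α _ => abs_nonneg _) hα).trans ?_
    exact Finset.single_le_sum
      (f := fun i => ∑ α ∈ multiIndices q (fiber cl i).card, |mom a i α|)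
      (fun i _ => Finset.sum_nonneg fun α _ => abs_nonneg _) (Finset.mem_univ i)
  have hball : ∀ᶠ a in (𝒰 : Filter A), ∀ b, z a b ∈ Metric.ball (θ (cl b)) 1 :=
    eventually_all.2 fun b => (hzlim b).eventually (Metric.ball_mem_nhds _ one_pos)
  have hW : ∀ᶠ a in (𝒰 : Filter A), 0 < M a ∧
      wasserstein r (mixOf (w a) (x a)) (mixOf (w' a) (y a)) ^ r ≤ K * M a := by
    filter_upwards [hball] with a ha
    have h := hK cl θ (w a) (w' a) (x a) (y a) (M a) (hw a) (hw' a) (hw1 a) (hw1' a) (hdiam a)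
      (fun i => hr ▸ (hord i).2) ha (hM0 a)
      (fun i α hα => hmomM a i α (mem_multiIndices.2 hα))
    exact ⟨lt_of_le_of_ne (hM0 a) fun h0 => hne a (h.2 h0.symm), h.1⟩
  have hlim : ∀ i α, α ∈ multiIndices q (fiber cl i).card →
      ∃ b, Tendsto (fun a => mom a i α / M a) 𝒰 (𝓝 b) := by
    intro i α hα
    obtain ⟨b, -, hb⟩ := exists_tendsto_of_mem_isCompact (isCompact_Icc (a := (-1 : ℝ)) (b := 1)) 𝒰
      (f := fun a => mom a i α / M a) (Eventually.of_forall fun a => by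
        rw [Set.mem_Icc, ← abs_le, abs_div, abs_of_nonneg (hM0 a)]
        exact div_le_one_of_le₀ (hmomM a i α hα) (hM0 a))
    exact ⟨b, hb⟩
  choose! b hb using hlim
  -- The normalization by `M`, positive because the two measures differ, keeps the limit
  -- coefficients from all vanishing.
  have hbsum : ∑ i, ∑ α ∈ multiIndices q (fiber cl i).card, |b i α| = 1 := by
    have h1 : Tendsto (fun a => ∑ i, ∑ α ∈ multiIndices q (fiber cl i).card, |mom a i α / M a|) 𝒰
        (𝓝 (∑ i, ∑ α ∈ multiIndices q (fiber cl i).card, |b i α|)) :=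
      tendsto_finsetSum _ fun i _ => tendsto_finsetSum _ fun α hα => (hb i α hα).abs
    refine tendsto_nhds_unique (h1.congr' ?_) tendsto_const_nhds
    filter_upwards [hW] with a ha
    have : ∀ i α, |mom a i α / M a| = |mom a i α| / M a := fun i α => by
      rw [abs_div, abs_of_nonneg (hM0 a)]
    simp only [this, ← Finset.sum_div]
    exact div_self ha.1.ne'
  have hzero_mem : ∀ i, (0 : Fin q → ℕ) ∈ multiIndices q (fiber cl i).card := fun i =>
    mem_multiIndices.2 (by simpa using (hord i).1)
  -- The moments of order zero add up to the total mass of a difference of probability measures.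
  have hbzero : ∑ i, b i 0 / multiFactorial (0 : Fin q → ℕ) = 0 := by
    have h1 : Tendsto (fun a => ∑ i, mom a i 0 / M a) 𝒰 (𝓝 (∑ i, b i 0)) :=
      tendsto_finsetSum _ fun i _ => hb i 0 (hzero_mem i)
    have h2 : ∀ a, ∑ i, mom a i 0 / M a = 0 := by
      intro a
      rw [← Finset.sum_div]
      have : ∑ i, mom a i 0 = ∑ c, s a c := by
        rw [← Finset.sum_fiberwise Finset.univ cl (s a)]
        simp [hmom, moment]
      rw [this, hs, Fintype.sum_sum_type]
      simp [signedWeights, hw1, hw1']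
    simp only [h2] at h1
    have h3 := tendsto_nhds_unique h1 tendsto_const_nhds
    simpa [multiFactorial] using h3
  obtain ⟨φ, hφ, hφne⟩ : ∃ φ ∈ Φ, ∑ i, ∑ α ∈ multiIndices q (fiber cl i).card,
      b i α / multiFactorial α * multiDeriv α φ (θ i) ≠ 0 := by
    by_contra! hcon
    have h := (hΦ.independent L hL hL' (fun i => (fiber cl i).card)
      (fun i => ⟨(hord i).1, hr ▸ (hord i).2⟩) (by rw [hsum]; lia) hsum.le θ hθ hθΘ
      fun i α => b i α / multiFactorial α).1 ⟨hcon, hbzero⟩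
    have h0 : ∑ i, ∑ α ∈ multiIndices q (fiber cl i).card, |b i α| = 0 :=
      Finset.sum_eq_zero fun i _ => Finset.sum_eq_zero fun α hα => by
        have := h i α hα
        rw [div_eq_zero_iff] at this
        rw [this.resolve_right (multiFactorial_ne_zero α), abs_zero]
    rw [hbsum] at h0
    exact one_ne_zero h0
  set ℓ := ∑ i, ∑ α ∈ multiIndices q (fiber cl i).card,
      b i α / multiFactorial α * multiDeriv α φ (θ i) with hℓ
  have hφlim : Tendsto (fun a => (integrate (mixOf (w a) (x a)) φ -
      integrate (mixOf (w' a) (y a)) φ) / M a) 𝒰 (𝓝 ℓ) := by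
    have h1 : ∀ a, (integrate (mixOf (w a) (x a)) φ - integrate (mixOf (w' a) (y a)) φ) / M a =
        ∑ i, (∑ c ∈ fiber cl i, s a c * φ (z a c)) / M a := by
      intro a
      rw [integrate_sub_integrate, ← Finset.sum_div, Finset.sum_fiberwise]
    simp only [h1]
    refine tendsto_finsetSum _ fun i _ => ?_
    obtain ⟨n, hn⟩ : ∃ n, (fiber cl i).card = n + 1 := ⟨(fiber cl i).card - 1, by
      have := (hord i).1
      lia⟩
    -- A cluster of at most `r + 1` points requires derivatives only up to order `r`.
    have hnr : n ≤ r := by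
      have := (hord i).2
      lia
    have h2 := hb i
    have h3 := fun a => hmomM a i
    rw [hn] at h2 h3 ⊢
    refine tendsto_sum_mul_div_of_moment hU
      ((hΦ.contDiffOn φ hφ).of_le (by exact_mod_cast hnr)) (hΘU (hθΘ i)) hn (fun c hc => ?_) hM0 h3 h2
    have : cl c = i := by simpa using hc
    exact this ▸ hzlim c
  have hℓ0 : 0 < |ℓ| := abs_pos.2 hφne
  refine ⟨|ℓ| / 2 / (K + 1), by positivity, φ, hφ, ?_⟩
  have hev : ∀ᶠ a in (𝒰 : Filter A), |ℓ| / 2 < |(integrate (mixOf (w a) (x a)) φ -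
      integrate (mixOf (w' a) (y a)) φ) / M a| :=
    hφlim.abs.eventually (lt_mem_nhds (by linarith))
  filter_upwards [hev, hW] with a ha haW
  rw [abs_div, abs_of_nonneg (hM0 a), lt_div_iff₀ haW.1] at ha
  refine ⟨lt_of_le_of_lt (by positivity) ha, le_trans ?_ ha.le⟩
  calc |ℓ| / 2 / (K + 1) * wasserstein r (mixOf (w a) (x a)) (mixOf (w' a) (y a)) ^ r
      ≤ |ℓ| / 2 / (K + 1) * (K * M a) := by gcongr; exact haW.2
    _ = |ℓ| / 2 * M a * (K / (K + 1)) := by ring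
    _ ≤ |ℓ| / 2 * M a * 1 := by
        have := hM0 a
        gcongr
        rw [div_le_one (by positivity)]
        linarith
    _ = _ := mul_one _

end Ultra

/-! ### Inverse bounds from linear independent domains -/

section InverseBounds

variable {q k : ℕ} {Θ U : Set (Param q)}

/-- Without a uniform positive bound, `f` would tend to `0` along some ultrafilter finer than `l`.
Constants depending on the ultrafilter are therefore enough. -/
theorem exists_pos_eventually_le_of_ultrafilter {A : Type*} {l : Filter A} {f : A → ℝ≥0∞}
    (h : ∀ 𝒰 : Ultrafilter A, (𝒰 : Filter A) ≤ l → ∃ c > 0, ∀ᶠ a in (𝒰 : Filter A), c ≤ f a) :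
    ∃ c > 0, ∀ᶠ a in l, c ≤ f a := by
  by_contra! hcon
  have hne : (comap f (𝓝 0) ⊓ l).NeBot := by
    rw [(ENNReal.nhds_zero_basis.comap f).inf_basis_neBot_iff l.basis_sets]
    intro c hc s hs
    by_contra hempty
    rw [Set.not_nonempty_iff_eq_empty] at hempty
    refine (hcon c hc).elim ?_
    filter_upwards [hs] with a ha
    by_contra! hlt
    exact (Set.eq_empty_iff_forall_notMem.1 hempty a) ⟨hlt, ha⟩
  obtain ⟨c, hc, hev⟩ := h (Ultrafilter.of (comap f (𝓝 0) ⊓ l))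
    ((Ultrafilter.of_le _).trans inf_le_right)
  have h0 : Tendsto f (Ultrafilter.of (comap f (𝓝 0) ⊓ l)) (𝓝 0) :=
    tendsto_comap.mono_left ((Ultrafilter.of_le _).trans inf_le_left)
  obtain ⟨a, h1, h2⟩ := (hev.and (h0.eventually (gt_mem_nhds hc))).exists
  exact absurd h2 (not_lt.2 h1)

theorem mixOf_support_subset (w : Fin k → ℝ) (x : Fin k → Param q) {a : Param q}
    (ha : a ∈ (mixOf w x).support) : ∃ j, x j = a := by
  by_contra! hcon
  rw [Finsupp.mem_support_iff, mixOf_apply, Finset.filter_false_of_mem fun j _ => hcon j] at ha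
  simp at ha

theorem mixOf_mem_mixingAtMost {w : Fin k → ℝ} {x : Fin k → Param q} (hw : ∀ j, 0 ≤ w j)
    (hw1 : ∑ j, w j = 1) (hx : ∀ j, x j ∈ Θ) : mixOf w x ∈ mixingAtMost k Θ := by
  classical
  refine ⟨⟨fun a => ?_, ?_, fun a ha => ?_⟩, ?_⟩
  · rw [mixOf_apply]
    exact Finset.sum_nonneg fun j _ => hw j
  · simpa [integrate, hw1] using integrate_mixOf w x fun _ => 1
  · obtain ⟨j, rfl⟩ := mixOf_support_subset w x ha
    exact hx j
  · have : (mixOf w x).support ⊆ Finset.univ.image x := fun a ha => by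
      obtain ⟨j, rfl⟩ := mixOf_support_subset w x ha
      exact Finset.mem_image_of_mem _ (Finset.mem_univ j)
    exact (Finset.card_le_card this).trans (Finset.card_image_le.trans (by simp))

/-- An atom of `G₀` that is far from the atoms of `G` keeps `G` away from `G₀`. -/
theorem mul_le_wasserstein_one {G G₀ : Weights q} (hG : G ∈ mixing Θ) (hG₀ : G₀ ∈ mixing Θ)
    {t : Param q} (ht : t ∈ G₀.support) {η : ℝ} (hη : ∀ a ∈ G.support, η ≤ ‖a - t‖) :
    η * G₀ t ≤ wasserstein 1 G G₀ := by
  have h := wasserstein_pow one_ne_zero G G₀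
  rw [pow_one] at h
  rw [h]
  -- The product coupling is needed because a real infimum over an empty type would be `0`.
  have : Nonempty (couplings G G₀) := ⟨⟨fun a b => G a * G₀ b,
    fun a b => mul_nonneg (hG.1 a) (hG₀.1 b),
    fun a _ => by rw [← Finset.mul_sum, hG₀.2.1, mul_one],
    fun b _ => by rw [← Finset.sum_mul, hG.2.1, one_mul]⟩⟩
  refine le_ciInf fun c => ?_
  rw [← c.2.2.2 t ht, Finset.mul_sum]
  refine Finset.sum_le_sum fun a ha => ?_
  rw [mul_comm]
  refine le_trans ?_ (Finset.single_le_sum (f := fun b => c.1 a b * ‖a - b‖ ^ 1)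
    (fun b _ => mul_nonneg (c.2.1 a b) (by positivity)) ht)
  simp only [pow_one]
  exact mul_le_mul_of_nonneg_left (hη a ha) (c.2.1 a t)

/-- The pairs of distinct mixing measures with at most `k` atoms. -/
abbrev DistinctPairs (k : ℕ) (Θ : Set (Param q)) : Type :=
  {GG : Weights q × Weights q // GG.1 ∈ mixingAtMost k Θ ∧ GG.2 ∈ mixingAtMost k Θ ∧ GG.1 ≠ GG.2}

theorem exists_limits (hΘ : IsCompact Θ) (𝒰 : Ultrafilter (DistinctPairs k Θ)) :
    ∃ (w w' : DistinctPairs k Θ → Fin k → ℝ) (x y : DistinctPairs k Θ → Fin k → Param q)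
      (W W' : Fin k → ℝ) (X Y : Fin k → Param q) (D : ℝ),
      (∀ a, a.1.1 = mixOf (w a) (x a)) ∧ (∀ a, a.1.2 = mixOf (w' a) (y a)) ∧
      (∀ a j, 0 ≤ w a j) ∧ (∀ a j, 0 ≤ w' a j) ∧ (∀ a, ∑ j, w a j = 1) ∧
      (∀ a, ∑ j, w' a j = 1) ∧ 1 ≤ D ∧
      (∀ a b c, ‖(Sum.elim (x a) (y a) : Fin k ⊕ Fin k → Param q) b -
        Sum.elim (x a) (y a) c‖ ≤ D) ∧ (∀ j, X j ∈ Θ) ∧ (∀ j, Y j ∈ Θ) ∧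
      (∀ j, Tendsto (fun a => x a j) 𝒰 (𝓝 (X j))) ∧
      (∀ j, Tendsto (fun a => y a j) 𝒰 (𝓝 (Y j))) ∧
      (∀ j, Tendsto (fun a => w a j) 𝒰 (𝓝 (W j))) ∧
      ∀ j, Tendsto (fun a => w' a j) 𝒰 (𝓝 (W' j)) := by
  choose w x hx hw hw1 hG using fun a : DistinctPairs k Θ => exists_eq_mixOf a.2.1
  choose w' y hy hw' hw1' hG' using fun a : DistinctPairs k Θ => exists_eq_mixOf a.2.2.1
  have hI : ∀ {v : Fin k → ℝ}, (∀ j, 0 ≤ v j) → ∑ j, v j = 1 → ∀ j, v j ∈ Set.Icc (0 : ℝ) 1 :=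
    fun hv hv1 j => ⟨hv j, hv1 ▸ Finset.single_le_sum (fun j _ => hv j) (Finset.mem_univ j)⟩
  choose X hXΘ hX using fun j => exists_tendsto_of_mem_isCompact hΘ 𝒰
    (f := fun a => x a j) (Eventually.of_forall fun a => hx a j)
  choose Y hYΘ hY using fun j => exists_tendsto_of_mem_isCompact hΘ 𝒰
    (f := fun a => y a j) (Eventually.of_forall fun a => hy a j)
  choose W _ hW using fun j => exists_tendsto_of_mem_isCompact isCompact_Icc 𝒰
    (f := fun a => w a j) (Eventually.of_forall fun a => hI (hw a) (hw1 a) j)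
  choose W' _ hW' using fun j => exists_tendsto_of_mem_isCompact isCompact_Icc 𝒰
    (f := fun a => w' a j) (Eventually.of_forall fun a => hI (hw' a) (hw1' a) j)
  obtain ⟨D, hD⟩ := Metric.isBounded_iff.1 hΘ.isBounded
  have hz : ∀ a b, (Sum.elim (x a) (y a) : Fin k ⊕ Fin k → Param q) b ∈ Θ := by
    rintro a (j | l)
    · exact hx a j
    · exact hy a l
  refine ⟨w, w', x, y, W, W', X, Y, max D 1, hG, hG', hw, hw', hw1, hw1', le_max_right _ _,
    fun a b c => ?_, hXΘ, hYΘ, hX, hY, hW, hW'⟩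
  rw [← dist_eq_norm]
  exact (hD (hz a b) (hz a c)).trans (le_max_left _ _)

/-- Strict positivity of the deviation rules out the value `0 / 0 = 0` of the extended ratio. Only
domination of `|Gφ - Hφ|` by `D` matters. -/
theorem exists_pos_eventually_le_inverseRatio {𝒰 : Ultrafilter (DistinctPairs k Θ)}
    {Φ : Set (Param q → ℝ)} {D : Weights q → Weights q → ℝ≥0∞}
    (hD : ∀ G ∈ mixingAtMost k Θ, ∀ G' ∈ mixingAtMost k Θ, ∀ φ ∈ Φ,
      ENNReal.ofReal |integrate G φ - integrate G' φ| ≤ D G G') {r : ℕ}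
    (h : ∃ κ > 0, ∃ φ ∈ Φ, ∀ᶠ a in (𝒰 : Filter (DistinctPairs k Θ)),
      0 < |integrate a.1.1 φ - integrate a.1.2 φ| ∧
      κ * wasserstein r a.1.1 a.1.2 ^ r ≤ |integrate a.1.1 φ - integrate a.1.2 φ|) :
    ∃ c > 0, ∀ᶠ a in (𝒰 : Filter (DistinctPairs k Θ)), c ≤ inverseRatio D r a.1.1 a.1.2 := by
  obtain ⟨κ, hκ, φ, hφ, hev⟩ := h
  refine ⟨ENNReal.ofReal κ, ENNReal.ofReal_pos.2 hκ, ?_⟩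
  filter_upwards [hev] with a ha
  have h1 := hD _ a.2.1 _ a.2.2.1 φ hφ
  rw [inverseRatio, ENNReal.le_div_iff_mul_le (Or.inr ?_) (Or.inl ENNReal.ofReal_ne_top),
    ← ENNReal.ofReal_mul hκ.le]
  · exact (ENNReal.ofReal_le_ofReal ha.2).trans h1
  · exact ((ENNReal.ofReal_pos.2 ha.1).trans_le h1).ne'

theorem LinearIndependentDomain.localInverseBound {Φ : Set (Param q → ℝ)} {k₀ : ℕ}
    (hk₀k : k₀ ≤ k) {r : ℕ} (hr : r + 1 = 2 * (k - k₀ + 1))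
    (hΦ : LinearIndependentDomain Φ Θ U r k₀ k) (hU : IsOpen U) (hΘU : Θ ⊆ U) (hΘ : IsCompact Θ)
    {D : Weights q → Weights q → ℝ≥0∞}
    (hD : ∀ G ∈ mixingAtMost k Θ, ∀ G' ∈ mixingAtMost k Θ, ∀ φ ∈ Φ,
      ENNReal.ofReal |integrate G φ - integrate G' φ| ≤ D G G')
    {G₀ : Weights q} (hG₀ : G₀ ∈ mixingExactly k₀ Θ) : LocalInverseBound D Θ k r G₀ := by
  set F : Filter (Weights q × Weights q) := comap (fun G => wasserstein 1 G G₀) (𝓝 0) ×ˢ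
    comap (fun G => wasserstein 1 G G₀) (𝓝 0) with hF
  have key : ∃ c > 0, ∀ᶠ a in comap (Subtype.val : DistinctPairs k Θ → _) F,
      c ≤ inverseRatio D r a.1.1 a.1.2 := by
    refine exists_pos_eventually_le_of_ultrafilter fun 𝒰 h𝒰 =>
      exists_pos_eventually_le_inverseRatio hD ?_
    obtain ⟨w, w', x, y, W, W', X, Y, d, hG, hG', hw, hw', hw1, hw1', hd, hdiam, hXΘ, hYΘ, hX, hY,
      -, -⟩ := exists_limits hΘ 𝒰
    have hval : Tendsto (Subtype.val : DistinctPairs k Θ → _) 𝒰 F := tendsto_iff_comap.2 h𝒰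
    have hlim1 : Tendsto (fun a : DistinctPairs k Θ => wasserstein 1 a.1.1 G₀) 𝒰 (𝓝 0) :=
      tendsto_comap.comp (tendsto_fst.comp hval)
    have hlim2 : Tendsto (fun a : DistinctPairs k Θ => wasserstein 1 a.1.2 G₀) 𝒰 (𝓝 0) :=
      tendsto_comap.comp (tendsto_snd.comp hval)
    -- If no list entry converged to the atom `t` of `G₀`, all atoms would eventually stay at some
    -- distance `η` from `t`, and transporting the mass `G₀ t` would cost at least `η * G₀ t`.
    have hatom : ∀ (G : DistinctPairs k Θ → Weights q) (v : DistinctPairs k Θ → Fin k → ℝ)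
        (z : DistinctPairs k Θ → Fin k → Param q) (Z : Fin k → Param q),
        (∀ a, G a ∈ mixing Θ) → (∀ a, G a = mixOf (v a) (z a)) →
        (∀ j, Tendsto (fun a => z a j) 𝒰 (𝓝 (Z j))) →
        Tendsto (fun a => wasserstein 1 (G a) G₀) 𝒰 (𝓝 0) →
        ∀ t ∈ G₀.support, ∃ j, Z j = t := by
      intro G v z Z hmix hGz hz hlim t ht
      by_contra! hcon
      have hpos : 0 < G₀ t := lt_of_le_of_ne (hG₀.1.1 t) (Finsupp.mem_support_iff.1 ht).symm
      have hη : ∃ η > 0, ∀ᶠ a in (𝒰 : Filter (DistinctPairs k Θ)), ∀ j, η ≤ ‖z a j - t‖ := by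
        have h1 : ∀ j, ∃ η > 0, ∀ᶠ a in (𝒰 : Filter (DistinctPairs k Θ)), η ≤ ‖z a j - t‖ := by
          intro j
          have h2 : 0 < ‖Z j - t‖ := norm_pos_iff.2 (sub_ne_zero.2 (hcon j))
          exact ⟨‖Z j - t‖ / 2, by positivity,
            ((hz j).sub_const t).norm.eventually (le_mem_nhds (by linarith))⟩
        choose η hη0 hη using h1
        obtain ⟨ε, hε0, hε⟩ : ∃ ε > 0, ∀ j, ε ≤ η j := by
          have : ∀ᶠ ε : ℝ in 𝓝[>] 0, 0 < ε ∧ ∀ j, ε ≤ η j :=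
            Filter.Eventually.and self_mem_nhdsWithin (eventually_all.2 fun j =>
              nhdsWithin_le_nhds (eventually_le_nhds (hη0 j)))
          exact this.exists
        exact ⟨ε, hε0, eventually_all.2 fun j => (hη j).mono fun a ha => (hε j).trans ha⟩
      obtain ⟨η, hη0, hη⟩ := hη
      have hlt : ∀ᶠ a in (𝒰 : Filter (DistinctPairs k Θ)),
          wasserstein 1 (G a) G₀ < η * G₀ t :=
        hlim.eventually (gt_mem_nhds (by positivity))
      obtain ⟨a, h1, h2⟩ := (hη.and hlt).exists
      refine absurd (mul_le_wasserstein_one (hmix a) hG₀.1 ht fun b hb => ?_) (not_le.2 h2)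
      rw [hGz] at hb
      obtain ⟨j, rfl⟩ := mixOf_support_subset _ _ hb
      exact h1 j
    have h := hΦ.exists_pow_wasserstein_le hk₀k hr hU hΘU 𝒰 hw hw' hw1 hw1' hd hdiam hXΘ hYΘ
      hX hY G₀.support hG₀.2 (hatom _ w x X (fun a => a.2.1.1) hG hX hlim1)
      (hatom _ w' y Y (fun a => a.2.2.1.1) hG' hY hlim2) fun a => by
        rw [← hG, ← hG']
        exact a.2.2.2
    simpa only [← hG, ← hG'] using h
  obtain ⟨c, hc, hev⟩ := key
  refine hc.trans_le (le_liminf_of_le (by isBoundedDefault) ?_)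
  rw [pairsTendingTo, eventually_inf_principal]
  rw [eventually_comap] at hev
  filter_upwards [hev] with GG hGG hmem
  exact hGG ⟨GG, hmem⟩ rfl

theorem LinearIndependentDomain.globalInverseBound {Φ : Set (Param q → ℝ)} (hk : 1 ≤ k) {r : ℕ}
    (hr : r + 1 = 2 * k) (hΦ : LinearIndependentDomain Φ Θ U r 1 k) (hU : IsOpen U)
    (hΘU : Θ ⊆ U) (hΘ : IsCompact Θ) {D : Weights q → Weights q → ℝ≥0∞}
    (hD : ∀ G ∈ mixingAtMost k Θ, ∀ G' ∈ mixingAtMost k Θ, ∀ φ ∈ Φ,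
      ENNReal.ofReal |integrate G φ - integrate G' φ| ≤ D G G')
    (hsep : ∀ G ∈ mixingAtMost k Θ, ∀ G' ∈ mixingAtMost k Θ, G ≠ G' →
      ∃ φ ∈ Φ, integrate G φ ≠ integrate G' φ) : GlobalInverseBound D Θ k r := by
  have key : ∃ c > 0, ∀ᶠ a in (⊤ : Filter (DistinctPairs k Θ)),
      c ≤ inverseRatio D r a.1.1 a.1.2 := by
    refine exists_pos_eventually_le_of_ultrafilter fun 𝒰 _ =>
      exists_pos_eventually_le_inverseRatio hD ?_
    obtain ⟨w, w', x, y, W, W', X, Y, d, hG, hG', hw, hw', hw1, hw1', hd, hdiam, hXΘ, hYΘ, hX, hY,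
      hW, hW'⟩ := exists_limits hΘ 𝒰
    have hmix : ∀ {v : DistinctPairs k Θ → Fin k → ℝ} {V : Fin k → ℝ} {Z : Fin k → Param q},
        (∀ a j, 0 ≤ v a j) → (∀ a, ∑ j, v a j = 1) →
        (∀ j, Tendsto (fun a => v a j) 𝒰 (𝓝 (V j))) → (∀ j, Z j ∈ Θ) →
        mixOf V Z ∈ mixingAtMost k Θ := by
      intro v V Z hv hv1 hV hZ
      refine mixOf_mem_mixingAtMost
        (fun j => ge_of_tendsto (hV j) (Eventually.of_forall fun a => hv a j)) ?_ hZ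
      have h := tendsto_finsetSum Finset.univ fun j _ => hV j
      simp only [hv1] at h
      exact tendsto_nhds_unique tendsto_const_nhds h |>.symm
    -- If the limits agree, any common atom serves as the singleton `T₀`. Otherwise a separating `φ`
    -- keeps the deviation above half its limit `e`, while the product plan bounds the cost by `d ^
    -- r`.
    by_cases hlim : mixOf W X = mixOf W' Y
    · have hne : (mixOf W X).support.Nonempty := by
        rw [Finset.nonempty_iff_ne_empty]
        intro h
        have := (hmix hw hw1 hW hXΘ).1.2.1
        simp [h] at this
      obtain ⟨t, ht⟩ := hne
      have ht' : t ∈ (mixOf W' Y).support := hlim ▸ ht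
      have h := hΦ.exists_pow_wasserstein_le hk (by lia) hU hΘU 𝒰 hw hw' hw1 hw1' hd hdiam
        hXΘ hYΘ hX hY {t} (by simp)
        (fun s hs => by rw [Finset.mem_singleton.1 hs]; exact mixOf_support_subset _ _ ht)
        (fun s hs => by rw [Finset.mem_singleton.1 hs]; exact mixOf_support_subset _ _ ht')
        fun a => by
          rw [← hG, ← hG']
          exact a.2.2.2
      simpa only [← hG, ← hG'] using h
    · obtain ⟨φ, hφ, hne⟩ := hsep _ (hmix hw hw1 hW hXΘ) _ (hmix hw' hw1' hW' hYΘ) hlim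
      have hcont : ∀ {v : DistinctPairs k Θ → Fin k → ℝ} {V : Fin k → ℝ}
          {z : DistinctPairs k Θ → Fin k → Param q} {Z : Fin k → Param q},
          (∀ j, Tendsto (fun a => v a j) 𝒰 (𝓝 (V j))) →
          (∀ j, Tendsto (fun a => z a j) 𝒰 (𝓝 (Z j))) → (∀ j, Z j ∈ Θ) →
          Tendsto (fun a => integrate (mixOf (v a) (z a)) φ) 𝒰
            (𝓝 (integrate (mixOf V Z) φ)) := by
        intro v V z Z hv hz hZ
        simp only [integrate_mixOf]
        refine tendsto_finsetSum _ fun j _ => (hv j).mul ?_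
        have hc : ContinuousAt φ (Z j) := (hΦ.contDiffOn φ hφ).continuousOn.continuousAt
          (hU.mem_nhds (hΘU (hZ j)))
        exact hc.tendsto.comp (hz j)
      have hdiff : Tendsto (fun a : DistinctPairs k Θ =>
          |integrate a.1.1 φ - integrate a.1.2 φ|) 𝒰
          (𝓝 |integrate (mixOf W X) φ - integrate (mixOf W' Y) φ|) := by
        simp only [hG, hG']
        exact ((hcont hW hX hXΘ).sub (hcont hW' hY hYΘ)).abs
      set e := |integrate (mixOf W X) φ - integrate (mixOf W' Y) φ| with he
      have he0 : 0 < e := abs_pos.2 (sub_ne_zero.2 hne)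
      have hd0 : 0 < d := by linarith
      refine ⟨e / 2 / d ^ r, by positivity, φ, hφ, ?_⟩
      filter_upwards [hdiff.eventually (lt_mem_nhds (show e / 2 < e by linarith))] with a ha
      refine ⟨lt_of_le_of_lt (by positivity) ha, le_trans ?_ ha.le⟩
      rw [div_mul_eq_mul_div, div_le_iff₀ (by positivity)]
      refine mul_le_mul_of_nonneg_left ?_ (by positivity)
      rw [hG, hG']
      refine (wasserstein_pow_le_of_plan (by lia) (hw a) (hw' a) (x a) (y a)
        (c := fun j l => w a j * w' a l)
        ⟨fun j l => mul_nonneg (hw a j) (hw' a l), fun j => by rw [← Finset.mul_sum, hw1', mul_one],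
          fun l => by rw [← Finset.sum_mul, hw1, one_mul]⟩).trans ?_
      calc ∑ j, ∑ l, w a j * w' a l * ‖x a j - y a l‖ ^ r
          ≤ ∑ j, ∑ l, w a j * w' a l * d ^ r := by
            refine Finset.sum_le_sum fun j _ => Finset.sum_le_sum fun l _ => ?_
            refine mul_le_mul_of_nonneg_left ?_ (mul_nonneg (hw a j) (hw' a l))
            exact pow_le_pow_left₀ (norm_nonneg _) (hdiam a (.inl j) (.inr l)) r
        _ = d ^ r := by
            simp only [← Finset.sum_mul, ← Finset.mul_sum, hw1', mul_one, hw1, one_mul]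
  obtain ⟨c, hc, hev⟩ := key
  refine hc.trans_le (le_iInf₂ fun G hG => le_iInf₂ fun G' hG' => le_iInf fun hne => ?_)
  exact (eventually_top.1 hev) ⟨(G, G'), hG, hG', hne⟩

end InverseBounds

/-! ### The MMD class of a family of densities -/

section MMD

variable {X : Type*} [MeasurableSpace X]

/-- The Jordan parts have the densities `g⁺` and `g⁻`; a measurable version `g'` is substituted in
order to identify them. -/
theorem signedIntegral_withDensityᵥ {ν : Measure X} {g : X → ℝ} (hg : Integrable g ν)
    {f : X → ℝ} (hfg : Integrable (fun x => f x * g x) ν) :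
    signedIntegral (ν.withDensityᵥ g) f = ∫ x, f x * g x ∂ν := by
  obtain ⟨g', hg'm, hgg'⟩ := hg.aestronglyMeasurable.aemeasurable
  have hg' : Integrable g' ν := hg.congr hgg'
  have hfg' : Integrable (fun x => f x * g' x) ν :=
    hfg.congr (hgg'.mono fun x hx => by simp only [hx])
  have h := SignedMeasure.toJordanDecomposition_eq_of_eq_add_withDensity (μ := ν)
    (t := (0 : SignedMeasure X)) hg'm hg' VectorMeasure.MutuallySingular.zero_left
    (zero_add _).symm
  rw [WithDensityᵥEq.congr_ae hgg', signedIntegral, h]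
  simp only [SignedMeasure.toJordanDecomposition_zero, JordanDecomposition.zero_posPart,
    JordanDecomposition.zero_negPart, zero_add]
  have hneg : Measurable fun x => ENNReal.ofReal (-g' x) := hg'm.neg.ennreal_ofReal
  rw [integral_withDensity_eq_integral_toReal_smul hg'm.ennreal_ofReal
      (Eventually.of_forall fun _ => ENNReal.ofReal_lt_top),
    integral_withDensity_eq_integral_toReal_smul hneg
      (Eventually.of_forall fun _ => ENNReal.ofReal_lt_top), ← integral_sub]
  · refine integral_congr_ae ?_
    filter_upwards [hgg'] with x hx
    simp only [ENNReal.toReal_ofReal', smul_eq_mul, hx]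
    rcases le_total 0 (g' x) with h0 | h0
    · rw [max_eq_left h0, max_eq_right (by linarith)]; ring
    · rw [max_eq_right h0, max_eq_left (by linarith)]; ring
  · refine hfg'.abs.mono' ?_ (Eventually.of_forall fun x => ?_)
    -- Only the product `f * g'` is known to be measurable almost everywhere, so `f * g'⁺` is
    -- written as its restriction to `{0 ≤ g'}`.
    · have : (fun x => (ENNReal.ofReal (g' x)).toReal • f x) =
          fun x => Set.indicator {x | 0 ≤ g' x} (fun x => f x * g' x) x := by
        funext x
        by_cases h0 : 0 ≤ g' x
        · simp [h0, mul_comm]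
        · simp [h0, max_eq_right (not_le.1 h0).le, ENNReal.toReal_ofReal']
      rw [this]
      exact hfg'.aestronglyMeasurable.indicator (measurableSet_le measurable_const hg'm)
    · rw [ENNReal.toReal_ofReal', smul_eq_mul, Real.norm_eq_abs, abs_mul, abs_mul, mul_comm]
      refine mul_le_mul_of_nonneg_left ?_ (abs_nonneg _)
      rw [abs_of_nonneg (le_max_right _ _)]
      exact max_le (le_abs_self _) (abs_nonneg _)
  · refine hfg'.abs.mono' ?_ (Eventually.of_forall fun x => ?_)
    · have : (fun x => (ENNReal.ofReal (-g' x)).toReal • f x) =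
          fun x => Set.indicator {x | g' x ≤ 0} (fun x => -(f x * g' x)) x := by
        funext x
        by_cases h0 : g' x ≤ 0
        · simp [h0, mul_comm]
        · simp [h0, max_eq_right (by linarith [not_le.1 h0] : -g' x ≤ 0),
            ENNReal.toReal_ofReal']
      rw [this]
      exact hfg'.aestronglyMeasurable.neg.indicator (measurableSet_le hg'm measurable_const)
    · rw [ENNReal.toReal_ofReal', smul_eq_mul, Real.norm_eq_abs, abs_mul, abs_mul, mul_comm]
      refine mul_le_mul_of_nonneg_left ?_ (abs_nonneg _)
      rw [abs_of_nonneg (le_max_right _ _)]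
      exact max_le (neg_le_abs _) (abs_nonneg _)

variable {H : Type*} [NormedAddCommGroup H] [InnerProductSpace ℝ H] [CompleteSpace H]
  [RKHS ℝ H X ℝ]

theorem BoundedMeasurableKernel.exists_abs_apply_le (hH : BoundedMeasurableKernel H) (h : H) :
    ∃ C : ℝ, ∀ x : X, |h x| ≤ C := by
  obtain ⟨C, hC⟩ := hH.bounded
  exact ⟨C * ‖h‖, fun x =>
    (abs_apply_le h x).trans (mul_le_mul_of_nonneg_right (hC x) (norm_nonneg h))⟩

theorem BoundedMeasurableKernel.integrable_mul (hH : BoundedMeasurableKernel H) (h : H)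
    {ν : Measure X} {g : X → ℝ} (hg : Integrable g ν) : Integrable (fun x => h x * g x) ν := by
  obtain ⟨C, hC⟩ := hH.exists_abs_apply_le h
  exact hg.bdd_mul (hH.measurable_apply h).aestronglyMeasurable (Eventually.of_forall hC)

/-- An integrable function against which all of `H` integrates to zero vanishes almost
everywhere, if the kernel mean embedding is injective. -/
theorem ae_eq_zero_of_forall_integral_eq_zero (hH : BoundedMeasurableKernel H)
    (hμ : Function.Injective (meanEmbedding hH)) {ν : Measure X} {g : X → ℝ}
    (hg : Integrable g ν) (h0 : ∀ h : H, ‖h‖ ≤ 1 → ∫ x, h x * g x ∂ν = 0) : g =ᵐ[ν] 0 := by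
  -- Rescaling by `‖h‖ + 1`, which is never zero, extends the hypothesis from the unit ball to `H`.
  have hall : ∀ h : H, ∫ x, h x * g x ∂ν = 0 := by
    intro h
    have hpos : 0 < ‖h‖ + 1 := by positivity
    have hn : ‖(‖h‖ + 1)⁻¹ • h‖ ≤ 1 := by
      rw [norm_smul, norm_inv, Real.norm_of_nonneg hpos.le, ← div_eq_inv_mul, div_le_one hpos]
      linarith
    have := h0 _ hn
    simp only [RKHS.coe_smul, Pi.smul_apply, smul_eq_mul, mul_assoc] at this
    rw [integral_const_mul] at this
    exact (mul_eq_zero.1 this).resolve_left (inv_ne_zero hpos.ne')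
  have heq : meanEmbedding hH (ν.withDensityᵥ g) = meanEmbedding hH 0 := by
    refine ext_inner_right ℝ fun h => ?_
    rw [inner_meanEmbedding, inner_meanEmbedding,
      signedIntegral_withDensityᵥ hg (hH.integrable_mul h hg), hall]
    simp [signedIntegral, SignedMeasure.toJordanDecomposition_zero]
  refine hg.ae_eq_of_withDensityᵥ_eq (integrable_zero _ _ _) ?_
  rw [withDensityᵥ_zero]
  exact hμ heq

variable {q : ℕ} {Θ U : Set (Param q)} {ν : Measure X} {p : Param q → X → ℝ}
  {P : Param q → Measure X}

theorem DominatedDerivatives.mul_left {m : ℕ} (hp : DominatedDerivatives ν p U m) {f : X → ℝ}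
    {C : ℝ} (hf : ∀ x, |f x| ≤ C) : DominatedDerivatives ν (fun θ x => f x * p θ x) U m := by
  refine ⟨?_, fun γ hγ i θ hθ => ?_, fun γ hγ θ hθ => ?_⟩
  · filter_upwards [hp.contDiffOn] with x hx using contDiffOn_const.mul hx
  · obtain ⟨δ, hδ, ψ, hψ, h⟩ := hp.quotient γ hγ i θ hθ
    refine ⟨δ, hδ, fun x => C * ψ x, hψ.const_mul C, fun t ht0 ht => ?_⟩
    filter_upwards [h t ht0 ht] with x hx
    simp only [multiDeriv_const_mul]
    rw [← mul_sub, mul_div_assoc, abs_mul]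
    exact mul_le_mul (hf x) hx (abs_nonneg _) ((abs_nonneg _).trans (hf x))
  · obtain ⟨δ, hδ, ψ, hψ, h⟩ := hp.increment γ hγ θ hθ
    refine ⟨δ, hδ, fun x => C * ψ x, hψ.const_mul C, fun v hv0 hv => ?_⟩
    filter_upwards [h v hv0 hv] with x hx
    simp only [multiDeriv_const_mul]
    rw [← mul_sub, abs_mul]
    exact mul_le_mul (hf x) hx (abs_nonneg _) ((abs_nonneg _).trans (hf x))

/-- Under the integral, a relation among the derivatives of the test function of `f` becomes `f`
integrated against the same relation for `p`. If this holds on the whole unit ball, injectivity of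
the embedding makes the relation hold almost everywhere. -/
theorem LinearIndependentFamily.linearIndependentDomain (hH : BoundedMeasurableKernel H)
    (hμ : Function.Injective (meanEmbedding hH)) (hU : IsOpen U) (hΘU : Θ ⊆ U)
    (hint : ∀ θ ∈ U, Integrable (p θ) ν) {m k₀ k : ℕ} (hp : DominatedDerivatives ν p U m)
    (hind : LinearIndependentFamily ν p Θ U m k₀ k) :
    LinearIndependentDomain (mmdClass H ν p) Θ U m k₀ k := by
  have hdom : ∀ f : H, DominatedDerivatives ν (fun θ x => f x * p θ x) U m := fun f =>
    hp.mul_left (hH.exists_abs_apply_le f).choose_spec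
  have hfint : ∀ f : H, ∀ θ ∈ U, Integrable (fun x => f x * p θ x) ν := fun f θ hθ =>
    hH.integrable_mul f (hint θ hθ)
  refine ⟨?_, fun l hl hl' ord hord hsum hsum' θ hθ hθΘ a => ⟨fun h => ?_, fun h => ?_⟩⟩
  · rintro _ ⟨f, -, rfl⟩
    exact (hdom f).contDiffOn_integral hU (hfint f)
  · refine (hind.independent l hl hl' ord hord hsum hsum' θ hθ hθΘ a).1 ⟨?_, h.2⟩
    have hDint : ∀ i, ∀ α ∈ multiIndices q (ord i),
        Integrable (fun x => multiDeriv α (fun η => p η x) (θ i)) ν := by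
      intro i α hα
      rw [mem_multiIndices] at hα
      exact hp.integrable_multiDeriv hU hint α (by have := (hord i).2; lia) _ (hΘU (hθΘ i))
    refine ae_eq_zero_of_forall_integral_eq_zero hH hμ
      (integrable_finsetSum _ fun i _ => integrable_finsetSum _ fun α hα =>
        (hDint i α hα).const_mul _) fun f hf => ?_
    rw [← h.1 _ ⟨f, hf, rfl⟩]
    simp only [Finset.mul_sum]
    rw [integral_finsetSum _ fun i _ => integrable_finsetSum _ fun α hα =>
      hH.integrable_mul f ((hDint i α hα).const_mul _)]
    refine Finset.sum_congr rfl fun i _ => ?_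
    rw [integral_finsetSum _ fun α hα => hH.integrable_mul f ((hDint i α hα).const_mul _)]
    refine Finset.sum_congr rfl fun α hα => ?_
    rw [mem_multiIndices] at hα
    rw [(hdom f).multiDeriv_integral hU (hfint f) α (by have := (hord i).2; lia) (hΘU (hθΘ i)),
      ← integral_const_mul]
    simp only [multiDeriv_const_mul]
    exact integral_congr_ae (Eventually.of_forall fun x => by ring)
  · refine ⟨fun φ _ => Finset.sum_eq_zero fun i _ => Finset.sum_eq_zero fun α hα => ?_,
      Finset.sum_eq_zero fun i _ => h i 0 (mem_multiIndices.2 ?_)⟩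
    · rw [h i α hα, zero_mul]
    · simpa using Nat.lt_of_lt_of_le Nat.zero_lt_one (hord i).1

theorem DensityModel.integral_mixture (hH : BoundedMeasurableKernel H)
    (hM : DensityModel ν p P Θ U) {G : Weights q} (hG : G ∈ mixing Θ) (h : H) :
    ∫ x, h x ∂(mixture P G) = integrate G fun θ => ∫ x, h x * p θ x ∂ν := by
  have hint : ∀ θ ∈ G.support, Integrable (fun x => h x) (P θ) := fun θ hθ => by
    have := hM.isProbability θ (hG.2.2 hθ)
    exact hH.integrable _ h
  rw [mixture, integral_finsetSum_measure fun θ hθ =>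
    (hint θ hθ).smul_measure ENNReal.ofReal_ne_top]
  refine Finset.sum_congr rfl fun θ hθ => ?_
  rw [integral_smul_measure, ENNReal.toReal_ofReal (hG.1 θ), ← hM.integral_eq _ (hG.2.2 hθ),
    smul_eq_mul]

/-- The members of the MMD class bound the maximum mean discrepancy of mixtures from below. -/
theorem DensityModel.ofReal_le_mmd (hH : BoundedMeasurableKernel H)
    (hM : DensityModel ν p P Θ U) {G G' : Weights q} (hG : G ∈ mixing Θ) (hG' : G' ∈ mixing Θ)
    {φ : Param q → ℝ} (hφ : φ ∈ mmdClass H ν p) :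
    ENNReal.ofReal |integrate G φ - integrate G' φ| ≤ mmd H (mixture P G) (mixture P G') := by
  obtain ⟨f, hf, rfl⟩ := hφ
  rw [← hM.integral_mixture hH hG, ← hM.integral_mixture hH hG']
  -- The discrepancy is a supremum over the unit sphere, the class comes from the unit ball: a
  -- nonzero `f` is rescaled outwards, and `f = 0` contributes nothing.
  rcases eq_or_ne f 0 with rfl | hf0
  · simp
  · have hpos : 0 < ‖f‖ := norm_pos_iff.2 hf0
    refine le_trans ?_ (le_iSup₂_of_le (‖f‖⁻¹ • f) (norm_smul_inv_norm hf0) le_rfl)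
    refine ENNReal.ofReal_le_ofReal ?_
    simp only [RKHS.coe_smul, Pi.smul_apply, smul_eq_mul]
    rw [integral_const_mul, integral_const_mul, ← mul_sub, abs_mul,
      abs_of_pos (inv_pos.2 hpos)]
    exact le_mul_of_one_le_left (abs_nonneg _) ((one_le_inv₀ hpos).2 hf)

theorem DensityModel.mixture_eq_withDensity (hM : DensityModel ν p P Θ U) {G : Weights q}
    (hG : G ∈ mixing Θ) :
    mixture P G = ν.withDensity fun x => ENNReal.ofReal (∑ θ ∈ G.support, G θ * p θ x) := by
  have hmeas : ∀ θ ∈ G.support, AEMeasurable (fun x => ENNReal.ofReal (p θ x)) ν := fun θ hθ =>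
    (hM.integrable θ (hM.subset (hG.2.2 hθ))).aestronglyMeasurable.aemeasurable.ennreal_ofReal
  have h0 : ∀ᵐ x ∂ν, ∀ θ ∈ G.support, 0 ≤ p θ x :=
    (ae_ball_iff G.support.countable_toSet).2 fun θ hθ => hM.nonneg θ (hG.2.2 hθ)
  have hae : (fun x => ENNReal.ofReal (∑ θ ∈ G.support, G θ * p θ x)) =ᵐ[ν]
      fun x => ∑ θ ∈ G.support, ENNReal.ofReal (G θ) * ENNReal.ofReal (p θ x) := by
    filter_upwards [h0] with x hx
    rw [ENNReal.ofReal_sum_of_nonneg fun θ hθ => mul_nonneg (hG.1 θ) (hx θ hθ)]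
    exact Finset.sum_congr rfl fun θ _ => ENNReal.ofReal_mul (hG.1 θ)
  rw [withDensity_congr_ae hae]
  ext s hs
  rw [withDensity_apply _ hs, lintegral_finsetSum' _ fun θ hθ =>
    ((hmeas θ hθ).restrict).const_mul _, mixture, Measure.finsetSum_apply]
  refine Finset.sum_congr rfl fun θ hθ => ?_
  rw [lintegral_const_mul'' _ (hmeas θ hθ).restrict, Measure.smul_apply,
    hM.density θ (hG.2.2 hθ), withDensity_apply _ hs, smul_eq_mul]

/-- The MMD class separates distinct mixtures. -/
theorem DensityModel.exists_integrate_ne (hH : BoundedMeasurableKernel H)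
    (hμ : Function.Injective (meanEmbedding hH)) (hM : DensityModel ν p P Θ U)
    {G G' : Weights q} (hG : G ∈ mixing Θ) (hG' : G' ∈ mixing Θ)
    (hne : mixture P G ≠ mixture P G') :
    ∃ φ ∈ mmdClass H ν p, integrate G φ ≠ integrate G' φ := by
  by_contra! hcon
  apply hne
  have hint : ∀ {G : Weights q}, G ∈ mixing Θ →
      Integrable (fun x => ∑ θ ∈ G.support, G θ * p θ x) ν := fun hG =>
    integrable_finsetSum _ fun θ hθ => (hM.integrable θ (hM.subset (hG.2.2 hθ))).const_mul _
  have hI : ∀ {G : Weights q}, G ∈ mixing Θ → ∀ h : H,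
      ∫ x, h x * ∑ θ ∈ G.support, G θ * p θ x ∂ν =
        integrate G fun θ => ∫ x, h x * p θ x ∂ν := by
    intro G hG h
    simp only [Finset.mul_sum, integrate]
    rw [integral_finsetSum _ fun θ hθ => hH.integrable_mul h
      ((hM.integrable θ (hM.subset (hG.2.2 hθ))).const_mul _)]
    refine Finset.sum_congr rfl fun θ _ => ?_
    rw [← integral_const_mul]
    exact integral_congr_ae (Eventually.of_forall fun x => by ring)
  have h := ae_eq_zero_of_forall_integral_eq_zero hH hμ ((hint hG).sub (hint hG')) fun f hf => by
    simp only [Pi.sub_apply, mul_sub]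
    rw [integral_sub (hH.integrable_mul f (hint hG)) (hH.integrable_mul f (hint hG')), hI hG,
      hI hG', hcon _ ⟨f, hf, rfl⟩, sub_self]
  rw [hM.mixture_eq_withDensity hG, hM.mixture_eq_withDensity hG']
  refine withDensity_congr_ae ?_
  filter_upwards [h] with x hx
  have hx' : (∑ θ ∈ G.support, G θ * p θ x) - ∑ θ ∈ G'.support, G' θ * p θ x = 0 := hx
  rw [sub_eq_zero.1 hx']

end MMD

end MMDMixture

end

/-! ### The local and global inverse bounds for the MMD class -/

theorem mainTheorem12 {X : Type*} [MeasurableSpace X]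
    {H : Type*} [NormedAddCommGroup H] [InnerProductSpace ℝ H] [CompleteSpace H] [RKHS ℝ H X ℝ]
    (hH : MMDMixture.BoundedMeasurableKernel H)
    (hμ : Function.Injective (MMDMixture.meanEmbedding hH))
    {q : ℕ} (Θ U : Set (MMDMixture.Param q)) (hΘ : IsCompact Θ)
    (ν : Measure X) (p : MMDMixture.Param q → X → ℝ) (P : MMDMixture.Param q → Measure X)
    (hM : MMDMixture.DensityModel ν p P Θ U) (k : ℕ) (hk : 1 ≤ k) :
    (∀ k₀ : ℕ, 1 ≤ k₀ → k₀ ≤ k → ∀ d₁ : ℕ, d₁ = k - k₀ + 1 →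
      MMDMixture.DominatedDerivatives ν p U (2 * d₁ - 1) →
      MMDMixture.LinearIndependentFamily ν p Θ U (2 * d₁ - 1) k₀ k →
        MMDMixture.LinearIndependentDomain (MMDMixture.mmdClass H ν p) Θ U (2 * d₁ - 1) k₀ k ∧
        ∀ G₀ ∈ MMDMixture.mixingExactly k₀ Θ,
          MMDMixture.LocalInverseBound
            (MMDMixture.testDistance (MMDMixture.mmdClass H ν p)) Θ k (2 * d₁ - 1) G₀ ∧
          MMDMixture.LocalInverseBound
            (fun G G' => MMDMixture.mmd H (MMDMixture.mixture P G) (MMDMixture.mixture P G'))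
            Θ k (2 * d₁ - 1) G₀) ∧
    (MMDMixture.DominatedDerivatives ν p U (2 * k - 1) →
      MMDMixture.LinearIndependentFamily ν p Θ U (2 * k - 1) 1 k →
        MMDMixture.LinearIndependentDomain (MMDMixture.mmdClass H ν p) Θ U (2 * k - 1) 1 k ∧
        (Set.InjOn (MMDMixture.mixture P) (MMDMixture.mixingAtMost k Θ) →
          MMDMixture.GlobalInverseBound
            (MMDMixture.testDistance (MMDMixture.mmdClass H ν p)) Θ k (2 * k - 1) ∧
          MMDMixture.GlobalInverseBound
            (fun G G' => MMDMixture.mmd H (MMDMixture.mixture P G) (MMDMixture.mixture P G'))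
            Θ k (2 * k - 1))) := by
  -- The inverse bounds only use that a deviation dominates `|Gφ - G'φ|` on the class, so the test
  -- distance and the discrepancy are handled alike, without proving them equal.
  have hle_test : ∀ G ∈ MMDMixture.mixingAtMost k Θ, ∀ G' ∈ MMDMixture.mixingAtMost k Θ,
      ∀ φ ∈ MMDMixture.mmdClass H ν p,
      ENNReal.ofReal |MMDMixture.integrate G φ - MMDMixture.integrate G' φ| ≤
        MMDMixture.testDistance (MMDMixture.mmdClass H ν p) G G' :=
    fun G _ G' _ φ hφ => le_iSup₂_of_le φ hφ le_rfl
  have hle_mmd : ∀ G ∈ MMDMixture.mixingAtMost k Θ, ∀ G' ∈ MMDMixture.mixingAtMost k Θ,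
      ∀ φ ∈ MMDMixture.mmdClass H ν p,
      ENNReal.ofReal |MMDMixture.integrate G φ - MMDMixture.integrate G' φ| ≤
        MMDMixture.mmd H (MMDMixture.mixture P G) (MMDMixture.mixture P G') :=
    fun G hG G' hG' φ hφ => hM.ofReal_le_mmd hH hG.1 hG'.1 hφ
  refine ⟨fun k₀ _ hk₀k d₁ hd₁ hp hind => ?_, fun hp hind => ?_⟩
  · have hΦ := hind.linearIndependentDomain hH hμ hM.isOpen hM.subset hM.integrable hp
    have hr : 2 * d₁ - 1 + 1 = 2 * (k - k₀ + 1) := by lia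
    exact ⟨hΦ, fun G₀ hG₀ =>
      ⟨hΦ.localInverseBound hk₀k hr hM.isOpen hM.subset hΘ hle_test hG₀,
        hΦ.localInverseBound hk₀k hr hM.isOpen hM.subset hΘ hle_mmd hG₀⟩⟩
  · have hΦ := hind.linearIndependentDomain hH hμ hM.isOpen hM.subset hM.integrable hp
    have hr : 2 * k - 1 + 1 = 2 * k := by lia
    refine ⟨hΦ, fun hinj => ?_⟩
    have hsep : ∀ G ∈ MMDMixture.mixingAtMost k Θ, ∀ G' ∈ MMDMixture.mixingAtMost k Θ, G ≠ G' →
        ∃ φ ∈ MMDMixture.mmdClass H ν p,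
          MMDMixture.integrate G φ ≠ MMDMixture.integrate G' φ := fun G hG G' hG' hne =>
      hM.exists_integrate_ne hH hμ hG.1 hG'.1 fun h => hne (hinj hG hG' h)
    exact ⟨hΦ.globalInverseBound hk hr hM.isOpen hM.subset hΘ hle_test hsep,
      hΦ.globalInverseBound hk hr hM.isOpen hM.subset hΘ hle_mmd hsep⟩
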